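/- Let $\mathcal C$ be a small $\mathbb C$-linear category. For $n\ge 0$ let $CN^n(\mathcal C)$ be the space of families $\phi$ of multilinear forms $\phi(f^0\otimes\cdots\otimes f^n)$ on tuples $f^0\in \mathrm{Hom}(X_1,X_0),\ f^1\in\mathrm{Hom}(X_2,X_1),\dots,f^n\in \mathrm{Hom}(X_0,X_n)$, with $(b\phi)(f^0\otimes\cdots\otimes f^{n+1})=\sum_{i=0}^{n}(-1)^i\phi(\cdots\otimes f^if^{i+1}\otimes\cdots)+(-1)^{n+1}\phi(f^{n+1}f^0\otimes f^1\otimes\cdots\otimes f^n)$ and $(\lambda\phi)(f^0\otimes\cdots\otimes f^n)=(-1)^n\phi(f^n\otimes f^0\otimes\cdots\otimes f^{n-1})$. Let $Z^n_\lambda(\mathcal C)=\ker(1-\lambda)\cap\ker b$ and let $H^n_\lambda(\mathcal C)$ be the cohomology of $(\ker(1-\lambda),b)$. An $n$-dimensional cycle over $\mathcal C$ consists of an ($\mathbb N$-graded) DG-semicategory $(\mathcal S,\hat\partial)$ (a $\mathbb C$-linear DG-category possibly without identities), a $\mathbb C$-linear semifunctor $\rho:\mathcal C\to\mathcal S^0$,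 and a closed graded trace of dimension $n$, i.e. linear maps $\hat T_X:\mathrm{Hom}^n_{\mathcal S}(X,X)\to\mathbb C$ with $\hat T_X(\hat\partial f)=0$ and $\hat T_X(gg')=(-1)^{ij}\hat T_Y(g'g)$ for $g\in \mathrm{Hom}^i_{\mathcal S}(Y,X)$, $g'\in\mathrm{Hom}^j_{\mathcal S}(X,Y)$, $i+j=n$. Its character is $\phi(f^0\otimes\cdots\otimes f^n)=\hat T(\rho(f^0)\hat\partial\rho(f^1)\cdots\hat\partial\rho(f^n))$. If $\phi$ and $\phi'$ are the characters of an $r$-dimensional cycle $(\mathcal S,\hat\partial,\hat T,\rho)$ over $\mathcal C$ and of an $s$-dimensional cycle $(\mathcal S',\hat\partial',\hat T',\rho')$ over $\mathcal C'$, then $\phi\#\phi'$ is the character of the $(r+s)$-dimensional cycle $(\mathcal S\otimes\mathcal S',\hat\partial\otimes\hat\partial',\hat T\#\hat T',\rho\otimes\rho')$ over $\mathcal C\otimes\mathcal C'$, where $\hat T\#\hat T'$ is $\hat T\otimes \hat T'$ on the summand of bidegree $(r,s)$ and $0$ on the others. The periodicity operator is $S(\phi)=\phi\#\psi$, regarded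 as a cochain on $\mathcal C\cong\mathcal C\otimes\mathbb C$ ($f\leftrightarrow f\otimes 1$), where $\psi$ is the cyclic $2$-cocycle on $\mathbb C$ (the category with one object) with $\psi(1,1,1)=1$. Let $1\le p<\infty$ and let $(\mathscr H,\mathcal F)$ be a $p$-summable even Fredholm module over $\mathcal C$: $\mathscr H$ is a $\mathbb C$-linear functor from $\mathcal C$ to $\mathbb Z/2$-graded separable Hilbert spaces and bounded operators such that every $\mathscr H(f)$ has degree $0$, and $\mathcal F=\{\mathcal F_X\}$ is a family of bounded operators on the spaces $\mathscr H(X)$, of degree $1$ and with $\mathcal F_X^2=\mathrm{id}$, such that $[\mathcal F,f]:=\mathcal F_Y\mathscr H(f)-\mathscr H(f)\mathcal F_X$ lies in the Schatten class $\mathcal B^p$ for every $f\in \mathrm{Hom}_{\mathcal C}(X,Y)$. Let $\epsilon$ be the grading operators, $\mathrm{Tr}$ the operator trace and $\mathrm{Tr}_s(T)=\frac12\mathrm{Tr}(\epsilon\mathcal F[\mathcal F,T])$, where $[\mathcal F,T]=\mathcal F T-T\mathcal F$ for $T$ of even degree. Let $m\ge 0$ be an integer with $2m\ge p-1$, and for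 $n\in\{2m,2m+2\}$ put $$\phi^{n}(f^0\otimes\cdots\otimes f^{n})=\mathrm{Tr}_s\big(\mathscr H(f^0)[\mathcal F,f^1]\cdots[\mathcal F,f^{n}]\big).$$ Then for both values of $n$ the operators $[\mathcal F,\mathscr H(f^0)[\mathcal F,f^1]\cdots[\mathcal F,f^{n}]]$ are of trace class and $\phi^{n}$ is a cyclic cocycle; $S(\phi^{2m})\in Z^{2m+2}_\lambda(\mathcal C)$ exists and does not depend on the cycles by which $\phi^{2m}$ and $\psi$ are represented; and $$S(\phi^{2m})=-(m+1)\,\phi^{2m+2}\qquad\text{in } H^{2m+2}_\lambda(\mathcal C).$$ -/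

import Mathlib

universe u v w a b a' b'

open CategoryTheory
open scoped TensorProduct DirectSum

noncomputable section

namespace CatFredholm

/-! ## The cyclic nerve of a linear category and its cyclic cohomology -/

section Nerve

variable {C : Type u} [Category.{v} C]

/-- `Chain n X Y` is the set of tuples `(f⁰, f¹, …, fⁿ)` of `n + 1` composable morphisms
`f⁰ : X₁ ⟶ X`, `f¹ : X₂ ⟶ X₁`, …, `fⁿ : Y ⟶ Xₙ`. The product `fⁱ fⁱ⁺¹` is the composite
`fⁱ ∘ fⁱ⁺¹`, i.e. `fⁱ⁺¹ ≫ fⁱ`. The cyclically composable tuples, which span the degree `n` part of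
the cyclic nerve, are the elements of `Chain n X X`. -/
inductive Chain {C : Type u} [Category.{v} C] : ℕ → C → C → Type (max u v)
  | single {X Y : C} (f : Y ⟶ X) : Chain 0 X Y
  | cons {n : ℕ} {X Y Z : C} (f : Z ⟶ X) (c : Chain n Z Y) : Chain (n + 1) X Y

namespace Chain

/-- `(f⁰, …, fⁿ⁺¹) ↦ (f⁰, …, fⁱ fⁱ⁺¹, …, fⁿ⁺¹)`, for `0 ≤ i ≤ n`. -/
def contract : {n : ℕ} → {X Y : C} → Chain (n + 1) X Y → Fin (n + 1) → Chain n X Y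
  | 0, _, _, .cons f (.single g), _ => .single (g ≫ f)
  | _ + 1, _, _, .cons f (.cons g c), i =>
      Fin.cases (.cons (g ≫ f) c) (fun j => .cons f (contract (.cons g c) j)) i

/-- `(f⁰, …, fⁿ⁺¹) ↦ ((f⁰, …, fⁿ), fⁿ⁺¹)`. -/
def splitLast : {n : ℕ} → {X Y : C} → Chain (n + 1) X Y → Σ W : C, Chain n X W × (Y ⟶ W)
  | 0, _, _, .cons (Z := Z) f (.single g) => ⟨Z, .single f, g⟩
  | _ + 1, _, _, .cons f (.cons g c) =>
      let r := splitLast (.cons g c)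
      ⟨r.1, .cons f r.2.1, r.2.2⟩

/-- `(f⁰, …, fⁿ) ↦ (fⁿ, f⁰, …, fⁿ⁻¹)` on cyclically composable tuples. -/
def rotate : {n : ℕ} → {X : C} → Chain n X X → Σ W : C, Chain n W W
  | 0, X, c => ⟨X, c⟩
  | _ + 1, _, c =>
      let r := splitLast c
      ⟨r.1, .cons r.2.2 r.2.1⟩

end Chain

variable (C) in
/-- Complex valued functions on the cyclically composable `(n + 1)`-tuples of morphisms. -/
abbrev NerveFun (n : ℕ) : Type (max u v) := ∀ X : C, Chain n X X → ℂ

/-- `(δᵢ φ)(f⁰ ⊗ … ⊗ fⁿ⁺¹) = φ(f⁰ ⊗ … ⊗ fⁱ fⁱ⁺¹ ⊗ … ⊗ fⁿ⁺¹)` for `0 ≤ i ≤ n`. -/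
def innerFace (n : ℕ) (i : Fin (n + 1)) : NerveFun C n →ₗ[ℂ] NerveFun C (n + 1) where
  toFun φ X c := φ X (c.contract i)
  map_add' _ _ := rfl
  map_smul' _ _ := rfl

/-- `(δₙ₊₁ φ)(f⁰ ⊗ … ⊗ fⁿ⁺¹) = φ(fⁿ⁺¹ f⁰ ⊗ f¹ ⊗ … ⊗ fⁿ)`. -/
def lastFace (n : ℕ) : NerveFun C n →ₗ[ℂ] NerveFun C (n + 1) where
  toFun φ _ c := φ c.rotate.1 (c.rotate.2.contract 0)
  map_add' _ _ := rfl
  map_smul' _ _ := rfl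

/-- The Hochschild differential `b = ∑ᵢ (-1)ⁱ δᵢ`, the sum being over `0 ≤ i ≤ n + 1`. -/
def hochschild (n : ℕ) : NerveFun C n →ₗ[ℂ] NerveFun C (n + 1) :=
  (∑ i : Fin (n + 1), (-1 : ℂ) ^ (i : ℕ) • innerFace n i) + (-1 : ℂ) ^ (n + 1) • lastFace n

/-- The signed cyclic operator `(λ φ)(f⁰ ⊗ … ⊗ fⁿ) = (-1)ⁿ φ(fⁿ ⊗ f⁰ ⊗ … ⊗ fⁿ⁻¹)`. -/
def signedCyclic (n : ℕ) : NerveFun C n →ₗ[ℂ] NerveFun C n where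
  toFun φ _ c := (-1 : ℂ) ^ n * φ c.rotate.1 c.rotate.2
  map_add' _ _ := by funext X c; simp [mul_add]
  map_smul' _ _ := by funext X c; simp [mul_left_comm]

variable [Preadditive C] [Linear ℂ C]

/-- Linearity in each of the morphisms of the tuple. -/
def IsMultilinear : {n : ℕ} → {X Y : C} → (Chain n X Y → ℂ) → Prop
  | 0, X, Y, Φ => IsLinearMap ℂ fun f : Y ⟶ X => Φ (.single f)
  | n + 1, X, Y, Φ =>
      (∀ (Z : C) (c : Chain n Z Y), IsLinearMap ℂ fun f : Z ⟶ X => Φ (.cons f c)) ∧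
      ∀ (Z : C) (f : Z ⟶ X), IsMultilinear fun c : Chain n Z Y => Φ (.cons f c)

theorem isMultilinear_zero : ∀ {n : ℕ} {X Y : C}, IsMultilinear (fun _ : Chain n X Y => (0 : ℂ))
  | 0, _, _ => (0 : _ →ₗ[ℂ] ℂ).isLinear
  | _ + 1, _, _ => ⟨fun _ _ => (0 : _ →ₗ[ℂ] ℂ).isLinear, fun _ _ => isMultilinear_zero⟩

theorem IsMultilinear.add : ∀ {n : ℕ} {X Y : C} {Φ Ψ : Chain n X Y → ℂ},
    IsMultilinear Φ → IsMultilinear Ψ → IsMultilinear (fun c => Φ c + Ψ c)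
  | 0, _, _, _, _, h, k => ((h.mk' _) + (k.mk' _)).isLinear
  | _ + 1, _, _, _, _, h, k =>
      ⟨fun Z c => (((h.1 Z c).mk' _) + ((k.1 Z c).mk' _)).isLinear,
        fun Z f => (h.2 Z f).add (k.2 Z f)⟩

theorem IsMultilinear.smul (t : ℂ) : ∀ {n : ℕ} {X Y : C} {Φ : Chain n X Y → ℂ},
    IsMultilinear Φ → IsMultilinear (fun c => t * Φ c)
  | 0, _, _, _, h => (t • (h.mk' _)).isLinear
  | _ + 1, _, _, _, h =>
      ⟨fun Z c => (t • ((h.1 Z c).mk' _)).isLinear, fun Z f => (h.2 Z f).smul t⟩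

variable (C)

/-- `CNⁿ(C) = Hom(CNₙ(C), ℂ)`, where `CNₙ(C)` is the direct sum over all `(X₀, …, Xₙ)` of
`Hom(X₁, X₀) ⊗ Hom(X₂, X₁) ⊗ … ⊗ Hom(X₀, Xₙ)`: a linear form on this sum of tensor products is a
family of multilinear forms on the cyclically composable tuples. -/
def cochains (n : ℕ) : Submodule ℂ (NerveFun C n) where
  carrier := {φ | ∀ X, IsMultilinear (φ X)}
  zero_mem' _ := isMultilinear_zero
  add_mem' h k X := (h X).add (k X)
  smul_mem' t _ h X := (h X).smul t

/-- `C^n_λ(C) = Ker (1 - λ) ⊆ CNⁿ(C)`. -/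
def cyclicCochains (n : ℕ) : Submodule ℂ (NerveFun C n) :=
  cochains C n ⊓ LinearMap.ker (LinearMap.id - signedCyclic n)

/-- The cyclic cocycles `Z^n_λ(C)`. -/
def cyclicCocycles (n : ℕ) : Submodule ℂ (NerveFun C n) :=
  cyclicCochains C n ⊓ LinearMap.ker (hochschild n)

/-- The cyclic coboundaries `B^n_λ(C)`. -/
def cyclicCoboundaries : (n : ℕ) → Submodule ℂ (NerveFun C n)
  | 0 => ⊥
  | n + 1 => (cyclicCochains C n).map (hochschild n)

/-- The cyclic cohomology `H^n_λ(C) = Z^n_λ(C) / B^n_λ(C)`. -/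
abbrev CyclicCohomology (n : ℕ) : Type (max u v) :=
  cyclicCocycles C n ⧸ (cyclicCoboundaries C n).submoduleOf (cyclicCocycles C n)

variable {C} in
/-- The class in `H^n_λ(C)` of a cyclic cocycle. -/
def cyclicClass {n : ℕ} (φ : NerveFun C n) (h : φ ∈ cyclicCocycles C n) : CyclicCohomology C n :=
  Submodule.Quotient.mk ⟨φ, h⟩

end Nerve

/-! ## DG-semicategories, closed graded traces and cycles -/

/-- A `ℂ`-linear differential graded semicategory, graded by `ℕ`. The index equations
(`j + i = n`, `i + 1 = j`) replace casts between propositionally equal degrees; `comp _ g f` is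
`g ∘ f`. There need not be identity morphisms. -/
structure DGSemicategory where
  Obj : Type a
  Hom : Obj → Obj → ℕ → Type b
  [addCommGroup : ∀ X Y n, AddCommGroup (Hom X Y n)]
  [module : ∀ X Y n, Module ℂ (Hom X Y n)]
  comp : ∀ {X Y Z : Obj} {j i n : ℕ}, j + i = n → (Hom Y Z j →ₗ[ℂ] Hom X Y i →ₗ[ℂ] Hom X Z n)
  assoc : ∀ {W X Y Z : Obj} {k j i kj ji n : ℕ} (h₁ : k + j = kj) (h₂ : kj + i = n)
    (h₃ : j + i = ji) (h₄ : k + ji = n) (h : Hom Y Z k) (g : Hom X Y j) (f : Hom W X i),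
    comp h₂ (comp h₁ h g) f = comp h₄ h (comp h₃ g f)
  d : ∀ {X Y : Obj} {i j : ℕ}, i + 1 = j → (Hom X Y i →ₗ[ℂ] Hom X Y j)
  d_d : ∀ {X Y : Obj} {i j k : ℕ} (h₁ : i + 1 = j) (h₂ : j + 1 = k) (f : Hom X Y i),
    d h₂ (d h₁ f) = 0
  leibniz : ∀ {X Y Z : Obj} {j i n j' i' n' : ℕ} (h : j + i = n) (hn : n + 1 = n')
    (hj : j + 1 = j') (hi : i + 1 = i') (h₁ : j' + i = n') (h₂ : j + i' = n')
    (g : Hom Y Z j) (f : Hom X Y i),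
    d hn (comp h g f) = comp h₁ (d hj g) f + (-1 : ℂ) ^ j • comp h₂ g (d hi f)

attribute [instance] DGSemicategory.addCommGroup DGSemicategory.module

/-- A closed graded trace of dimension `n` on a DG-semicategory. -/
structure ClosedGradedTrace (S : DGSemicategory.{a, b}) (n : ℕ) where
  toFun : ∀ X : S.Obj, S.Hom X X n →ₗ[ℂ] ℂ
  closed : ∀ (X : S.Obj) {k : ℕ} (h : k + 1 = n) (f : S.Hom X X k), toFun X (S.d h f) = 0
  graded : ∀ {X Y : S.Obj} {i j : ℕ} (h₁ : i + j = n) (h₂ : j + i = n)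
    (g : S.Hom Y X i) (g' : S.Hom X Y j),
    toFun X (S.comp h₁ g g') = (-1 : ℂ) ^ (i * j) * toFun Y (S.comp h₂ g' g)

/-- A `ℂ`-linear semifunctor from the category `C` to the degree `0` part of `S`. -/
structure LinearSemifunctor (C : Type u) [Category.{v} C] [Preadditive C] [Linear ℂ C]
    (S : DGSemicategory.{a, b}) where
  obj : C → S.Obj
  map : ∀ {X Y : C}, (X ⟶ Y) →ₗ[ℂ] S.Hom (obj X) (obj Y) 0
  map_comp : ∀ {X Y Z : C} (f : X ⟶ Y) (g : Y ⟶ Z),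
    map (f ≫ g) = S.comp (zero_add 0) (map g) (map f)

/-- An `n`-dimensional cycle over the linear category `C`. -/
structure Cycle (C : Type u) [Category.{v} C] [Preadditive C] [Linear ℂ C] (n : ℕ) where
  S : DGSemicategory.{a, b}
  T : ClosedGradedTrace S n
  ρ : LinearSemifunctor C S

section Character

variable {C : Type u} [Category.{v} C] [Preadditive C] [Linear ℂ C]

/-- `∂(ρ f⁰) ∂(ρ f¹) ⋯ ∂(ρ fⁿ)`. -/
def LinearSemifunctor.dWord {S : DGSemicategory.{a, b}} (ρ : LinearSemifunctor C S) :
    {n : ℕ} → {X Y : C} → Chain n X Y → S.Hom (ρ.obj Y) (ρ.obj X) (n + 1)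
  | 0, _, _, .single f => S.d rfl (ρ.map f)
  | _ + 1, _, _, .cons f c => S.comp (Nat.add_comm 1 _) (S.d (zero_add 1) (ρ.map f)) (ρ.dWord c)

/-- `(ρ f⁰) ∂(ρ f¹) ⋯ ∂(ρ fⁿ)`. -/
def LinearSemifunctor.word {S : DGSemicategory.{a, b}} (ρ : LinearSemifunctor C S) :
    {n : ℕ} → {X Y : C} → Chain n X Y → S.Hom (ρ.obj Y) (ρ.obj X) n
  | 0, _, _, .single f => ρ.map f
  | _ + 1, _, _, .cons f c => S.comp (zero_add _) (ρ.map f) (ρ.dWord c)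

/-- The character `φ(f⁰ ⊗ … ⊗ fⁿ) = T(ρ(f⁰) ∂(ρ f¹) ⋯ ∂(ρ fⁿ))` of a cycle. -/
def Cycle.character {n : ℕ} (A : Cycle.{u, v, a, b} C n) : NerveFun C n :=
  fun X c => A.T.toFun (A.ρ.obj X) (A.ρ.word c)

end Character

/-! ## Tensor products -/

/-- The tensor product `C ⊗ D` of two linear categories: its objects are the pairs, and
`Hom((X, X'), (Y, Y')) = Hom(X, Y) ⊗ Hom(X', Y')`. -/
structure TensorCat (C : Type u) (D : Type w) where
  fst : C
  snd : D

section TensorCat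

universe u' v'

variable {C : Type u} [Category.{v} C] [Preadditive C] [Linear ℂ C]
variable {D : Type u'} [Category.{v'} D] [Preadditive D] [Linear ℂ D]

/-- `(f ⊗ f') ≫ (g ⊗ g') = (f ≫ g) ⊗ (f' ≫ g')`, extended bilinearly. -/
def tensorComp (X Y Z : TensorCat C D) :
    ((X.fst ⟶ Y.fst) ⊗[ℂ] (X.snd ⟶ Y.snd)) →ₗ[ℂ] ((Y.fst ⟶ Z.fst) ⊗[ℂ] (Y.snd ⟶ Z.snd)) →ₗ[ℂ]
      ((X.fst ⟶ Z.fst) ⊗[ℂ] (X.snd ⟶ Z.snd)) :=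
  TensorProduct.map₂ (Linear.comp X.fst Y.fst Z.fst) (Linear.comp X.snd Y.snd Z.snd)

instance : Category (TensorCat C D) where
  Hom X Y := (X.fst ⟶ Y.fst) ⊗[ℂ] (X.snd ⟶ Y.snd)
  id X := 𝟙 X.fst ⊗ₜ 𝟙 X.snd
  comp {X Y Z} f g := tensorComp X Y Z f g
  id_comp {X Y} f := by
    induction f using TensorProduct.induction_on with
    | zero => simp
    | tmul f g => simp [tensorComp]
    | add f g hf hg => rw [map_add, hf, hg]
  comp_id {X Y} f := by
    induction f using TensorProduct.induction_on with
    | zero => simp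
    | tmul f g => simp [tensorComp]
    | add f g hf hg => rw [map_add, LinearMap.add_apply, hf, hg]
  assoc {W X Y Z} f g h := by
    induction f using TensorProduct.induction_on with
    | zero => simp
    | add f f' hf hf' => simp only [map_add, LinearMap.add_apply, hf, hf']
    | tmul f f' =>
      induction g using TensorProduct.induction_on with
      | zero => simp
      | add g g' hg hg' => simp only [map_add, LinearMap.add_apply, hg, hg']
      | tmul g g' =>
        induction h using TensorProduct.induction_on with
        | zero => simp
        | add h h' hh hh' => simp only [map_add, hh, hh']
        | tmul h h' => simp [tensorComp]

instance : Preadditive (TensorCat C D) where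
  homGroup X Y := inferInstanceAs (AddCommGroup ((X.fst ⟶ Y.fst) ⊗[ℂ] (X.snd ⟶ Y.snd)))
  add_comp X Y Z f f' g := (tensorComp X Y Z).map_add₂ f f' g
  comp_add X Y Z f g g' := (tensorComp X Y Z f).map_add g g'

instance : Linear ℂ (TensorCat C D) where
  homModule X Y := inferInstanceAs (Module ℂ ((X.fst ⟶ Y.fst) ⊗[ℂ] (X.snd ⟶ Y.snd)))
  smul_comp X Y Z r f g := (tensorComp X Y Z).map_smul₂ r f g
  comp_smul X Y Z f r g := (tensorComp X Y Z f).map_smul r g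

end TensorCat

namespace DGSemicategory

variable (S : DGSemicategory.{a, b}) (S' : DGSemicategory.{a', b'})

/-- `⨁_{i + j = n} Hom^i(X, Y) ⊗ Hom^j(X', Y')`. -/
abbrev TensorHom (X Y : S.Obj × S'.Obj) (n : ℕ) : Type (max b b') :=
  ⨁ q : {q : ℕ × ℕ // q.1 + q.2 = n}, S.Hom X.1 Y.1 q.1.1 ⊗[ℂ] S'.Hom X.2 Y.2 q.1.2

variable {S S'}

/-- The inclusion of the summand `Hom^i(X, Y) ⊗ Hom^j(X', Y')`. -/
def tensorIncl (X Y : S.Obj × S'.Obj) {i j n : ℕ} (h : i + j = n) :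
    (S.Hom X.1 Y.1 i ⊗[ℂ] S'.Hom X.2 Y.2 j) →ₗ[ℂ] TensorHom S S' X Y n :=
  DirectSum.lof ℂ {q : ℕ × ℕ // q.1 + q.2 = n}
    (fun q => S.Hom X.1 Y.1 q.1.1 ⊗[ℂ] S'.Hom X.2 Y.2 q.1.2) ⟨(i, j), h⟩

/-- The composition `(g ⊗ g') ∘ (f ⊗ f') = (-1)^{deg(g') deg(f)} (g f ⊗ g' f')`. -/
def tensorCompDG {X Y Z : S.Obj × S'.Obj} {j i n : ℕ} (h : j + i = n) :
    TensorHom S S' Y Z j →ₗ[ℂ] TensorHom S S' X Y i →ₗ[ℂ] TensorHom S S' X Z n :=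
  DirectSum.toModule ℂ _ _ fun q =>
    LinearMap.flip <| DirectSum.toModule ℂ _ _ fun q' =>
      LinearMap.flip <| (-1 : ℂ) ^ (q.1.2 * q'.1.1) •
        (TensorProduct.map₂ (S.comp (X := X.1) (Y := Y.1) (Z := Z.1) (rfl : q.1.1 + q'.1.1 = _))
          (S'.comp (X := X.2) (Y := Y.2) (Z := Z.2) (rfl : q.1.2 + q'.1.2 = _))).compr₂
          (tensorIncl X Z (by have := q.2; have := q'.2; omega))

/-- The differential `∂(f ⊗ f') = ∂f ⊗ f' + (-1)^{deg(f)} f ⊗ ∂f'`. -/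
def tensorD {X Y : S.Obj × S'.Obj} {i j : ℕ} (h : i + 1 = j) :
    TensorHom S S' X Y i →ₗ[ℂ] TensorHom S S' X Y j :=
  DirectSum.toModule ℂ _ _ fun q =>
    (tensorIncl X Y (by have := q.2; omega)).comp
        (TensorProduct.map (S.d (rfl : q.1.1 + 1 = _)) LinearMap.id) +
      (-1 : ℂ) ^ q.1.1 • (tensorIncl X Y (by have := q.2; omega)).comp
        (TensorProduct.map LinearMap.id (S'.d (rfl : q.1.2 + 1 = _)))

theorem tensorCompDG_incl {X Y Z : S.Obj × S'.Obj} {j i n j₁ j₂ i₁ i₂ n₁ n₂ : ℕ} (h : j + i = n)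
    (hj : j₁ + j₂ = j) (hi : i₁ + i₂ = i) (h₁ : j₁ + i₁ = n₁) (h₂ : j₂ + i₂ = n₂)
    (hn : n₁ + n₂ = n) (g : S.Hom Y.1 Z.1 j₁) (g' : S'.Hom Y.2 Z.2 j₂)
    (f : S.Hom X.1 Y.1 i₁) (f' : S'.Hom X.2 Y.2 i₂) :
    tensorCompDG h (tensorIncl Y Z hj (g ⊗ₜ g')) (tensorIncl X Y hi (f ⊗ₜ f')) =
      (-1 : ℂ) ^ (j₂ * i₁) • tensorIncl X Z hn (S.comp h₁ g f ⊗ₜ S'.comp h₂ g' f') := by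
  subst h₁ h₂
  simp [tensorCompDG, tensorIncl]

theorem tensorD_incl {X Y : S.Obj × S'.Obj} {i j i₁ i₂ i₁' i₂' : ℕ} (h : i + 1 = j)
    (hi : i₁ + i₂ = i) (h₁ : i₁ + 1 = i₁') (h₂ : i₂ + 1 = i₂') (hj₁ : i₁' + i₂ = j)
    (hj₂ : i₁ + i₂' = j) (f : S.Hom X.1 Y.1 i₁) (f' : S'.Hom X.2 Y.2 i₂) :
    tensorD h (tensorIncl X Y hi (f ⊗ₜ f')) =
      tensorIncl X Y hj₁ (S.d h₁ f ⊗ₜ f') +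
        (-1 : ℂ) ^ i₁ • tensorIncl X Y hj₂ (f ⊗ₜ S'.d h₂ f') := by
  subst h₁ h₂
  simp [tensorD, tensorIncl]

/-- Every element of `TensorHom` is a sum of homogeneous pure tensors. -/
theorem tensorHom_induction {X Y : S.Obj × S'.Obj} {n : ℕ} {P : TensorHom S S' X Y n → Prop}
    (zero : P 0) (add : ∀ x y, P x → P y → P (x + y))
    (pure : ∀ {i j : ℕ} (h : i + j = n) (f : S.Hom X.1 Y.1 i) (f' : S'.Hom X.2 Y.2 j),
      P (tensorIncl X Y h (f ⊗ₜ f'))) (x : TensorHom S S' X Y n) : P x := by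
  induction x using DirectSum.induction_on with
  | zero => exact zero
  | add x y hx hy => exact add x y hx hy
  | of q x =>
    induction x using TensorProduct.induction_on with
    | zero => rw [map_zero]; exact zero
    | add x y hx hy => rw [map_add]; exact add _ _ hx hy
    | tmul f f' => exact pure q.2 f f'

variable (S S')

/-- The tensor product of two DG-semicategories. -/
def tensor : DGSemicategory.{max a a', max b b'} where
  Obj := S.Obj × S'.Obj
  Hom X Y n := TensorHom S S' X Y n
  comp h := tensorCompDG h
  assoc {W X Y Z k j i kj ji n} h₁ h₂ h₃ h₄ h g f := by
    induction h using tensorHom_induction with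
    | zero => simp
    | add x y hx hy => simp only [map_add, LinearMap.add_apply, hx, hy]
    | pure hk h h' =>
    induction g using tensorHom_induction with
    | zero => simp
    | add x y hx hy => simp only [map_add, LinearMap.add_apply, hx, hy]
    | pure hj g g' =>
    induction f using tensorHom_induction with
    | zero => simp
    | add x y hx hy => simp only [map_add, hx, hy]
    | pure hi f f' =>
    rw [tensorCompDG_incl h₁ hk hj rfl rfl (by omega),
      tensorCompDG_incl h₃ hj hi rfl rfl (by omega)]
    simp only [map_smul, LinearMap.smul_apply]
    rw [tensorCompDG_incl h₂ _ hi rfl rfl (by omega),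
      tensorCompDG_incl h₄ hk _ (add_assoc _ _ _).symm (add_assoc _ _ _).symm (by omega),
      S.assoc rfl rfl rfl (add_assoc _ _ _).symm, S'.assoc rfl rfl rfl (add_assoc _ _ _).symm,
      smul_smul, smul_smul]
    congr 1
    ring
  d h := tensorD h
  d_d {X Y i j k} h₁ h₂ f := by
    induction f using tensorHom_induction with
    | zero => simp
    | add x y hx hy => simp only [map_add, hx, hy, add_zero]
    | pure hi f f' =>
    rw [tensorD_incl h₁ hi rfl rfl (by omega) (by omega), map_add, map_smul,
      tensorD_incl h₂ _ rfl rfl (by omega) (by omega),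
      tensorD_incl h₂ _ rfl rfl (by omega) (by omega), S.d_d, S'.d_d]
    simp only [TensorProduct.zero_tmul, TensorProduct.tmul_zero, map_zero, smul_zero, zero_add,
      add_zero, ← add_smul, pow_succ]
    simp
  leibniz {X Y Z j i n j' i' n'} h hn hj hi h₁ h₂ g f := by
    induction g using tensorHom_induction with
    | zero => simp
    | add x y hx hy =>
      simp only [map_add, LinearMap.add_apply, hx, hy, smul_add]
      abel
    | pure hg g g' =>
    induction f using tensorHom_induction with
    | zero => simp
    | add x y hx hy =>
      simp only [map_add, hx, hy, smul_add]
      abel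
    | @pure i₁ i₂ hf f f' =>
    rename_i j₁ j₂
    rw [tensorCompDG_incl h hg hf rfl rfl (by omega), map_smul,
      tensorD_incl hn _ rfl rfl (by omega) (by omega),
      tensorD_incl hj hg rfl rfl (by omega) (by omega),
      tensorD_incl hi hf rfl rfl (by omega) (by omega)]
    simp only [map_add, map_smul, LinearMap.add_apply, LinearMap.smul_apply]
    rw [tensorCompDG_incl h₁ _ hf (add_right_comm _ _ _) rfl (by omega),
      tensorCompDG_incl h₁ _ hf rfl (add_right_comm _ _ _) (by omega),
      tensorCompDG_incl h₂ hg _ (add_assoc _ _ _).symm rfl (by omega),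
      tensorCompDG_incl h₂ hg _ rfl (add_assoc _ _ _).symm (by omega),
      S.leibniz rfl rfl rfl rfl (add_right_comm _ _ _) (add_assoc _ _ _).symm,
      S'.leibniz rfl rfl rfl rfl (add_right_comm _ _ _) (add_assoc _ _ _).symm]
    simp only [TensorProduct.add_tmul, TensorProduct.tmul_add, map_add, smul_add, smul_smul,
      ← TensorProduct.smul_tmul', TensorProduct.tmul_smul, map_smul]
    have e : (-1 : ℂ) ^ j₂ * (-1) ^ j₂ = 1 := by rw [← mul_pow]; simp
    have s₁ : (-1 : ℂ) ^ j * (-1) ^ (j₂ * (i₁ + 1)) = (-1) ^ (j₂ * i₁) * (-1) ^ j₁ := by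
      rw [← hg, pow_add, mul_add, pow_add, mul_one]
      linear_combination ((-1 : ℂ) ^ j₁ * (-1) ^ (j₂ * i₁)) * e
    have s₂ : (-1 : ℂ) ^ j₁ * (-1) ^ ((j₂ + 1) * i₁) =
        (-1) ^ (j₂ * i₁) * (-1) ^ (j₁ + i₁) := by ring
    have s₃ : (-1 : ℂ) ^ j * ((-1) ^ i₁ * (-1) ^ (j₂ * i₁)) =
        (-1) ^ (j₂ * i₁) * ((-1) ^ (j₁ + i₁) * (-1) ^ j₂) := by rw [← hg]; ring
    rw [s₁, s₂, s₃]
    abel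

end DGSemicategory

/-! ## The cup product and the periodicity operator -/

section Cup

universe u' v'

/-- `(T # T')(f ⊗ f') = T(f_r) T'(f'_s)`, which only sees the summand `Hom^r ⊗ Hom^s`. -/
def traceTensorFun {S : DGSemicategory.{a, b}} {S' : DGSemicategory.{a', b'}} {r s : ℕ}
    (T : ClosedGradedTrace S r) (T' : ClosedGradedTrace S' s) (X : S.Obj × S'.Obj) :
    DGSemicategory.TensorHom S S' X X (r + s) →ₗ[ℂ] ℂ :=
  (TensorProduct.lift ((LinearMap.mul ℂ ℂ).compl₁₂ (T.toFun X.1) (T'.toFun X.2))).comp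
    (DirectSum.component ℂ {q : ℕ × ℕ // q.1 + q.2 = r + s}
      (fun q => S.Hom X.1 X.1 q.1.1 ⊗[ℂ] S'.Hom X.2 X.2 q.1.2) ⟨(r, s), rfl⟩)

theorem traceTensorFun_incl {S : DGSemicategory.{a, b}} {S' : DGSemicategory.{a', b'}} {r s : ℕ}
    (T : ClosedGradedTrace S r) (T' : ClosedGradedTrace S' s) (X : S.Obj × S'.Obj)
    (h : r + s = r + s) (f : S.Hom X.1 X.1 r) (f' : S'.Hom X.2 X.2 s) :
    traceTensorFun T T' X (DGSemicategory.tensorIncl X X h (f ⊗ₜ f')) =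
      T.toFun X.1 f * T'.toFun X.2 f' := by
  simp [traceTensorFun, DGSemicategory.tensorIncl, DirectSum.component.lof_self]

theorem traceTensorFun_incl_of_ne {S : DGSemicategory.{a, b}} {S' : DGSemicategory.{a', b'}}
    {r s i j : ℕ} (T : ClosedGradedTrace S r) (T' : ClosedGradedTrace S' s)
    (X : S.Obj × S'.Obj) (h : i + j = r + s) (hi : i ≠ r)
    (x : S.Hom X.1 X.1 i ⊗[ℂ] S'.Hom X.2 X.2 j) :
    traceTensorFun T T' X (DGSemicategory.tensorIncl X X h x) = 0 := by
  have : (⟨(i, j), h⟩ : {q : ℕ × ℕ // q.1 + q.2 = r + s}) ≠ ⟨(r, s), rfl⟩ := by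
    intro e
    exact hi (congrArg (fun q => q.1.1) e)
  simp [traceTensorFun, DGSemicategory.tensorIncl, DirectSum.component.of, this]

theorem traceTensorFun_closed {S : DGSemicategory.{a, b}} {S' : DGSemicategory.{a', b'}} {r s : ℕ}
    (T : ClosedGradedTrace S r) (T' : ClosedGradedTrace S' s)
    (X : S.Obj × S'.Obj) {k : ℕ} (h : k + 1 = r + s) (f : DGSemicategory.TensorHom S S' X X k) :
    traceTensorFun T T' X (DGSemicategory.tensorD h f) = 0 := by
  induction f using DGSemicategory.tensorHom_induction with
  | zero => simp
  | add x y hx hy => rw [map_add, map_add, hx, hy, add_zero]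
  | @pure i j hi f f' =>
  rw [DGSemicategory.tensorD_incl h hi rfl rfl (by omega) (by omega), map_add, map_smul]
  by_cases h₁ : i + 1 = r
  · have h₂ : j = s := by omega
    subst h₁ h₂
    rw [traceTensorFun_incl, T.closed, traceTensorFun_incl_of_ne _ _ _ _ (by omega)]
    simp
  · rw [traceTensorFun_incl_of_ne _ _ _ _ h₁]
    by_cases h₃ : i = r
    · have h₂ : j + 1 = s := by omega
      subst h₃ h₂
      rw [traceTensorFun_incl, T'.closed]
      simp
    · rw [traceTensorFun_incl_of_ne _ _ _ _ h₃]
      simp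

theorem traceTensorFun_graded {S : DGSemicategory.{a, b}} {S' : DGSemicategory.{a', b'}} {r s : ℕ}
    (T : ClosedGradedTrace S r) (T' : ClosedGradedTrace S' s)
    {X Y : S.Obj × S'.Obj} {i j : ℕ} (h₁ : i + j = r + s) (h₂ : j + i = r + s)
    (g : DGSemicategory.TensorHom S S' Y X i) (g' : DGSemicategory.TensorHom S S' X Y j) :
    traceTensorFun T T' X (DGSemicategory.tensorCompDG h₁ g g') =
      (-1 : ℂ) ^ (i * j) * traceTensorFun T T' Y (DGSemicategory.tensorCompDG h₂ g' g) := by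
  induction g using DGSemicategory.tensorHom_induction with
  | zero => simp
  | add x y hx hy => simp only [map_add, LinearMap.add_apply, hx, hy, mul_add]
  | @pure i₁ i₂ hi f f' =>
  induction g' using DGSemicategory.tensorHom_induction with
  | zero => simp
  | add x y hx hy => simp only [map_add, LinearMap.add_apply, hx, hy, mul_add]
  | @pure j₁ j₂ hj g g' =>
  rw [DGSemicategory.tensorCompDG_incl h₁ hi hj rfl rfl (by omega),
    DGSemicategory.tensorCompDG_incl h₂ hj hi (add_comm _ _) (add_comm _ _) (by omega),
    map_smul, map_smul]
  by_cases h₃ : i₁ + j₁ = r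
  · have h₄ : i₂ + j₂ = s := by omega
    subst h₃ h₄
    rw [traceTensorFun_incl, traceTensorFun_incl, T.graded rfl (add_comm _ _),
      T'.graded rfl (add_comm _ _), ← hi, ← hj]
    have e : (-1 : ℂ) ^ (i₁ * j₂) * (-1) ^ (i₁ * j₂) = 1 := by rw [← mul_pow]; simp
    simp only [smul_eq_mul, add_mul, mul_add, pow_add]
    linear_combination (-(-1 : ℂ) ^ (i₂ * j₁) * (-1) ^ (i₁ * j₁) * (-1) ^ (i₂ * j₂) *
      T.toFun Y.1 (S.comp (add_comm j₁ i₁) g f) *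
      T'.toFun Y.2 (S'.comp (add_comm j₂ i₂) g' f')) * e
  · rw [traceTensorFun_incl_of_ne _ _ _ _ h₃, traceTensorFun_incl_of_ne _ _ _ _ h₃]
    simp

/-- The closed graded trace `T # T'` of dimension `r + s` on the tensor product. -/
def ClosedGradedTrace.tensor {S : DGSemicategory.{a, b}} {S' : DGSemicategory.{a', b'}} {r s : ℕ}
    (T : ClosedGradedTrace S r) (T' : ClosedGradedTrace S' s) :
    ClosedGradedTrace (S.tensor S') (r + s) where
  toFun X := traceTensorFun T T' X
  closed X _ h f := traceTensorFun_closed T T' X h f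
  graded h₁ h₂ g g' := traceTensorFun_graded T T' h₁ h₂ g g'

variable {C : Type u} [Category.{v} C] [Preadditive C] [Linear ℂ C]
variable {D : Type u'} [Category.{v'} D] [Preadditive D] [Linear ℂ D]

/-- The semifunctor `ρ ⊗ ρ'` on `C ⊗ D`. -/
def LinearSemifunctor.tensor {S : DGSemicategory.{a, b}} {S' : DGSemicategory.{a', b'}}
    (ρ : LinearSemifunctor C S) (ρ' : LinearSemifunctor D S') :
    LinearSemifunctor (TensorCat C D) (S.tensor S') where
  obj X := (ρ.obj X.fst, ρ'.obj X.snd)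
  map {X Y} := (DGSemicategory.tensorIncl (ρ.obj X.fst, ρ'.obj X.snd) (ρ.obj Y.fst, ρ'.obj Y.snd)
    (zero_add 0)).comp (TensorProduct.map ρ.map ρ'.map)
  map_comp {X Y Z} f g := by
    change DGSemicategory.tensorIncl (ρ.obj X.fst, ρ'.obj X.snd) (ρ.obj Z.fst, ρ'.obj Z.snd)
        (zero_add 0) (TensorProduct.map ρ.map ρ'.map (tensorComp X Y Z f g)) =
      DGSemicategory.tensorCompDG (zero_add 0)
        (DGSemicategory.tensorIncl (ρ.obj Y.fst, ρ'.obj Y.snd) (ρ.obj Z.fst, ρ'.obj Z.snd)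
          (zero_add 0) (TensorProduct.map ρ.map ρ'.map g))
        (DGSemicategory.tensorIncl (ρ.obj X.fst, ρ'.obj X.snd) (ρ.obj Y.fst, ρ'.obj Y.snd)
          (zero_add 0) (TensorProduct.map ρ.map ρ'.map f))
    induction f using TensorProduct.induction_on with
    | zero => simp
    | add x y hx hy => simp only [map_add, LinearMap.add_apply, hx, hy]
    | tmul f f' =>
    induction g using TensorProduct.induction_on with
    | zero => simp
    | add x y hx hy => simp only [map_add, LinearMap.add_apply, hx, hy]
    | tmul g g' =>
    simp only [TensorProduct.map_tmul]
    rw [DGSemicategory.tensorCompDG_incl _ _ _ (zero_add 0) (zero_add 0) (zero_add 0)]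
    simp [tensorComp, ρ.map_comp, ρ'.map_comp]

/-- The tensor product `(S ⊗ S', ∂ ⊗ ∂', T # T', ρ ⊗ ρ')` of a cycle over `C` and one over `D`. -/
def Cycle.tensor {r s : ℕ} (A : Cycle.{u, v, a, b} C r) (A' : Cycle.{u', v', a', b'} D s) :
    Cycle.{max u u', max v v', max a a', max b b'} (TensorCat C D) (r + s) where
  S := A.S.tensor A'.S
  T := A.T.tensor A'.T
  ρ := A.ρ.tensor A'.ρ

/-- `χ = φ # φ'`: the cochain `χ` on `C ⊗ D` is the character of the tensor product of a cycle over
`C` with character `φ` and a cycle over `D` with character `φ'`. -/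
def IsCupProduct {r s : ℕ} (φ : NerveFun C r) (φ' : NerveFun D s)
    (χ : NerveFun (TensorCat C D) (r + s)) : Prop :=
  ∃ (A : Cycle.{u, v, a, b} C r) (A' : Cycle.{u', v', a', b'} D s),
    A.character = φ ∧ A'.character = φ' ∧ (A.tensor A').character = χ

instance : Linear ℂ (SingleObj ℂ) where
  homModule _ _ := inferInstanceAs (Module ℂ ℂ)
  smul_comp _ _ _ r f g := mul_smul_comm (β := ℂ) r g f
  comp_smul _ _ _ f r g := smul_mul_assoc (β := ℂ) r g f

/-- The cyclic `2`-cocycle `ψ` on `ℂ`, regarded as a category with one object, which is determined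
by `ψ(1, 1, 1) = 1`, i.e. `ψ(x, y, z) = x y z`. -/
def unitTwoCocycle : NerveFun (SingleObj ℂ) 2 :=
  fun _ c => match c with
    | .cons x (.cons y (.single z)) => (show ℂ from x) * (show ℂ from y) * (show ℂ from z)

/-- The tuple `(f⁰ ⊗ 1, …, fⁿ ⊗ 1)`. -/
def Chain.tensorOne : {n : ℕ} → {X Y : C} → Chain n X Y →
    Chain n (⟨X, SingleObj.star ℂ⟩ : TensorCat C (SingleObj ℂ)) ⟨Y, SingleObj.star ℂ⟩
  | 0, _, _, .single f => .single (f ⊗ₜ[ℂ] 𝟙 (SingleObj.star ℂ))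
  | _ + 1, _, _, .cons f c => .cons (Z := ⟨_, SingleObj.star ℂ⟩) (f ⊗ₜ[ℂ] 𝟙 (SingleObj.star ℂ))
      c.tensorOne

/-- `χ = S(φ)`, where `S(φ) = φ # ψ` is Connes' periodicity operator; here `C ⊗ ℂ` is identified
with `C` by `f ⊗ 1 ↔ f`. -/
def IsPeriodicity {r : ℕ} (φ : NerveFun C r) (χ : NerveFun C (r + 2)) : Prop :=
  ∃ χ' : NerveFun (TensorCat C (SingleObj ℂ)) (r + 2),
    IsCupProduct.{u, v, a, b, a', b'} φ unitTwoCocycle χ' ∧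
      χ = fun X c => χ' ⟨X, SingleObj.star ℂ⟩ c.tensorOne

end Cup

/-! ## Schatten classes, the trace, Fredholm modules and their characters -/

section Hilbert

open ContinuousLinearMap

/-- `|T| = (T* T)^{1/2}`. -/
def absOp {E F : Type*} [NormedAddCommGroup E] [InnerProductSpace ℂ E] [CompleteSpace E]
    [NormedAddCommGroup F] [InnerProductSpace ℂ F] [CompleteSpace F] (T : E →L[ℂ] F) : E →L[ℂ] E :=
  CFC.sqrt (adjoint T ∘L T)

/-- The multiplicity of `s > 0` as a singular value of `T`, i.e. as an eigenvalue of `|T|` (finite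
if `T` is compact). -/
def singularMultiplicity {E F : Type*} [NormedAddCommGroup E] [InnerProductSpace ℂ E]
    [CompleteSpace E] [NormedAddCommGroup F] [InnerProductSpace ℂ F] [CompleteSpace F]
    (T : E →L[ℂ] F) (s : ℝ) : ℕ :=
  Module.finrank ℂ (Module.End.eigenspace (absOp T : E →ₗ[ℂ] E) (s : ℂ))

/-- The Schatten class `B^p`: the compact operators `T` with `∑ₙ μₙ(T)^p < ∞`, where the `μₙ(T)` are
the eigenvalues of `|T|` repeated according to multiplicity. The sum is grouped by the distinct
nonzero eigenvalues. -/
def IsSchatten {E F : Type*} [NormedAddCommGroup E] [InnerProductSpace ℂ E]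
    [CompleteSpace E] [NormedAddCommGroup F] [InnerProductSpace ℂ F] [CompleteSpace F]
    (p : ℝ) (T : E →L[ℂ] F) : Prop :=
  IsCompactOperator T ∧
    Summable fun s : {s : ℝ // 0 < s} => (singularMultiplicity T s : ℝ) * (s : ℝ) ^ p

/-- The trace `∑ᵢ ⟨eᵢ, T eᵢ⟩` with respect to an orthonormal basis `(eᵢ)`; for an operator of trace
class the series converges absolutely and does not depend on the basis. -/
def opTrace {E : Type*} [NormedAddCommGroup E] [InnerProductSpace ℂ E] [CompleteSpace E]
    (T : E →L[ℂ] E) : ℂ :=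
  ∑' i : (exists_hilbertBasis ℂ E).choose,
    inner ℂ ((exists_hilbertBasis ℂ E).choose_spec.choose i)
      (T ((exists_hilbertBasis ℂ E).choose_spec.choose i))

/-- `ℤ/2`-graded separable Hilbert spaces: the grading is given by the grading operator `ε`, which
is `1` on the even and `-1` on the odd part; these parts are orthogonal to each other. -/
structure SHilbZ2 where
  carrier : Type w
  [normedAddCommGroup : NormedAddCommGroup carrier]
  [innerProductSpace : InnerProductSpace ℂ carrier]
  [completeSpace : CompleteSpace carrier]
  [separableSpace : TopologicalSpace.SeparableSpace carrier]
  ε : carrier →L[ℂ] carrier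
  ε_sq : ε ∘L ε = ContinuousLinearMap.id ℂ carrier
  ε_selfAdjoint : adjoint ε = ε

attribute [instance] SHilbZ2.normedAddCommGroup SHilbZ2.innerProductSpace SHilbZ2.completeSpace
  SHilbZ2.separableSpace

/-- Morphisms are all bounded linear maps. -/
instance : Category SHilbZ2.{w} where
  Hom E F := E.carrier →L[ℂ] F.carrier
  id E := ContinuousLinearMap.id ℂ E.carrier
  comp f g := g ∘L f

instance : Preadditive SHilbZ2.{w} where
  homGroup E F := inferInstanceAs (AddCommGroup (E.carrier →L[ℂ] F.carrier))
  add_comp _ _ _ f f' g := ContinuousLinearMap.comp_add g f f'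
  comp_add _ _ _ f g g' := ContinuousLinearMap.add_comp g g' f

instance : Linear ℂ SHilbZ2.{w} where
  homModule E F := inferInstanceAs (Module ℂ (E.carrier →L[ℂ] F.carrier))
  smul_comp _ _ _ r f g := ContinuousLinearMap.comp_smul g r f
  comp_smul _ _ _ f r g := ContinuousLinearMap.smul_comp r g f

variable (C : Type u) [Category.{v} C] [Preadditive C] [Linear ℂ C]

/-- A pair `(H, F)` of a linear functor `H` from `C` to `ℤ/2`-graded separable Hilbert spaces, which
takes values in operators of degree `0`, and of a family `F` of bounded operators of degree `1`
with `F² = id`. -/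
structure FredholmPair where
  H : C ⥤ SHilbZ2.{w}
  [additive : H.Additive]
  [linear : H.Linear ℂ]
  F : ∀ X : C, (H.obj X).carrier →L[ℂ] (H.obj X).carrier
  H_degree_zero : ∀ {X Y : C} (f : X ⟶ Y), H.map f ≫ (H.obj Y).ε = (H.obj X).ε ≫ H.map f
  F_degree_one : ∀ X : C, F X ∘L (H.obj X).ε = -((H.obj X).ε ∘L F X)
  F_sq : ∀ X : C, F X ∘L F X = ContinuousLinearMap.id ℂ (H.obj X).carrier

namespace FredholmPair

variable {C} (M : FredholmPair.{u, v, w} C)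

/-- `H(f)` as a bounded operator. -/
def op {X Y : C} (f : X ⟶ Y) : (M.H.obj X).carrier →L[ℂ] (M.H.obj Y).carrier := M.H.map f

/-- The graded commutator `[F, T] = F_Y T - (-1)^k T F_X` of `F` with an operator `T` of degree
`k`. -/
def gradedComm {X Y : C} (k : ℕ) (T : (M.H.obj X).carrier →L[ℂ] (M.H.obj Y).carrier) :
    (M.H.obj X).carrier →L[ℂ] (M.H.obj Y).carrier :=
  M.F Y ∘L T - (-1 : ℂ) ^ k • (T ∘L M.F X)

/-- `(H, F)` is a `p`-summable even Fredholm module over `C`. -/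
def IsSummable (p : ℝ) : Prop :=
  ∀ {X Y : C} (f : X ⟶ Y), IsSchatten p (M.gradedComm 0 (M.op f))

/-- `[F, f⁰] [F, f¹] ⋯ [F, fⁿ]`. -/
def commProd : {n : ℕ} → {X Y : C} → Chain n X Y →
    ((M.H.obj Y).carrier →L[ℂ] (M.H.obj X).carrier)
  | 0, _, _, .single f => M.gradedComm 0 (M.op f)
  | _ + 1, _, _, .cons f c => M.gradedComm 0 (M.op f) ∘L commProd c

/-- `H(f⁰) [F, f¹] [F, f²] ⋯ [F, fⁿ]`. -/
def charOp : {n : ℕ} → {X Y : C} → Chain n X Y →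
    ((M.H.obj Y).carrier →L[ℂ] (M.H.obj X).carrier)
  | 0, _, _, .single f => M.op f
  | _ + 1, _, _, .cons f c => M.op f ∘L M.commProd c

/-- `Tr_s(T) = ½ Tr(ε F [F, T])` for `T` of degree `k` such that `[F, T]` is of trace class. -/
def superTrace {X : C} (k : ℕ) (T : (M.H.obj X).carrier →L[ℂ] (M.H.obj X).carrier) : ℂ :=
  (1 / 2 : ℂ) * opTrace ((M.H.obj X).ε ∘L M.F X ∘L M.gradedComm k T)

/-- The `n`-dimensional character `φⁿ(f⁰ ⊗ … ⊗ fⁿ) = Tr_s(H(f⁰) [F, f¹] ⋯ [F, fⁿ])`, to be used for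
even `n`. -/
def character (n : ℕ) : NerveFun C n :=
  fun _ c => M.superTrace n (M.charOp c)

end FredholmPair

end Hilbert

end CatFredholm

end

set_option linter.unusedSectionVars false

/-! The proof is algebra in a DG-semicategory; analysis enters through summability estimates and the
cyclicity of the operator trace.

Analysis. Put `q = 2m + 1 ≥ p`. Operators of degree `k` are required to have approximation numbers
`O(cₙᵏ)` with `c ∈ ℓ^q` (`IsIdeal`). Splitting a rank budget `n` into two halves shows that the
exponents `k` add under composition, which replaces Hölder's inequality for Schatten norms, and `k ≥
q` forces trace class. Expanding along eigenvectors of `|T|` links this to `B^p`: truncation bounds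
approximation numbers by singular values, and a min-max argument gives the converse needed for `B¹`.
Then `Tr(AB) = Tr(BA)` when the exponents add up to at least `q` (`opTrace_comp_comm`). Hence the
operators with `d = [F, ·]` form a DG-semicategory, `Tr_s` is a closed graded trace on it in the
dimensions `2m` and `2m + 2`, and `φ²ᵐ`, `φ²ᵐ⁺²` are characters, so they are cyclic cocycles.

Periodicity. Let `e` be the image of `1` in a cycle representing `ψ`. Then `∂(f ⊗ e) = df ⊗ e + f ⊗
de`, and `e (de) e = 0` because `e` is idempotent. So in bidegree `(n, 2)` only the products in
which the two factors `de` are adjacent survive, each with coefficient `ψ(1, 1, 1) = 1`. Therefore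
`S(φ) = ∑ᵢ T(f⁰ df¹ ⋯ fⁱ fⁱ⁺¹ ⋯ dfⁿ⁺²)`, the sum being over `i ≥ 1`
(`Cycle.character_tensor_tensorOne`). The rule `(df) g = d(fg) - f dg` turns the argument into a
universal combination of words `g⁰ dg¹ ⋯ dgⁿ` and exact elements, so `S(φ)` depends on `φ` alone
(`Cycle.periodicity_congr`).

Comparison. For `n = 2m`, the form `τ(x) = Tr(εFx)` in degree `n + 1` satisfies `Tr_s(x) = ½ τ(dx)`
and `τ(xy) = τ(yx) - Tr_s((dy) x)`. The cochain `∑ⱼ (-1)ʲ τ(df⁰ ⋯ fʲ ⋯ dfⁿ⁺¹)` is cyclic, since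
checking this only moves closed elements around `τ`. In its Hochschild coboundary exactly one
commutation moves an undifferentiated morphism; its defect contributes `-(n + 2) φⁿ⁺²`, and what
remains is `-2 S(φ)` (`Transgression.two_mul_add_hochschild`). Dividing by `2` gives the theorem. -/

noncomputable section

namespace CatFredholm

/-! ## Approximation of operators by operators of finite rank -/

section Approximation

variable {E : Type*} [NormedAddCommGroup E] [InnerProductSpace ℂ E]
variable {F : Type*} [NormedAddCommGroup F] [InnerProductSpace ℂ F]
variable {G : Type*} [NormedAddCommGroup G] [InnerProductSpace ℂ G]

/-- The operator `R` has rank at most `n`. -/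
def HasRankLE (R : E →L[ℂ] F) (n : ℕ) : Prop :=
  ∃ W : Submodule ℂ F, FiniteDimensional ℂ W ∧ Module.finrank ℂ W ≤ n ∧ ∀ x, R x ∈ W

theorem HasRankLE.zero (n : ℕ) : HasRankLE (0 : E →L[ℂ] F) n :=
  ⟨⊥, inferInstance, by simp, by simp⟩

theorem HasRankLE.mono {R : E →L[ℂ] F} {m n : ℕ} (h : HasRankLE R m) (hmn : m ≤ n) :
    HasRankLE R n := by
  obtain ⟨W, h₁, h₂, h₃⟩ := h
  exact ⟨W, h₁, h₂.trans hmn, h₃⟩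

theorem HasRankLE.add {R S : E →L[ℂ] F} {m n : ℕ} (h : HasRankLE R m) (k : HasRankLE S n) :
    HasRankLE (R + S) (m + n) := by
  obtain ⟨W, h₁, h₂, h₃⟩ := h
  obtain ⟨V, k₁, k₂, k₃⟩ := k
  refine ⟨W ⊔ V, inferInstance,
    (Submodule.finrank_add_le_finrank_add_finrank W V).trans (add_le_add h₂ k₂), fun x => ?_⟩
  exact add_mem (Submodule.mem_sup_left (h₃ x)) (Submodule.mem_sup_right (k₃ x))

theorem HasRankLE.comp_right {R : F →L[ℂ] G} {n : ℕ} (h : HasRankLE R n) (S : E →L[ℂ] F) :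
    HasRankLE (R ∘L S) n := by
  obtain ⟨W, h₁, h₂, h₃⟩ := h
  exact ⟨W, h₁, h₂, fun x => h₃ (S x)⟩

theorem HasRankLE.comp_left {R : E →L[ℂ] F} {n : ℕ} (h : HasRankLE R n) (S : F →L[ℂ] G) :
    HasRankLE (S ∘L R) n := by
  obtain ⟨W, h₁, h₂, h₃⟩ := h
  exact ⟨W.map (S : F →ₗ[ℂ] G), inferInstance, (Submodule.finrank_map_le _ _).trans h₂,
    fun x => ⟨R x, h₃ x, rfl⟩⟩

/-- The `n`-th approximation number of `T` is at most `c n`, and this bound is attained. -/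
def ApproxBy (T : E →L[ℂ] F) (c : ℕ → ℝ) : Prop :=
  ∀ n, ∃ R : E →L[ℂ] F, HasRankLE R n ∧ ‖T - R‖ ≤ c n

theorem ApproxBy.nonneg {T : E →L[ℂ] F} {c : ℕ → ℝ} (h : ApproxBy T c) (n : ℕ) : 0 ≤ c n := by
  obtain ⟨R, -, hR⟩ := h n
  exact (norm_nonneg _).trans hR

theorem ApproxBy.mono {T : E →L[ℂ] F} {c d : ℕ → ℝ} (h : ApproxBy T c) (hcd : ∀ n, c n ≤ d n) :
    ApproxBy T d := fun n => by
  obtain ⟨R, h₁, h₂⟩ := h n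
  exact ⟨R, h₁, h₂.trans (hcd n)⟩

theorem approxBy_norm (T : E →L[ℂ] F) : ApproxBy T fun _ => ‖T‖ :=
  fun n => ⟨0, HasRankLE.zero n, by simp⟩

theorem ApproxBy.min {T : E →L[ℂ] F} {c d : ℕ → ℝ} (h : ApproxBy T c) (k : ApproxBy T d) :
    ApproxBy T fun n => min (c n) (d n) := fun n => by
  rcases le_total (c n) (d n) with hcd | hcd
  · simpa only [min_eq_left hcd] using h n
  · simpa only [min_eq_right hcd] using k n

theorem ApproxBy.add {S T : E →L[ℂ] F} {c d : ℕ → ℝ} (h : ApproxBy S c) (k : ApproxBy T d) :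
    ApproxBy (S + T) fun n => c (n / 2) + d (n / 2) := fun n => by
  obtain ⟨R, h₁, h₂⟩ := h (n / 2)
  obtain ⟨R', k₁, k₂⟩ := k (n / 2)
  refine ⟨R + R', (h₁.add k₁).mono (by omega), ?_⟩
  calc ‖S + T - (R + R')‖ = ‖(S - R) + (T - R')‖ := by congr 1; abel
    _ ≤ _ := (norm_add_le _ _).trans (add_le_add h₂ k₂)

theorem ApproxBy.smul {T : E →L[ℂ] F} {c : ℕ → ℝ} (h : ApproxBy T c) (t : ℂ) :
    ApproxBy (t • T) fun n => ‖t‖ * c n := fun n => by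
  obtain ⟨R, ⟨W, w₁, w₂, w₃⟩, h₂⟩ := h n
  refine ⟨t • R, ⟨W, w₁, w₂, fun x => W.smul_mem t (w₃ x)⟩, ?_⟩
  rw [← smul_sub, norm_smul]
  exact mul_le_mul_of_nonneg_left h₂ (norm_nonneg t)

/-- The errors multiply: `(S - R)(T - R')` differs from `ST` by `SR' + R(T - R')`, whose rank is at
most twice `n / 2`. -/
theorem ApproxBy.comp {S : F →L[ℂ] G} {T : E →L[ℂ] F} {c d : ℕ → ℝ} (h : ApproxBy S c)
    (k : ApproxBy T d) : ApproxBy (S ∘L T) fun n => c (n / 2) * d (n / 2) := fun n => by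
  obtain ⟨R, h₁, h₂⟩ := h (n / 2)
  obtain ⟨R', k₁, k₂⟩ := k (n / 2)
  refine ⟨S ∘L R' + R ∘L (T - R'), ((k₁.comp_left S).add (h₁.comp_right _)).mono (by omega), ?_⟩
  calc ‖S ∘L T - (S ∘L R' + R ∘L (T - R'))‖ = ‖(S - R) ∘L (T - R')‖ := by
        congr 1; ext x; simp; abel
    _ ≤ ‖S - R‖ * ‖T - R'‖ := ContinuousLinearMap.opNorm_comp_le _ _
    _ ≤ _ := mul_le_mul h₂ k₂ (norm_nonneg _) (h.nonneg _)

/-- Unlike in `ApproxBy.comp`, the index is not halved; the cyclicity proof needs this to keep the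
same bounds after cutting off by a projection. -/
theorem ApproxBy.comp_right {S : F →L[ℂ] G} {c : ℕ → ℝ} (h : ApproxBy S c)
    {T : E →L[ℂ] F} (hT : ‖T‖ ≤ 1) : ApproxBy (S ∘L T) c := fun n => by
  obtain ⟨R, h₁, h₂⟩ := h n
  refine ⟨R ∘L T, h₁.comp_right T, ?_⟩
  rw [← ContinuousLinearMap.sub_comp]
  calc ‖(S - R) ∘L T‖ ≤ ‖S - R‖ * ‖T‖ := ContinuousLinearMap.opNorm_comp_le _ _
    _ ≤ ‖S - R‖ * 1 := by gcongr
    _ ≤ c n := by rwa [mul_one]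

theorem hasSum_comp_half {c : ℕ → ℝ} (h : Summable c) :
    HasSum (fun n => c (n / 2)) (2 * ∑' n, c n) := by
  rw [two_mul]
  refine HasSum.even_add_odd ?_ ?_
  · simpa using h.hasSum
  · have : ∀ k : ℕ, (2 * k + 1) / 2 = k := fun k => by omega
    simpa only [this] using h.hasSum

/-- The operators whose approximation numbers are `O(cₙᵏ)` for some `c ∈ ℓ^q`: the weak form of the
Schatten class of exponent `q / k`, and all bounded operators for `k = 0`. -/
def IsIdeal (q k : ℕ) (T : E →L[ℂ] F) : Prop :=
  ∃ (C : ℝ) (c : ℕ → ℝ), 0 ≤ C ∧ (∀ n, 0 ≤ c n) ∧ (Summable fun n => c n ^ q) ∧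
    ApproxBy T fun n => C * c n ^ k

/-- A sum or product of two operators needs a single dominating `ℓ^q` sequence. Halving the index
only doubles the sum, and the maximum is bounded by adding the `q`-th powers. -/
theorem summable_max_half_pow {q : ℕ} {c d : ℕ → ℝ} (hc : Summable fun n => c n ^ q)
    (hd : Summable fun n => d n ^ q) (hc₀ : ∀ n, 0 ≤ c n) (hd₀ : ∀ n, 0 ≤ d n) :
    Summable fun n => max (c (n / 2)) (d (n / 2)) ^ q := by
  refine Summable.of_nonneg_of_le (fun n => pow_nonneg (le_max_of_le_left (hc₀ _)) _) (fun n => ?_)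
    (hasSum_comp_half (hc.add hd)).summable
  rcases le_total (c (n / 2)) (d (n / 2)) with h | h
  · rw [max_eq_right h]
    exact le_add_of_nonneg_left (pow_nonneg (hc₀ _) _)
  · rw [max_eq_left h]
    exact le_add_of_nonneg_right (pow_nonneg (hd₀ _) _)

variable {q : ℕ}

theorem isIdeal_bounded (hq : q ≠ 0) (T : E →L[ℂ] F) : IsIdeal q 0 T :=
  ⟨‖T‖, 0, norm_nonneg T, by simp, by simp [hq], by simpa using approxBy_norm T⟩

theorem isIdeal_zero (hq : q ≠ 0) (k : ℕ) : IsIdeal q k (0 : E →L[ℂ] F) :=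
  ⟨0, 0, le_rfl, by simp, by simp [hq], fun n => ⟨0, HasRankLE.zero n, by simp⟩⟩

theorem IsIdeal.smul {k : ℕ} {T : E →L[ℂ] F} (h : IsIdeal q k T) (t : ℂ) :
    IsIdeal q k (t • T) := by
  obtain ⟨C, c, h₁, h₂, h₃, h₄⟩ := h
  exact ⟨‖t‖ * C, c, by positivity, h₂, h₃, (h₄.smul t).mono fun n => by rw [mul_assoc]⟩

theorem IsIdeal.add {k : ℕ} {S T : E →L[ℂ] F} (h : IsIdeal q k S) (h' : IsIdeal q k T) :
    IsIdeal q k (S + T) := by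
  obtain ⟨C, c, h₁, h₂, h₃, h₄⟩ := h
  obtain ⟨D, d, k₁, k₂, k₃, k₄⟩ := h'
  refine ⟨C + D, fun n => max (c (n / 2)) (d (n / 2)), by positivity,
    fun n => le_max_of_le_left (h₂ _), summable_max_half_pow h₃ k₃ h₂ k₂,
    (h₄.add k₄).mono fun n => ?_⟩
  rw [add_mul]
  have := h₂ (n / 2)
  have := k₂ (n / 2)
  gcongr
  · exact le_max_left _ _
  · exact le_max_right _ _

/-- Exponents add because both factors are measured against powers of one common `ℓ^q` sequence.
This is the substitute for Hölder's inequality. -/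
theorem IsIdeal.comp {j k l : ℕ} {S : F →L[ℂ] G} {T : E →L[ℂ] F} (h : IsIdeal q j S)
    (h' : IsIdeal q k T) (hl : j + k = l) : IsIdeal q l (S ∘L T) := by
  obtain ⟨C, c, h₁, h₂, h₃, h₄⟩ := h
  obtain ⟨D, d, k₁, k₂, k₃, k₄⟩ := h'
  refine ⟨C * D, fun n => max (c (n / 2)) (d (n / 2)), by positivity,
    fun n => le_max_of_le_left (h₂ _), summable_max_half_pow h₃ k₃ h₂ k₂,
    (h₄.comp k₄).mono fun n => ?_⟩
  rw [← hl, pow_add, mul_mul_mul_comm]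
  have := h₂ (n / 2)
  have := k₂ (n / 2)
  gcongr
  · exact le_max_left _ _
  · exact le_max_right _ _

/-- The approximation numbers of `T` are summable. -/
def IsTraceClass (T : E →L[ℂ] F) : Prop :=
  ∃ c : ℕ → ℝ, Summable c ∧ ApproxBy T c

theorem IsTraceClass.add {S T : E →L[ℂ] F} (h : IsTraceClass S) (k : IsTraceClass T) :
    IsTraceClass (S + T) := by
  obtain ⟨c, h₁, h₂⟩ := h
  obtain ⟨d, k₁, k₂⟩ := k
  exact ⟨_, (hasSum_comp_half h₁).summable.add (hasSum_comp_half k₁).summable, h₂.add k₂⟩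

theorem IsTraceClass.smul {T : E →L[ℂ] F} (h : IsTraceClass T) (t : ℂ) :
    IsTraceClass (t • T) := by
  obtain ⟨c, h₁, h₂⟩ := h
  exact ⟨_, h₁.mul_left ‖t‖, h₂.smul t⟩

/-- Terms of a convergent series are eventually below `1`, where raising the exponent only decreases
them. -/
theorem summable_mul_pow_of_le {k : ℕ} {c : ℕ → ℝ} (hc₀ : ∀ n, 0 ≤ c n)
    (hc : Summable fun n => c n ^ q) (hq : q ≠ 0) (hk : q ≤ k) (C : ℝ) :
    Summable fun n => C * c n ^ k := by
  refine Summable.mul_left C ?_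
  have h₁ : ∀ᶠ n in Filter.atTop, c n ^ q < 1 :=
    hc.tendsto_atTop_zero.eventually (gt_mem_nhds one_pos)
  refine hc.of_norm_bounded_eventually_nat ?_
  filter_upwards [h₁] with n hn
  rw [Real.norm_of_nonneg (pow_nonneg (hc₀ n) k)]
  exact pow_le_pow_of_le_one (hc₀ n) ((pow_lt_one_iff_of_nonneg (hc₀ n) hq).1 hn).le hk

theorem IsIdeal.isTraceClass {k : ℕ} {T : E →L[ℂ] F} (h : IsIdeal q k T) (hq : q ≠ 0)
    (hk : q ≤ k) : IsTraceClass T := by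
  obtain ⟨C, c, h₁, h₂, h₃, h₄⟩ := h
  exact ⟨_, summable_mul_pow_of_le h₂ h₃ hq hk C, h₄⟩

theorem isCompactOperator_of_approxBy [CompleteSpace F] {T : E →L[ℂ] F} {c : ℕ → ℝ}
    (h : ApproxBy T c) (hc : Filter.Tendsto c Filter.atTop (nhds 0)) : IsCompactOperator T := by
  choose R h₁ h₂ using h
  refine isCompactOperator_of_tendsto (F := R) (l := Filter.atTop) ?_
    (Filter.Eventually.of_forall fun n => ?_)
  · rw [tendsto_iff_norm_sub_tendsto_zero]
    refine squeeze_zero (fun n => norm_nonneg _) (fun n => ?_) hc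
    rw [norm_sub_rev]
    exact h₂ n
  · obtain ⟨W, w₁, w₂, w₃⟩ := h₁ n
    have : ProperSpace W := FiniteDimensional.proper ℂ W
    have := isCompactOperator_of_locallyCompactSpace_dom ((R n).codRestrict W w₃)
    exact this.clm_comp W.subtypeL

end Approximation

/-! ## Singular values -/

section SingularValues

open ContinuousLinearMap

variable {E : Type*} [NormedAddCommGroup E] [InnerProductSpace ℂ E] [CompleteSpace E]
variable {F : Type*} [NormedAddCommGroup F] [InnerProductSpace ℂ F] [CompleteSpace F]

theorem absOp_isPositive (T : E →L[ℂ] F) : (absOp T).IsPositive :=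
  (ContinuousLinearMap.nonneg_iff_isPositive _).1 (CFC.sqrt_nonneg _)

theorem absOp_comp_absOp (T : E →L[ℂ] F) : absOp T ∘L absOp T = adjoint T ∘L T :=
  CFC.sqrt_mul_sqrt_self _
    ((ContinuousLinearMap.nonneg_iff_isPositive _).2 (isPositive_adjoint_comp_self T))

theorem norm_absOp_apply (T : E →L[ℂ] F) (x : E) : ‖absOp T x‖ = ‖T x‖ := by
  have h : inner ℂ (absOp T x) (absOp T x) = inner ℂ (T x) (T x) := by
    rw [(absOp_isPositive T).inner_left_eq_inner_right, ← adjoint_inner_right]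
    exact congrArg (fun A : E →L[ℂ] E => inner ℂ x (A x)) (absOp_comp_absOp T)
  rw [inner_self_eq_norm_sq_to_K, inner_self_eq_norm_sq_to_K] at h
  have h' : ‖absOp T x‖ ^ 2 = ‖T x‖ ^ 2 := by exact_mod_cast h
  exact (pow_left_inj₀ (norm_nonneg _) (norm_nonneg _) two_ne_zero).1 h'

/-- Since `‖|T| x‖ = ‖T x‖`, preimages of the centres of a finite `ε`-net for the image of the ball
under `T` give one for its image under `|T|`. No polar decomposition is needed. -/
theorem isCompactOperator_absOp {T : E →L[ℂ] F} (hT : IsCompactOperator T) :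
    IsCompactOperator (absOp T) := by
  have h₁ := (isCompactOperator_iff_isCompact_closure_image_ball (T : E →ₗ[ℂ] F) one_pos).1 hT
  have h₂ : TotallyBounded (T '' Metric.ball 0 1) := h₁.totallyBounded.subset subset_closure
  refine (isCompactOperator_iff_isCompact_closure_image_ball (absOp T : E →ₗ[ℂ] E) one_pos).2
    (TotallyBounded.isCompact_of_isClosed (TotallyBounded.closure ?_) isClosed_closure)
  refine Metric.totallyBounded_iff.2 fun ε hε => ?_
  obtain ⟨t, ht, ht', hs⟩ := Metric.finite_approx_of_totallyBounded h₂ ε hε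
  obtain ⟨t', ht'', hf, rfl⟩ := Set.exists_subset_image_finite_and.1 ⟨t, ht, ht', rfl⟩
  refine ⟨absOp T '' t', hf.image _, ?_⟩
  rintro _ ⟨x, hx, rfl⟩
  obtain ⟨_, ⟨y, hy, rfl⟩, hxy⟩ := Set.mem_iUnion₂.1 (hs ⟨x, hx, rfl⟩)
  refine Set.mem_iUnion₂.2 ⟨absOp T y, ⟨y, hy, rfl⟩, ?_⟩
  rw [Metric.mem_ball, dist_eq_norm] at hxy ⊢
  have : ‖absOp T (x - y)‖ < ε := by rwa [norm_absOp_apply, map_sub]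
  simpa using this

/-- The eigenspaces of `|T|`. -/
abbrev absEigenspace (T : E →L[ℂ] F) (μ : ℂ) : Submodule ℂ E :=
  Module.End.eigenspace (absOp T : E →ₗ[ℂ] E) μ

/-- Positivity of `|T|` makes `μ ‖x‖²` a nonnegative real for every eigenvector `x`. It lets the sum
over positive reals in `IsSchatten` be taken over all of `ℂ`. -/
theorem absEigenspace_eq_bot (T : E →L[ℂ] F) {μ : ℂ}
    (hμ : μ ∉ Set.range fun s : {s : ℝ // 0 < s} => ((s : ℝ) : ℂ)) (hμ₀ : μ ≠ 0) :
    absEigenspace T μ = ⊥ := by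
  refine (Submodule.eq_bot_iff _).2 fun x hx => ?_
  by_contra hx₀
  have hx' : absOp T x = μ • x := Module.End.mem_eigenspace_iff.1 hx
  have h₁ := (absOp_isPositive T).inner_nonneg_right x
  rw [hx', inner_smul_right, inner_self_eq_norm_sq_to_K] at h₁
  have h₂ : (0 : ℝ) < ‖x‖ ^ 2 := by positivity
  obtain ⟨h₃, h₄⟩ := Complex.le_def.1 h₁
  have e : ((‖x‖ : ℂ) ^ 2) = ((‖x‖ ^ 2 : ℝ) : ℂ) := by push_cast; rfl
  rw [show ((RCLike.ofReal ‖x‖ : ℂ)) = (‖x‖ : ℂ) from rfl, e] at h₃ h₄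
  rw [Complex.re_mul_ofReal] at h₃
  rw [Complex.im_mul_ofReal] at h₄
  have h₅ : μ.im = 0 := by
    rcases mul_eq_zero.1 h₄.symm with h | h
    · exact h
    · exact absurd h h₂.ne'
  have h₆ : 0 ≤ μ.re := by
    by_contra hneg
    exact absurd h₃ (not_le.2 (mul_neg_of_neg_of_pos (not_le.1 hneg) h₂))
  refine hμ ⟨⟨μ.re, lt_of_le_of_ne h₆ fun h => hμ₀ ?_⟩, ?_⟩
  · exact Complex.ext h.symm h₅
  · exact Complex.ext rfl h₅.symm

/-- Passes from eigenvalues counted with multiplicity to a sum over distinct eigenvalues. The fibre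
over `0` may be infinite, but its terms vanish because `p > 0`. -/
theorem summable_sigma_norm_rpow_iff {ι : ℂ → Type*} {N : ℂ → ℕ}
    (hcard : ∀ μ : ℂ, μ ≠ 0 → Finite (ι μ) ∧ Nat.card (ι μ) = N μ) {p : ℝ} (hp : 0 < p) :
    (Summable fun a : Σ μ : ℂ, ι μ => ‖a.1‖ ^ p) ↔ Summable fun μ : ℂ => (N μ : ℝ) * ‖μ‖ ^ p := by
  rw [summable_sigma_of_nonneg fun a => by positivity]
  have h₁ : ∀ μ : ℂ, Summable fun _ : ι μ => ‖μ‖ ^ p := fun μ => by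
    rcases eq_or_ne μ 0 with rfl | hμ
    · simp [Real.zero_rpow hp.ne']
    · have := (hcard μ hμ).1
      exact Summable.of_finite
  have h₂ : ∀ μ : ℂ, ∑' _ : ι μ, ‖μ‖ ^ p = (N μ : ℝ) * ‖μ‖ ^ p := fun μ => by
    rcases eq_or_ne μ 0 with rfl | hμ
    · simp [Real.zero_rpow hp.ne']
    · rw [tsum_const, (hcard μ hμ).2, nsmul_eq_mul]
  simp only [h₁, implies_true, true_and, h₂]

theorem summable_singularMultiplicity_iff (T : E →L[ℂ] F) {p : ℝ} (hp : 0 < p) :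
    (Summable fun s : {s : ℝ // 0 < s} => (singularMultiplicity T s : ℝ) * (s : ℝ) ^ p) ↔
      Summable fun μ : ℂ => (Module.finrank ℂ (absEigenspace T μ) : ℝ) * ‖μ‖ ^ p := by
  have hinj : Function.Injective fun s : {s : ℝ // 0 < s} => ((s : ℝ) : ℂ) := fun s t h =>
    Subtype.ext (Complex.ofReal_injective h)
  rw [← hinj.summable_iff]
  · refine summable_congr fun s => ?_
    simp only [Function.comp, Complex.norm_real, Real.norm_of_nonneg s.2.le]
    rfl
  · intro μ hμ
    rcases eq_or_ne μ 0 with rfl | hμ₀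
    · simp [Real.zero_rpow hp.ne']
    · rw [absEigenspace_eq_bot T hμ hμ₀]; simp

theorem inner_eq_zero_of_hilbertBasis {K : Submodule ℂ E} {ι : Type*} (b : HilbertBasis ι ℂ K)
    {x : E} (hx : ∀ i, inner ℂ x (b i : E) = 0) (y : K) : inner ℂ x (y : E) = 0 := by
  have h := (b.hasSum_repr y).mapL ((innerSL ℂ x).comp K.subtypeL)
  have h₀ : (fun i => (innerSL ℂ x).comp K.subtypeL (b.repr y i • b i)) = 0 := by
    funext i
    simp [hx i]
  rw [h₀] at h
  exact h.unique hasSum_zero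

end SingularValues

section SingularBasis

open ContinuousLinearMap

variable {E : Type w} [NormedAddCommGroup E] [InnerProductSpace ℂ E] [CompleteSpace E]
variable {F : Type*} [NormedAddCommGroup F] [InnerProductSpace ℂ F] [CompleteSpace F]

/-- An orthonormal basis of eigenvectors of `|T|`, for compact `T`. -/
theorem exists_hilbertBasis_absOp {T : E →L[ℂ] F} (hT : IsCompactOperator T) :
    ∃ (ι : Type w) (u : HilbertBasis ι ℂ E) (μ : ι → ℂ),
      (∀ i, absOp T (u i) = μ i • u i) ∧
      ∀ p : ℝ, 0 < p → ((Summable fun s : {s : ℝ // 0 < s} =>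
        (singularMultiplicity T s : ℝ) * (s : ℝ) ^ p) ↔ Summable fun i => ‖μ i‖ ^ p) := by
  have hcpt := isCompactOperator_absOp hT
  have hsymm := (absOp_isPositive T).isSymmetric
  have hclosed : ∀ μ : ℂ, IsClosed (absEigenspace T μ : Set E) := fun μ => by
    have : (absEigenspace T μ : Set E) = {x | absOp T x = μ • x} := by
      ext x; exact Module.End.mem_eigenspace_iff
    rw [this]
    exact isClosed_eq (absOp T).continuous (continuous_const_smul μ)
  have hcomplete : ∀ μ : ℂ, CompleteSpace (absEigenspace T μ) := fun μ =>
    (hclosed μ).completeSpace_coe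
  choose w bas hbas using fun μ : ℂ => exists_hilbertBasis ℂ (absEigenspace T μ)
  -- Compactness is essential here: `Module.finrank` would be `0` on an infinite-dimensional
  -- eigenspace and lose its multiplicity.
  have hcard : ∀ μ : ℂ, μ ≠ 0 → Finite (w μ) ∧
      Nat.card (w μ) = Module.finrank ℂ (absEigenspace T μ) := fun μ hμ => by
    have : FiniteDimensional ℂ (absEigenspace T μ) :=
      ContinuousLinearMap.finite_dimensional_eigenspace hcpt μ hμ
    have : Finite (w μ) := (bas μ).orthonormal.linearIndependent.finite
    have := Fintype.ofFinite (w μ)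
    exact ⟨inferInstance, by
      rw [Nat.card_eq_fintype_card,
        Module.finrank_eq_card_basis (bas μ).toOrthonormalBasis.toBasis]⟩
  have horth := hsymm.orthogonalFamily_eigenspaces.orthonormal_sigma_orthonormal
    (fun μ => (bas μ).orthonormal)
  -- The spectral theorem says that the eigenspaces have trivial common orthogonal complement; a
  -- vector orthogonal to the chosen bases is orthogonal to every eigenspace.
  have hspan : (Submodule.span ℂ (Set.range fun a : Σ μ : ℂ, w μ =>
      ((absEigenspace T a.1).subtypeₗᵢ (bas a.1 a.2))))ᗮ = ⊥ := by
    rw [← ContinuousLinearMap.orthogonalComplement_iSup_eigenspaces_eq_bot hcpt hsymm]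
    refine le_antisymm ?_ (Submodule.orthogonal_le (Submodule.span_le.2 ?_))
    · intro x hx
      rw [← Submodule.iInf_orthogonal, Submodule.mem_iInf]
      refine fun μ => (Submodule.mem_orthogonal' _ _).2 fun y hy =>
        inner_eq_zero_of_hilbertBasis (bas μ) (fun i => ?_) ⟨y, hy⟩
      exact (Submodule.mem_orthogonal' _ _).1 hx _ (Submodule.subset_span ⟨⟨μ, i⟩, rfl⟩)
    · rintro _ ⟨a, rfl⟩
      exact Submodule.mem_iSup_of_mem a.1 (bas a.1 a.2).2
  refine ⟨Σ μ : ℂ, w μ, HilbertBasis.mkOfOrthogonalEqBot horth hspan, fun a => a.1, fun a => ?_,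
    fun p hp => ?_⟩
  · rw [HilbertBasis.coe_mkOfOrthogonalEqBot]
    exact Module.End.mem_eigenspace_iff.1 (bas a.1 a.2).2
  · rw [summable_singularMultiplicity_iff T hp]
    exact (summable_sigma_norm_rpow_iff hcard hp).symm

end SingularBasis

/-! ### Singular values versus approximation numbers -/

section Truncation

open ContinuousLinearMap

theorem hasSum_norm_inner_sq {E ι : Type*} [NormedAddCommGroup E] [InnerProductSpace ℂ E]
    (u : HilbertBasis ι ℂ E) (x : E) : HasSum (fun i => ‖inner ℂ (u i) x‖ ^ 2) (‖x‖ ^ 2) := by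
  have h := u.hasSum_inner_mul_inner x x
  rw [inner_self_eq_norm_sq_to_K] at h
  have e : (fun i => inner ℂ x (u i) * inner ℂ (u i) x) =
      fun i => ((‖inner ℂ (u i) x‖ ^ 2 : ℝ) : ℂ) := by
    funext i
    rw [← inner_conj_symm x (u i), Complex.conj_mul']
    push_cast
    rfl
  rw [e] at h
  refine Complex.hasSum_ofReal.1 ?_
  rw [Complex.ofReal_pow]
  exact h

variable {E : Type w} [NormedAddCommGroup E] [InnerProductSpace ℂ E] [CompleteSpace E]
variable {F : Type*} [NormedAddCommGroup F] [InnerProductSpace ℂ F] [CompleteSpace F]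
variable {T : E →L[ℂ] F} {ι : Type*} {u : HilbertBasis ι ℂ E} {μ : ι → ℂ}

/-- Parseval for `|T| y`. All norm comparisons below are made term by term in this series. -/
theorem hasSum_norm_apply_sq (hu : ∀ i, absOp T (u i) = μ i • u i) (y : E) :
    HasSum (fun i => ‖μ i‖ ^ 2 * ‖inner ℂ (u i) y‖ ^ 2) (‖T y‖ ^ 2) := by
  rw [← norm_absOp_apply]
  convert hasSum_norm_inner_sq u (absOp T y) using 2 with i
  rw [← (absOp_isPositive T).inner_left_eq_inner_right, hu, inner_smul_left, norm_mul, mul_pow,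
    RCLike.norm_conj]

theorem norm_apply_basis (hu : ∀ i, absOp T (u i) = μ i • u i) (i : ι) :
    ‖T (u i)‖ = ‖μ i‖ := by
  rw [← norm_absOp_apply, hu, norm_smul, u.orthonormal.1 i, mul_one]

theorem norm_le_of_forall_le (hu : ∀ i, absOp T (u i) = μ i • u i) {c : ℝ} (hc : 0 ≤ c) {y z : E}
    (h : ∀ i, ‖μ i‖ * ‖inner ℂ (u i) y‖ ≤ c * ‖inner ℂ (u i) z‖) : ‖T y‖ ≤ c * ‖z‖ := by
  refine (pow_le_pow_iff_left₀ (norm_nonneg _) (by positivity) two_ne_zero).1 ?_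
  rw [mul_pow]
  refine hasSum_le (fun i => ?_) (hasSum_norm_apply_sq hu y)
    ((hasSum_norm_inner_sq u z).mul_left (c ^ 2))
  rw [← mul_pow, ← mul_pow]
  exact pow_le_pow_left₀ (by positivity) (h i) 2

theorem le_norm_of_forall_le (hu : ∀ i, absOp T (u i) = μ i • u i) {c : ℝ} (hc : 0 ≤ c) {y : E}
    (h : ∀ i, c * ‖inner ℂ (u i) y‖ ≤ ‖μ i‖ * ‖inner ℂ (u i) y‖) : c * ‖y‖ ≤ ‖T y‖ := by
  refine (pow_le_pow_iff_left₀ (by positivity) (norm_nonneg _) two_ne_zero).1 ?_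
  rw [mul_pow]
  refine hasSum_le (fun i => ?_) ((hasSum_norm_inner_sq u y).mul_left (c ^ 2))
    (hasSum_norm_apply_sq hu y)
  rw [← mul_pow, ← mul_pow]
  exact pow_le_pow_left₀ (by positivity) (h i) 2

/-- Keep `T` on the span of the eigenvectors indexed by `A`; on the orthogonal complement all
singular values are at most `c`. -/
theorem exists_truncation (hu : ∀ i, absOp T (u i) = μ i • u i) (A : Finset ι) {c : ℝ}
    (hc : 0 ≤ c) (hA : ∀ i ∉ A, ‖μ i‖ ≤ c) :
    ∃ R : E →L[ℂ] F, HasRankLE R A.card ∧ ‖T - R‖ ≤ c := by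
  classical
  set P : E →L[ℂ] E := ∑ i ∈ A, InnerProductSpace.rankOne ℂ (u i) (u i) with hP
  have hPy : ∀ y, P y = ∑ i ∈ A, inner ℂ (u i) y • u i := fun y => by
    simp [hP]
  refine ⟨T ∘L P, ⟨Submodule.span ℂ (A.image fun i => T (u i) : Finset F), inferInstance,
    (finrank_span_finset_le_card _).trans Finset.card_image_le, fun y => ?_⟩, ?_⟩
  · rw [ContinuousLinearMap.comp_apply, hPy, map_sum]
    refine Submodule.sum_mem _ fun i hi => ?_
    rw [map_smul]
    exact Submodule.smul_mem _ _ (Submodule.subset_span (by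
      simpa using ⟨i, hi, rfl⟩))
  · refine ContinuousLinearMap.opNorm_le_bound _ hc fun y => ?_
    have : (T - T ∘L P) y = T (y - P y) := by simp
    rw [this]
    refine norm_le_of_forall_le hu hc fun i => ?_
    have hi : inner ℂ (u i) (y - P y) = if i ∈ A then 0 else inner ℂ (u i) y := by
      rw [inner_sub_right, hPy, inner_sum]
      simp only [inner_smul_right, orthonormal_iff_ite.1 u.orthonormal, mul_ite, mul_one, mul_zero]
      rw [Finset.sum_ite_eq]
      split_ifs <;> simp
    rw [hi]
    split_ifs with h
    · simp; positivity
    · exact mul_le_mul_of_nonneg_right (hA i h) (norm_nonneg _)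

/-- The min-max argument: the span of more than `n` eigenvectors contains a nonzero vector killed by
`R`, and `T` stretches that vector by at least `c`. -/
theorem le_norm_sub_of_hasRankLE (hu : ∀ i, absOp T (u i) = μ i • u i) {A : Finset ι} {c : ℝ}
    (hc : 0 ≤ c) (hA : ∀ i ∈ A, c ≤ ‖μ i‖) {R : E →L[ℂ] F} {n : ℕ} (hR : HasRankLE R n)
    (hn : n < A.card) : c ≤ ‖T - R‖ := by
  obtain ⟨W, w₁, w₂, w₃⟩ := hR
  set V := Submodule.span ℂ (Set.range fun i : A => u i) with hV
  have hVfin : FiniteDimensional ℂ V := FiniteDimensional.span_of_finite ℂ (Set.finite_range _)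
  have hVcard : Module.finrank ℂ V = A.card := by
    have := finrank_span_eq_card
      (u.orthonormal.linearIndependent.comp (fun i : A => (i : ι)) Subtype.val_injective)
    rwa [Fintype.card_coe] at this
  have hker := LinearMap.ker_ne_bot_of_finrank_lt
    (f := ((R : E →ₗ[ℂ] F).codRestrict W w₃).comp V.subtype) (by omega)
  obtain ⟨y, hy, hy₀⟩ := (Submodule.ne_bot_iff _).1 hker
  have hRy : R (y : E) = 0 := congrArg Subtype.val (LinearMap.mem_ker.1 hy)
  have hy₁ : ∀ i ∉ A, inner ℂ (u i) (y : E) = 0 := fun i hi => by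
    have : (y : E) ∈ (Submodule.span ℂ {u i})ᗮ := by
      refine (Submodule.span_le.2 ?_) y.2
      rintro _ ⟨j, rfl⟩
      refine Submodule.mem_orthogonal_singleton_iff_inner_right.2 (u.orthonormal.2 ?_)
      rintro rfl
      exact hi j.2
    exact Submodule.mem_orthogonal_singleton_iff_inner_right.1 this
  have h₁ : c * ‖(y : E)‖ ≤ ‖T (y : E)‖ := le_norm_of_forall_le hu hc fun i => by
    by_cases hi : i ∈ A
    · exact mul_le_mul_of_nonneg_right (hA i hi) (norm_nonneg _)
    · simp [hy₁ i hi]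
  have h₂ : ‖T (y : E)‖ ≤ ‖T - R‖ * ‖(y : E)‖ := by
    simpa [hRy] using (T - R).le_opNorm (y : E)
  have h₃ : 0 < ‖(y : E)‖ := norm_pos_iff.2 fun h => hy₀ (Subtype.ext h)
  exact le_of_mul_le_mul_right (h₁.trans h₂) h₃

/-- By induction on the size of `A`, the smallest of `n + 1` singular values is at most `c n`.
Removing the minimum avoids ordering the singular values. -/
theorem sum_norm_le_of_approxBy (hu : ∀ i, absOp T (u i) = μ i • u i) {c : ℕ → ℝ}
    (h : ApproxBy T c) : ∀ A : Finset ι, ∑ i ∈ A, ‖μ i‖ ≤ ∑ n ∈ Finset.range A.card, c n := by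
  classical
  intro A
  induction hn : A.card generalizing A with
  | zero => simp [Finset.card_eq_zero.1 hn]
  | succ n ih =>
    obtain ⟨i, hi, hmin⟩ := A.exists_min_image (fun i => ‖μ i‖) (Finset.card_pos.1 (by omega))
    rw [← Finset.sum_erase_add _ _ hi, Finset.sum_range_succ]
    refine add_le_add (ih _ (by rw [Finset.card_erase_of_mem hi, hn]; rfl)) ?_
    obtain ⟨R, h₁, h₂⟩ := h n
    exact (le_norm_sub_of_hasRankLE hu (norm_nonneg _) hmin h₁ (by omega)).trans h₂

theorem summable_norm_of_approxBy (hu : ∀ i, absOp T (u i) = μ i • u i) {c : ℕ → ℝ}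
    (h : ApproxBy T c) (hc : Summable c) :
    (Summable fun i => ‖μ i‖) ∧ ∑' i, ‖μ i‖ ≤ ∑' n, c n := by
  have hb : ∀ A : Finset ι, ∑ i ∈ A, ‖μ i‖ ≤ ∑' n, c n := fun A =>
    (sum_norm_le_of_approxBy hu h A).trans (hc.sum_le_tsum _ fun n _ => h.nonneg n)
  have hs := summable_of_sum_le (fun i => norm_nonneg (μ i)) hb
  exact ⟨hs, hs.tsum_le_of_sum_le hb⟩

/-- A `p`-summable family of nonnegative numbers can be exhausted greedily. -/
theorem exists_greedy_sequence {a : ι → ℝ} (ha : ∀ i, 0 ≤ a i) {p : ℝ} (hp : 0 < p)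
    (hs : Summable fun i => a i ^ p) :
    ∃ (c : ℕ → ℝ) (A : ℕ → Finset ι), (∀ n, 0 ≤ c n) ∧ (Summable fun n => c n ^ p) ∧
      (∀ n, (A n).card ≤ n) ∧ ∀ n, ∀ i ∉ A n, a i ≤ c n := by
  classical
  have step : ∀ A : Finset ι, ∃ (B : Finset ι) (c : ℝ), 0 ≤ c ∧ A ⊆ B ∧ B.card ≤ A.card + 1 ∧
      (∀ i ∉ A, a i ≤ c) ∧ ∑ i ∈ A, a i ^ p + c ^ p ≤ ∑ i ∈ B, a i ^ p := fun A => by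
    by_cases h : ∀ i ∉ A, a i ≤ 0
    · exact ⟨A, 0, le_rfl, subset_rfl, by omega, h, by simp [Real.zero_rpow hp.ne']⟩
    · push Not at h
      obtain ⟨i₀, hi₀, hpos⟩ := h
      -- Summability leaves only finitely many entries as large as `a i₀`, so the maximum outside
      -- `A` is attained; it is both the next bound `c` and the next entry to be removed.
      have hfin : {i | a i₀ ^ p ≤ a i ^ p}.Finite := by
        have := (hs.tendsto_cofinite_zero.eventually
          (gt_mem_nhds (Real.rpow_pos_of_pos hpos p)))
        simpa [Filter.eventually_cofinite] using this
      have hfin' : {i | i ∉ A ∧ a i₀ ≤ a i}.Finite := hfin.subset fun i hi =>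
        Real.rpow_le_rpow hpos.le hi.2 hp.le
      obtain ⟨i₁, ⟨h₁, h₂⟩, h₃⟩ := Set.exists_max_image _ a hfin' ⟨i₀, hi₀, le_rfl⟩
      refine ⟨insert i₁ A, a i₁, ha i₁, Finset.subset_insert _ _, Finset.card_insert_le _ _,
        fun i hi => ?_, ?_⟩
      · rcases le_total (a i₀) (a i) with h | h
        · exact h₃ i ⟨hi, h⟩
        · exact h.trans h₂
      · rw [Finset.sum_insert h₁, add_comm]
  choose B c hc hAB hcard hle hsum using step
  let A : ℕ → Finset ι := fun n => B^[n] ∅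
  have hA : ∀ n, A (n + 1) = B (A n) := fun n => Function.iterate_succ_apply' _ _ _
  refine ⟨fun n => c (A n), A, fun n => hc _, ?_, fun n => ?_, fun n => hle _⟩
  · have hpart : ∀ n, ∑ k ∈ Finset.range n, c (A k) ^ p ≤ ∑ i ∈ A n, a i ^ p := fun n => by
      induction n with
      | zero => simp [A]
      | succ n ih =>
        rw [Finset.sum_range_succ, hA]
        exact (add_le_add_left ih _).trans (hsum _)
    exact summable_of_sum_range_le (fun n => Real.rpow_nonneg (hc _) _) fun n =>
      (hpart n).trans (hs.sum_le_tsum _ fun i _ => Real.rpow_nonneg (ha i) _)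
  · induction n with
    | zero => simp [A]
    | succ n ih => rw [hA]; exact (hcard _).trans (by omega)

end Truncation

/-! ### Schatten classes versus the ideals of approximable operators -/

section Schatten

open ContinuousLinearMap

variable {E : Type*} [NormedAddCommGroup E] [InnerProductSpace ℂ E] [CompleteSpace E]
variable {F : Type*} [NormedAddCommGroup F] [InnerProductSpace ℂ F] [CompleteSpace F]

theorem IsSchatten.exists_approxBy {p : ℝ} (hp : 0 < p) {T : E →L[ℂ] F} (h : IsSchatten p T) :
    ∃ c : ℕ → ℝ, (∀ n, 0 ≤ c n) ∧ (Summable fun n => c n ^ p) ∧ ApproxBy T c := by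
  obtain ⟨ι, u, μ, hu, hμ⟩ := exists_hilbertBasis_absOp h.1
  obtain ⟨c, A, h₁, h₂, h₃, h₄⟩ :=
    exists_greedy_sequence (fun i => norm_nonneg (μ i)) hp ((hμ p hp).1 h.2)
  refine ⟨c, h₁, h₂, fun n => ?_⟩
  obtain ⟨R, hR, hR'⟩ := exists_truncation hu (A n) (h₁ n) (h₄ n)
  exact ⟨R, hR.mono (h₃ n), hR'⟩

/-- Replaces the real exponent `p` by an integer `q ≥ p`, so that exponents and degrees can be
compared as natural numbers. -/
theorem IsSchatten.isIdeal {p : ℝ} (hp : 0 < p) {q : ℕ} (hpq : p ≤ q) {T : E →L[ℂ] F}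
    (h : IsSchatten p T) : IsIdeal q 1 T := by
  obtain ⟨c, h₁, h₂, h₃⟩ := h.exists_approxBy hp
  refine ⟨1, c, zero_le_one, h₁, ?_, by simpa using h₃⟩
  refine h₂.of_norm_bounded_eventually_nat ?_
  filter_upwards [h₂.tendsto_atTop_zero.eventually (gt_mem_nhds one_pos)] with n hn
  have hn' : c n ≤ 1 := by
    by_contra hcon
    exact absurd hn (not_lt.2 (Real.one_le_rpow (not_le.1 hcon).le hp.le))
  rw [Real.norm_of_nonneg (pow_nonneg (h₁ n) q), ← Real.rpow_natCast]
  rcases eq_or_lt_of_le (h₁ n) with h₀ | h₀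
  · rw [← h₀, Real.zero_rpow hp.ne', Real.zero_rpow (hp.trans_le hpq).ne']
  · exact Real.rpow_le_rpow_of_exponent_ge h₀ hn' hpq

theorem IsTraceClass.isCompactOperator {T : E →L[ℂ] F} (h : IsTraceClass T) :
    IsCompactOperator T := by
  obtain ⟨c, h₁, h₂⟩ := h
  exact isCompactOperator_of_approxBy h₂ h₁.tendsto_atTop_zero

theorem IsTraceClass.isSchatten {T : E →L[ℂ] F} (h : IsTraceClass T) : IsSchatten 1 T := by
  obtain ⟨ι, u, μ, hu, hμ⟩ := exists_hilbertBasis_absOp h.isCompactOperator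
  obtain ⟨c, h₁, h₂⟩ := id h
  refine ⟨h.isCompactOperator, (hμ 1 one_pos).2 ?_⟩
  simpa using (summable_norm_of_approxBy hu h₂ h₁).1

end Schatten

/-! ## The trace -/

section Trace

open ContinuousLinearMap

theorem summable_mul_of_sq {ι : Type*} {a b : ι → ℝ} {r s : ℝ} (ha : ∀ i, 0 ≤ a i)
    (hb : ∀ i, 0 ≤ b i) (hr : 0 ≤ r) (hs : 0 ≤ s) (ha₂ : HasSum (fun i => a i ^ 2) (r ^ 2))
    (hb₂ : HasSum (fun i => b i ^ 2) (s ^ 2)) :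
    (Summable fun i => a i * b i) ∧ ∑' i, a i * b i ≤ r * s := by
  have hs₁ : Summable fun i => a i * b i :=
    Summable.of_nonneg_of_le (fun i => mul_nonneg (ha i) (hb i))
      (fun i => by nlinarith [sq_nonneg (a i - b i), sq_nonneg (a i), sq_nonneg (b i)])
      (ha₂.summable.add hb₂.summable)
  refine ⟨hs₁, hs₁.tsum_le_of_sum_le fun A => ?_⟩
  have h₁ := Finset.sum_mul_sq_le_sq_mul_sq A a b
  have h₂ : ∑ i ∈ A, a i ^ 2 ≤ r ^ 2 := sum_le_hasSum A (fun i _ => sq_nonneg _) ha₂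
  have h₃ : ∑ i ∈ A, b i ^ 2 ≤ s ^ 2 := sum_le_hasSum A (fun i _ => sq_nonneg _) hb₂
  refine (pow_le_pow_iff_left₀ (Finset.sum_nonneg fun i _ => mul_nonneg (ha i) (hb i))
    (mul_nonneg hr hs) two_ne_zero).1 (h₁.trans ?_)
  rw [mul_pow]
  exact mul_le_mul h₂ h₃ (Finset.sum_nonneg fun i _ => sq_nonneg _) (sq_nonneg r)

variable {E : Type w} [NormedAddCommGroup E] [InnerProductSpace ℂ E] [CompleteSpace E]
variable {F : Type*} [NormedAddCommGroup F] [InnerProductSpace ℂ F] [CompleteSpace F]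

/-- Expand `⟨uⱼ, T uⱼ⟩` in the basis `e` and interchange the sums. The double series converges
absolutely since Cauchy-Schwarz bounds its `j`-th row by `‖T uⱼ‖`. -/
theorem hasSum_inner_of_summable_norm {ι κ : Type*} (u : HilbertBasis ι ℂ E)
    (e : HilbertBasis κ ℂ E) {T : E →L[ℂ] E} (hT : Summable fun j => ‖T (u j)‖) :
    HasSum (fun i => inner ℂ (e i) (T (e i))) (∑' j, inner ℂ (u j) (T (u j))) := by
  set f : ι × κ → ℂ := fun a => inner ℂ (u a.1) (e a.2) * inner ℂ (e a.2) (T (u a.1)) with hf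
  have hfib : ∀ j, (Summable fun i => ‖f (j, i)‖) ∧ ∑' i, ‖f (j, i)‖ ≤ ‖T (u j)‖ := fun j => by
    have h := summable_mul_of_sq (fun i => norm_nonneg (inner ℂ (e i) (u j)))
      (fun i => norm_nonneg (inner ℂ (e i) (T (u j)))) (norm_nonneg _) (norm_nonneg _)
      (hasSum_norm_inner_sq e (u j)) (hasSum_norm_inner_sq e (T (u j)))
    rw [u.orthonormal.1 j, one_mul] at h
    simpa only [hf, norm_mul, norm_inner_symm (u j)] using h
  have hsum : Summable f := by
    refine Summable.of_norm ((summable_prod_of_nonneg fun a => norm_nonneg _).2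
      ⟨fun j => (hfib j).1, ?_⟩)
    exact Summable.of_nonneg_of_le (fun j => tsum_nonneg fun i => norm_nonneg _)
      (fun j => (hfib j).2) hT
  have h₁ : ∀ j, HasSum (fun i => f (j, i)) (inner ℂ (u j) (T (u j))) := fun j =>
    e.hasSum_inner_mul_inner (u j) (T (u j))
  have h₂ : ∀ i, HasSum (fun j => f (j, i)) (inner ℂ (e i) (T (e i))) := fun i => by
    have h := (u.hasSum_repr (e i)).mapL ((innerSL ℂ (e i)).comp T)
    simpa [u.repr_apply_apply, hf] using h
  have h₃ := hsum.hasSum.prod_fiberwise h₁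
  rw [h₃.tsum_eq]
  have hswap : HasSum (fun a : κ × ι => f a.swap) (∑' a, f a) :=
    (Equiv.prodComm κ ι).hasSum_iff.2 hsum.hasSum
  exact hswap.prod_fiberwise h₂

/-- Eigenvectors of `|T|` work: there `‖T uⱼ‖` is a singular value. -/
theorem IsTraceClass.exists_basis {T : E →L[ℂ] E} {c : ℕ → ℝ} (hc : Summable c)
    (h : ApproxBy T c) : ∃ (ι : Type w) (u : HilbertBasis ι ℂ E),
      (Summable fun j => ‖T (u j)‖) ∧ ∑' j, ‖T (u j)‖ ≤ ∑' n, c n := by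
  obtain ⟨ι, u, μ, hu, -⟩ := exists_hilbertBasis_absOp
    (IsTraceClass.isCompactOperator ⟨c, hc, h⟩)
  refine ⟨ι, u, ?_⟩
  simp only [norm_apply_basis hu]
  exact summable_norm_of_approxBy hu h hc

theorem IsTraceClass.summable_inner {T : E →L[ℂ] E} (h : IsTraceClass T) {κ : Type*}
    (e : HilbertBasis κ ℂ E) : Summable fun i => inner ℂ (e i) (T (e i)) := by
  obtain ⟨c, h₁, h₂⟩ := h
  obtain ⟨ι, u, h₃, -⟩ := IsTraceClass.exists_basis h₁ h₂
  exact (hasSum_inner_of_summable_norm u e h₃).summable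

/-- Hides the chosen basis in `opTrace`; later arguments use only that the same basis serves all
operators on `E`. -/
theorem exists_opTrace_basis (E : Type w) [NormedAddCommGroup E] [InnerProductSpace ℂ E]
    [CompleteSpace E] : ∃ (κ : Type w) (e : HilbertBasis κ ℂ E),
      ∀ T : E →L[ℂ] E, opTrace T = ∑' i, inner ℂ (e i) (T (e i)) :=
  ⟨_, (exists_hilbertBasis ℂ E).choose_spec.choose, fun _ => rfl⟩

theorem norm_opTrace_le {T : E →L[ℂ] E} {c : ℕ → ℝ} (hc : Summable c) (h : ApproxBy T c) :
    ‖opTrace T‖ ≤ ∑' n, c n := by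
  obtain ⟨ι, u, h₁, h₂⟩ := IsTraceClass.exists_basis hc h
  obtain ⟨κ, e, he⟩ := exists_opTrace_basis E
  rw [he, (hasSum_inner_of_summable_norm u e h₁).tsum_eq]
  have h₃ : ∀ j, ‖inner ℂ (u j) (T (u j))‖ ≤ ‖T (u j)‖ := fun j => by
    simpa [u.orthonormal.1 j] using norm_inner_le_norm (𝕜 := ℂ) (u j) (T (u j))
  exact (tsum_of_norm_bounded h₁.hasSum h₃).trans h₂

theorem opTrace_add {S T : E →L[ℂ] E} (hS : IsTraceClass S) (hT : IsTraceClass T) :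
    opTrace (S + T) = opTrace S + opTrace T := by
  obtain ⟨κ, e, he⟩ := exists_opTrace_basis E
  simp only [he, add_apply, inner_add_right]
  exact (hS.summable_inner e).tsum_add (hT.summable_inner e)

theorem opTrace_smul (t : ℂ) (T : E →L[ℂ] E) : opTrace (t • T) = t * opTrace T := by
  obtain ⟨κ, e, he⟩ := exists_opTrace_basis E
  simp only [he, smul_apply, inner_smul_right, tsum_mul_left]

theorem opTrace_neg (T : E →L[ℂ] E) : opTrace (-T) = -opTrace T := by
  simpa using opTrace_smul (-1) T

theorem opTrace_rankOne (x y : E) : opTrace (InnerProductSpace.rankOne ℂ x y) = inner ℂ y x := by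
  obtain ⟨κ, e, he⟩ := exists_opTrace_basis E
  rw [he]
  simp only [InnerProductSpace.rankOne_apply, inner_smul_right]
  exact (e.hasSum_inner_mul_inner y x).tsum_eq

theorem isTraceClass_rankOne (x y : E) : IsTraceClass (InnerProductSpace.rankOne ℂ x y) := by
  have hr : HasRankLE (InnerProductSpace.rankOne ℂ x y : E →L[ℂ] E) 1 :=
    ⟨Submodule.span ℂ {x}, inferInstance, by
      simpa using finrank_span_le_card (R := ℂ) ({x} : Set E), fun z =>
      Submodule.smul_mem _ _ (Submodule.mem_span_singleton_self x)⟩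
  -- Rank one is exact from `n = 1` on, so only the bound at `n = 0` is nonzero.
  refine ⟨fun n => if n = 0 then ‖InnerProductSpace.rankOne ℂ x y‖ else 0,
    summable_of_ne_finset_zero (s := {0}) (by simp +contextual), fun n => ?_⟩
  rcases Nat.eq_zero_or_pos n with rfl | hn
  · exact ⟨0, HasRankLE.zero _, by simp⟩
  · exact ⟨_, hr.mono hn, by simp [hn.ne']⟩

theorem IsTraceClass.zero : IsTraceClass (0 : E →L[ℂ] F) :=
  ⟨0, summable_zero, fun n => ⟨0, HasRankLE.zero n, by simp⟩⟩

theorem opTrace_sum {ι : Type*} (s : Finset ι) (T : ι → E →L[ℂ] E)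
    (h : ∀ i ∈ s, IsTraceClass (T i)) :
    IsTraceClass (∑ i ∈ s, T i) ∧ opTrace (∑ i ∈ s, T i) = ∑ i ∈ s, opTrace (T i) := by
  classical
  induction s using Finset.induction_on with
  | empty => exact ⟨IsTraceClass.zero, by simpa using opTrace_smul 0 (0 : E →L[ℂ] E)⟩
  | insert i s hi ih =>
    obtain ⟨h₁, h₂⟩ := ih fun j hj => h j (Finset.mem_insert_of_mem hj)
    have h₃ := h i (Finset.mem_insert_self i s)
    rw [Finset.sum_insert hi, Finset.sum_insert hi, opTrace_add h₃ h₁, h₂]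
    exact ⟨h₃.add h₁, rfl⟩

/-- The trace is cyclic when one of the factors is cut off by a projection of finite rank. -/
theorem opTrace_comp_starProjection_comm (A : E →L[ℂ] F) (B : F →L[ℂ] E) (K : Submodule ℂ E)
    [FiniteDimensional ℂ K] :
    (IsTraceClass ((A ∘L K.starProjection) ∘L B) ∧ IsTraceClass (B ∘L (A ∘L K.starProjection))) ∧
      opTrace ((A ∘L K.starProjection) ∘L B) = opTrace (B ∘L (A ∘L K.starProjection)) := by
  have b := stdOrthonormalBasis ℂ K
  have hP : K.starProjection = ∑ i, InnerProductSpace.rankOne ℂ (b i : E) (b i : E) :=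
    b.starProjection_eq_sum_rankOne
  have h₁ : (A ∘L K.starProjection) ∘L B =
      ∑ i, InnerProductSpace.rankOne ℂ (A (b i)) (adjoint B (b i)) := by
    ext x; simp [hP, adjoint_inner_left]
  have h₂ : B ∘L (A ∘L K.starProjection) =
      ∑ i, InnerProductSpace.rankOne ℂ (B (A (b i))) (b i : E) := by
    ext x; simp [hP]
  obtain ⟨h₃, h₄⟩ := opTrace_sum Finset.univ
    (fun i => InnerProductSpace.rankOne ℂ (A (b i)) (adjoint B (b i)))
    fun i _ => isTraceClass_rankOne _ _
  obtain ⟨h₅, h₆⟩ := opTrace_sum Finset.univ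
    (fun i => InnerProductSpace.rankOne ℂ (B (A (b i))) (b i : E))
    fun i _ => isTraceClass_rankOne _ _
  rw [h₁, h₂, h₄, h₆]
  refine ⟨⟨h₃, h₅⟩, Finset.sum_congr rfl fun i _ => ?_⟩
  rw [opTrace_rankOne, opTrace_rankOne, adjoint_inner_left]

/-- Take `K = (ker R)ᗮ` for a good approximant `R`: `R` is injective on `K`, so `K` is
finite-dimensional, and `A - A P_K = (A - R) P_{Kᗮ}` because `R` vanishes on `Kᗮ`. -/
theorem exists_starProjection_norm_le {A : E →L[ℂ] F} {c : ℕ → ℝ} (h : ApproxBy A c) (n : ℕ) :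
    ∃ (K : Submodule ℂ E) (_ : FiniteDimensional ℂ K), ‖A - A ∘L K.starProjection‖ ≤ c n := by
  obtain ⟨R, ⟨W, w₁, w₂, w₃⟩, hR⟩ := h n
  set K : Submodule ℂ E := (LinearMap.ker (R : E →ₗ[ℂ] F))ᗮ with hK
  have hRK : ∀ x ∈ Kᗮ, R x = 0 := fun x hx => by
    rw [hK, Submodule.orthogonal_orthogonal_eq_closure,
      IsClosed.submodule_topologicalClosure_eq R.isClosed_ker] at hx
    exact hx
  have hfin : FiniteDimensional ℂ K := by
    refine FiniteDimensional.of_injective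
      (((R : E →ₗ[ℂ] F).codRestrict W w₃).comp K.subtype) ?_
    rw [← LinearMap.ker_eq_bot, Submodule.eq_bot_iff]
    intro x hx
    have h₁ : (x : E) ∈ LinearMap.ker (R : E →ₗ[ℂ] F) := congrArg Subtype.val hx
    have h₂ : inner ℂ (x : E) (x : E) = 0 := (Submodule.mem_orthogonal _ _).1 x.2 _ h₁
    exact Subtype.ext (inner_self_eq_zero.1 h₂)
  refine ⟨K, hfin, le_trans ?_ hR⟩
  have e : A - A ∘L K.starProjection = (A - R) ∘L Kᗮ.starProjection := by
    ext x
    have h₁ : Kᗮ.starProjection x = x - K.starProjection x := by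
      rw [Submodule.starProjection_orthogonal]; simp
    have h₂ : R (Kᗮ.starProjection x) = 0 := hRK _ (Submodule.starProjection_apply_mem _ _)
    have h₃ : (A - R) (Kᗮ.starProjection x) = A (Kᗮ.starProjection x) - 0 := by rw [← h₂]; rfl
    rw [ContinuousLinearMap.comp_apply, h₃, h₁]
    simp
  rw [e]
  refine (opNorm_comp_le _ _).trans ?_
  exact mul_le_of_le_one_right (norm_nonneg _) (Submodule.starProjection_norm_le _)

/-- The trace is cyclic on products of operators of complementary summability exponents. -/
theorem opTrace_comp_comm_of_pos {q i j : ℕ} (hq : q ≠ 0) (hi : i ≠ 0) (hij : q ≤ i + j)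
    {A : E →L[ℂ] F} {B : F →L[ℂ] E} (hA : IsIdeal q i A) (hB : IsIdeal q j B) :
    opTrace (A ∘L B) = opTrace (B ∘L A) := by
  have hAB := (hA.comp hB rfl).isTraceClass hq hij
  have hBA := (hB.comp hA (add_comm j i)).isTraceClass hq hij
  obtain ⟨C, c, h₁, h₂, h₃, h₄⟩ := hA
  obtain ⟨D, d, k₁, k₂, k₃, k₄⟩ := hB
  set m : ℕ → ℝ := fun n => max (c n) (d n) with hm
  have hm₀ : ∀ n, 0 ≤ m n := fun n => le_max_of_le_left (h₂ n)
  have hmq : Summable fun n => m n ^ q := by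
    refine Summable.of_nonneg_of_le (fun n => pow_nonneg (hm₀ n) q) (fun n => ?_) (h₃.add k₃)
    rcases le_total (c n) (d n) with h | h
    · simp only [hm, max_eq_right h]
      exact le_add_of_nonneg_left (pow_nonneg (h₂ _) _)
    · simp only [hm, max_eq_left h]
      exact le_add_of_nonneg_right (pow_nonneg (k₂ _) _)
  have hbound := summable_mul_pow_of_le hm₀ hmq hq hij (C * D)
  have hdom : ∀ n, (C * c n ^ i) * (D * d n ^ j) ≤ C * D * m n ^ (i + j) := fun n => by
    rw [pow_add, mul_mul_mul_comm]
    have := h₂ n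
    have := k₂ n
    gcongr
    · exact le_max_left _ _
    · exact le_max_right _ _
  -- This is where `i ≠ 0` is used: the cut-off errors of `A` must tend to zero.
  have hlim : Filter.Tendsto (fun N => C * c N ^ i) Filter.atTop (nhds 0) := by
    have h := h₃.tendsto_atTop_zero
    have hc : Filter.Tendsto c Filter.atTop (nhds 0) := by
      have h' := h.rpow_const (p := (q : ℝ)⁻¹) (Or.inr (by positivity))
      rw [Real.zero_rpow (by simpa using hq)] at h'
      refine h'.congr fun n => ?_
      exact Real.pow_rpow_inv_natCast (h₂ n) hq
    simpa [hi] using (hc.pow i).const_mul C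
  choose K hK hKn using fun N => exists_starProjection_norm_le h₄ N
  set g : ℕ → ℕ → ℝ := fun N n => min (C * c n ^ i) (C * c N ^ i) * (D * d n ^ j) with hg
  have hg₀ : ∀ N n, 0 ≤ g N n := fun N n =>
    mul_nonneg (le_min (h₄.nonneg n) (h₄.nonneg N)) (k₄.nonneg n)
  have hgle : ∀ N n, g N n ≤ C * D * m n ^ (i + j) := fun N n =>
    (mul_le_mul_of_nonneg_right (min_le_left _ _) (k₄.nonneg n)).trans (hdom n)
  have hgs : ∀ N, Summable (g N) := fun N => Summable.of_nonneg_of_le (hg₀ N) (hgle N) hbound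
  -- Dominated convergence: `g N n` is at most `C * D * m n ^ (i + j)`, summable since `q ≤ i + j`,
  -- and for fixed `n` it tends to zero with the cut-off error.
  have htend : Filter.Tendsto (fun N => ∑' n, g N n) Filter.atTop (nhds 0) := by
    have h := tendsto_tsum_of_dominated_convergence (𝓕 := Filter.atTop) (f := g)
      (g := fun _ => (0 : ℝ)) hbound (fun n => ?_) (Filter.Eventually.of_forall fun N n => ?_)
    · simpa using h
    · have h := ((tendsto_const_nhds (x := C * c n ^ i)).min hlim).mul_const (D * d n ^ j)
      rwa [min_eq_right (h₄.nonneg n), zero_mul] at h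
    · rw [Real.norm_of_nonneg (hg₀ N n)]
      exact hgle N n
  have hrest : ∀ N, ApproxBy (A - A ∘L (K N).starProjection)
      fun n => min (C * c n ^ i) (C * c N ^ i) := fun N => by
    refine ApproxBy.min ?_ ((approxBy_norm _).mono fun n => hKn N)
    have e : A - A ∘L (K N).starProjection = A ∘L (K N)ᗮ.starProjection := by
      rw [Submodule.starProjection_orthogonal]; ext x; simp
    rw [e]
    exact h₄.comp_right (Submodule.starProjection_norm_le _)
  -- The finite-rank parts have equal traces, and each remainder is bounded by the doubled sum
  -- coming from the halved index.
  have hkey : ∀ N, ‖opTrace (A ∘L B) - opTrace (B ∘L A)‖ ≤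
      2 * ∑' n, g N n + 2 * ∑' n, g N n := fun N => by
    obtain ⟨⟨t₁, t₂⟩, t₃⟩ := opTrace_comp_starProjection_comm A B (K N)
    have a₁ := (hrest N).comp k₄
    have a₂ := (k₄.comp (hrest N)).mono fun n => (mul_comm _ _).le
    have s₁ := hasSum_comp_half (hgs N)
    have n₁ := norm_opTrace_le s₁.summable a₁
    have n₂ := norm_opTrace_le s₁.summable a₂
    rw [s₁.tsum_eq] at n₁ n₂
    have e₁ : A ∘L B = (A ∘L (K N).starProjection) ∘L B +
        (A - A ∘L (K N).starProjection) ∘L B := by ext x; simp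
    have e₂ : B ∘L A = B ∘L (A ∘L (K N).starProjection) +
        B ∘L (A - A ∘L (K N).starProjection) := by ext x; simp
    rw [e₁, e₂, opTrace_add t₁ ⟨_, s₁.summable, a₁⟩, opTrace_add t₂ ⟨_, s₁.summable, a₂⟩, t₃,
      add_sub_add_left_eq_sub]
    exact (norm_sub_le _ _).trans (add_le_add n₁ n₂)
  have h0 : ‖opTrace (A ∘L B) - opTrace (B ∘L A)‖ ≤ 0 := by
    have := (htend.const_mul 2).add (htend.const_mul 2)
    rw [mul_zero, add_zero] at this
    exact ge_of_tendsto' this hkey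
  exact sub_eq_zero.1 (norm_le_zero_iff.1 h0)

theorem opTrace_comp_comm {E F : Type w} [NormedAddCommGroup E] [InnerProductSpace ℂ E]
    [CompleteSpace E] [NormedAddCommGroup F] [InnerProductSpace ℂ F] [CompleteSpace F]
    {q i j : ℕ} (hq : q ≠ 0) (hij : q ≤ i + j)
    {A : E →L[ℂ] F} {B : F →L[ℂ] E} (hA : IsIdeal q i A) (hB : IsIdeal q j B) :
    opTrace (A ∘L B) = opTrace (B ∘L A) := by
  rcases eq_or_ne i 0 with rfl | hi
  · exact (opTrace_comp_comm_of_pos hq (by omega) (by omega) hB hA).symm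
  · exact opTrace_comp_comm_of_pos hq hi hij hA hB

end Trace

/-! ## Words in the image of a semifunctor -/

namespace Chain

variable {C : Type u} [Category.{v} C]

@[simp]
theorem contract_cons_cons_zero {n : ℕ} {X Y Z W : C} (f : Z ⟶ X) (g : W ⟶ Z) (c : Chain n W Y) :
    (Chain.cons f (.cons g c)).contract 0 = .cons (g ≫ f) c := rfl

@[simp]
theorem contract_cons_cons_succ {n : ℕ} {X Y Z W : C} (f : Z ⟶ X) (g : W ⟶ Z) (c : Chain n W Y)
    (i : Fin (n + 1)) : (Chain.cons f (.cons g c)).contract i.succ =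
      .cons f ((Chain.cons g c).contract i) := rfl

/-- `(f⁰, …, fⁿ⁺¹) ↦ (f⁰, …, fⁿ)`. -/
abbrev init {n : ℕ} {X Y : C} (c : Chain (n + 1) X Y) : Chain n X c.splitLast.1 := c.splitLast.2.1

/-- `(f⁰, …, fⁿ⁺¹) ↦ fⁿ⁺¹`. -/
abbrev last {n : ℕ} {X Y : C} (c : Chain (n + 1) X Y) : Y ⟶ c.splitLast.1 := c.splitLast.2.2

end Chain

namespace LinearSemifunctor

variable {C : Type u} [Category.{v} C] [Preadditive C] [Linear ℂ C]
variable {S : DGSemicategory.{a, b}} (ρ : LinearSemifunctor C S)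

/-- `∂(ρ f)`. -/
abbrev dmap {X Y : C} (f : X ⟶ Y) : S.Hom (ρ.obj X) (ρ.obj Y) 1 := S.d (zero_add 1) (ρ.map f)

theorem word_cons {n : ℕ} {X Y Z : C} (f : Z ⟶ X) (c : Chain n Z Y) :
    ρ.word (.cons f c) = S.comp (zero_add _) (ρ.map f) (ρ.dWord c) := rfl

theorem dWord_cons {n : ℕ} {X Y Z : C} (f : Z ⟶ X) (c : Chain n Z Y) :
    ρ.dWord (.cons f c) = S.comp (Nat.add_comm 1 _) (ρ.dmap f) (ρ.dWord c) := rfl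

theorem dWord_splitLast : ∀ {n : ℕ} {X Y : C} (c : Chain (n + 1) X Y),
    ρ.dWord c = S.comp rfl (ρ.dWord c.init) (ρ.dmap c.last)
  | 0, _, _, .cons f (.single g) => rfl
  | n + 1, _, _, .cons f (.cons g c) => by
    rw [dWord_cons, dWord_splitLast (.cons g c)]
    exact (S.assoc _ _ _ _ _ _ _).symm

theorem word_splitLast : ∀ {n : ℕ} {X Y : C} (c : Chain (n + 1) X Y),
    ρ.word c = S.comp rfl (ρ.word c.init) (ρ.dmap c.last)
  | 0, _, _, .cons f (.single g) => rfl
  | n + 1, _, _, .cons f (.cons g c) => by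
    rw [word_cons, dWord_splitLast ρ (.cons g c)]
    exact (S.assoc _ _ _ _ _ _ _).symm

theorem d_dWord : ∀ {n k : ℕ} {X Y : C} (c : Chain n X Y) (h : n + 1 + 1 = k),
    S.d h (ρ.dWord c) = 0
  | 0, _, _, _, .single f, h => S.d_d _ _ _
  | n + 1, _, _, _, .cons f c, h => by
    rw [dWord_cons, S.leibniz _ h (rfl : 1 + 1 = 2) rfl (by omega) (by omega), S.d_d,
      d_dWord c rfl]
    simp

theorem d_word : ∀ {n : ℕ} {X Y : C} (c : Chain n X Y), S.d rfl (ρ.word c) = ρ.dWord c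
  | 0, _, _, .single f => rfl
  | n + 1, _, _, .cons f c => by
    rw [word_cons, S.leibniz _ rfl (zero_add 1) rfl (Nat.add_comm 1 _) (by omega),
      d_dWord ρ c rfl, dWord_cons]
    simp

theorem d_map_comp {X Y Z : C} (f : X ⟶ Y) (g : Y ⟶ Z) :
    ρ.dmap (f ≫ g) = S.comp (add_zero 1) (ρ.dmap g) (ρ.map f) +
      S.comp (zero_add 1) (ρ.map g) (ρ.dmap f) := by
  rw [dmap, ρ.map_comp, S.leibniz _ _ (zero_add 1) (zero_add 1) (add_zero 1) (zero_add 1)]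
  simp

/-- By Leibniz each `d(fⁱ fⁱ⁺¹)` splits into two terms, and neighbouring terms cancel with the
alternating signs. Only the two ends remain. -/
theorem sum_dWord_contract : ∀ {n : ℕ} {X Y : C} (c : Chain (n + 1) X Y),
    ∑ i : Fin (n + 1), (-1 : ℂ) ^ (i : ℕ) • ρ.dWord (c.contract i) =
      ρ.word c + (-1 : ℂ) ^ n • S.comp (add_zero _) (ρ.dWord c.init) (ρ.map c.last)
  | 0, _, _, .cons f (.single g) => by
    simp only [Nat.reduceAdd, Finset.univ_unique, Fin.default_eq_zero, Finset.sum_singleton,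
      Fin.val_zero, pow_zero, one_smul]
    exact (ρ.d_map_comp g f).trans (add_comm _ _)
  | n + 1, _, _, .cons f (.cons g c) => by
    have ih := sum_dWord_contract (.cons g c)
    have h₁ : S.comp (Nat.add_comm 1 _) (ρ.dmap f) (ρ.word (.cons g c)) =
        S.comp (Nat.add_comm 1 _) (S.comp (add_zero 1) (ρ.dmap f) (ρ.map g)) (ρ.dWord c) :=
      (S.assoc _ _ _ _ _ _ _).symm
    have h₂ : S.comp (zero_add _) (ρ.map f) (ρ.dWord (.cons g c)) =
        S.comp (Nat.add_comm 1 _) (S.comp (zero_add 1) (ρ.map f) (ρ.dmap g)) (ρ.dWord c) :=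
      (S.assoc _ _ _ _ _ _ _).symm
    have h₃ : S.comp (add_zero _) (ρ.dWord (Chain.cons f (.cons g c)).init)
          (ρ.map (Chain.cons f (.cons g c)).last) =
        S.comp (Nat.add_comm 1 _) (ρ.dmap f) (S.comp (add_zero _) (ρ.dWord (Chain.cons g c).init)
          (ρ.map (Chain.cons g c).last)) := S.assoc _ _ _ _ _ _ _
    have h₄ : ∑ i : Fin (n + 1), (-1 : ℂ) ^ ((i.succ : Fin (n + 2)) : ℕ) •
        ρ.dWord (.cons f ((Chain.cons g c).contract i)) =
        -S.comp (Nat.add_comm 1 _) (ρ.dmap f)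
          (∑ i : Fin (n + 1), (-1 : ℂ) ^ (i : ℕ) • ρ.dWord ((Chain.cons g c).contract i)) := by
      rw [map_sum, ← Finset.sum_neg_distrib]
      refine Finset.sum_congr rfl fun i _ => ?_
      rw [dWord_cons, map_smul, Fin.val_succ, pow_succ]
      simp
    rw [Fin.sum_univ_succ]
    simp only [Chain.contract_cons_cons_zero, Chain.contract_cons_cons_succ]
    rw [h₄, ih, h₃, word_cons ρ f, h₂, dWord_cons ρ (g ≫ f), d_map_comp, pow_succ]
    simp only [map_add, LinearMap.add_apply, map_smul, Fin.val_zero, pow_zero, one_smul, h₁]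
    module

theorem sum_word_contract : ∀ {n : ℕ} {X Y : C} (c : Chain (n + 1) X Y),
    ∑ i : Fin (n + 1), (-1 : ℂ) ^ (i : ℕ) • ρ.word (c.contract i) =
      (-1 : ℂ) ^ n • S.comp (add_zero _) (ρ.word c.init) (ρ.map c.last)
  | 0, _, _, .cons f (.single g) => by
    simp only [Nat.reduceAdd, Finset.univ_unique, Fin.default_eq_zero, Finset.sum_singleton,
      Fin.val_zero, pow_zero, one_smul]
    exact ρ.map_comp g f
  | n + 1, _, _, .cons f (.cons g c) => by
    have ih := sum_dWord_contract ρ (.cons g c)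
    have h₂ : ρ.word (.cons (g ≫ f) c) = S.comp (zero_add _) (ρ.map f) (ρ.word (.cons g c)) := by
      rw [word_cons, ρ.map_comp]
      exact S.assoc _ _ _ _ _ _ _
    have h₃ : S.comp (add_zero _) (ρ.word (Chain.cons f (.cons g c)).init)
          (ρ.map (Chain.cons f (.cons g c)).last) =
        S.comp (zero_add _) (ρ.map f) (S.comp (add_zero _) (ρ.dWord (Chain.cons g c).init)
          (ρ.map (Chain.cons g c).last)) := S.assoc _ _ _ _ _ _ _
    have h₄ : ∑ i : Fin (n + 1), (-1 : ℂ) ^ ((i.succ : Fin (n + 2)) : ℕ) •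
        ρ.word (.cons f ((Chain.cons g c).contract i)) =
        -S.comp (zero_add _) (ρ.map f)
          (∑ i : Fin (n + 1), (-1 : ℂ) ^ (i : ℕ) • ρ.dWord ((Chain.cons g c).contract i)) := by
      rw [map_sum, ← Finset.sum_neg_distrib]
      refine Finset.sum_congr rfl fun i _ => ?_
      rw [word_cons, map_smul, Fin.val_succ, pow_succ]
      simp
    rw [Fin.sum_univ_succ]
    simp only [Chain.contract_cons_cons_zero, Chain.contract_cons_cons_succ]
    rw [h₄, ih, h₃, h₂, pow_succ]
    simp only [map_add, map_smul, Fin.val_zero, pow_zero, one_smul]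
    module

theorem word_contract_zero : ∀ {n : ℕ} {X Y Z : C} (f : Z ⟶ X) (c : Chain n Z Y),
    ρ.word ((Chain.cons f c).contract 0) = S.comp (zero_add _) (ρ.map f) (ρ.word c)
  | 0, _, _, _, f, .single g => ρ.map_comp g f
  | n + 1, _, _, _, f, .cons g c => by
    rw [Chain.contract_cons_cons_zero, word_cons, ρ.map_comp]
    exact S.assoc _ _ _ _ _ _ _

theorem isMultilinear_dWord : ∀ {n : ℕ} {X Y : C}
    (L : S.Hom (ρ.obj Y) (ρ.obj X) (n + 1) →ₗ[ℂ] ℂ),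
    IsMultilinear fun c : Chain n X Y => L (ρ.dWord c)
  | 0, _, _, L => (L ∘ₗ S.d rfl ∘ₗ ρ.map).isLinear
  | _ + 1, _, _, L =>
    ⟨fun _ c => (L ∘ₗ (S.comp (Nat.add_comm 1 _)).flip (ρ.dWord c) ∘ₗ S.d (zero_add 1) ∘ₗ
        ρ.map).isLinear,
      fun _ f => isMultilinear_dWord (L ∘ₗ S.comp (Nat.add_comm 1 _) (ρ.dmap f))⟩

theorem isMultilinear_word : ∀ {n : ℕ} {X Y : C}
    (L : S.Hom (ρ.obj Y) (ρ.obj X) n →ₗ[ℂ] ℂ), IsMultilinear fun c : Chain n X Y => L (ρ.word c)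
  | 0, _, _, L => (L ∘ₗ ρ.map).isLinear
  | _ + 1, _, _, L =>
    ⟨fun _ c => (L ∘ₗ (S.comp (zero_add _)).flip (ρ.dWord c) ∘ₗ ρ.map).isLinear,
      fun _ f => ρ.isMultilinear_dWord (L ∘ₗ S.comp (zero_add _) (ρ.map f))⟩

end LinearSemifunctor

/-! ### Characters of cycles are cyclic cocycles -/

section Character

variable {C : Type u} [Category.{v} C] [Preadditive C] [Linear ℂ C]

theorem hochschild_apply {n : ℕ} (φ : NerveFun C n) (X : C) (c : Chain (n + 1) X X) :
    hochschild n φ X c = ∑ i : Fin (n + 1), (-1 : ℂ) ^ (i : ℕ) * φ X (c.contract i) +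
      (-1 : ℂ) ^ (n + 1) * φ _ ((Chain.cons c.last c.init).contract 0) := by
  simp only [hochschild, LinearMap.add_apply, LinearMap.smul_apply, LinearMap.sum_apply,
    Pi.add_apply, Pi.smul_apply, Finset.sum_apply, smul_eq_mul]
  rfl

theorem ClosedGradedTrace.toFun_comp_zero {S : DGSemicategory.{a, b}} {n : ℕ}
    (T : ClosedGradedTrace S n) {X Y : S.Obj} (g : S.Hom Y X 0) (x : S.Hom X Y n) :
    T.toFun X (S.comp (zero_add n) g x) = T.toFun Y (S.comp (add_zero n) x g) := by
  rw [T.graded _ (add_zero n)]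
  simp

theorem mem_cyclicCochains_iff {n : ℕ} (φ : NerveFun C n) :
    φ ∈ cyclicCochains C n ↔ φ ∈ cochains C n ∧ signedCyclic n φ = φ := by
  rw [cyclicCochains, Submodule.mem_inf, LinearMap.mem_ker, LinearMap.sub_apply,
    LinearMap.id_apply, sub_eq_zero, eq_comm (a := φ)]

/-- Closedness of the trace gives cyclic symmetry. The inner faces telescope to one boundary term,
which cancels the last face by the trace property. -/
theorem Cycle.character_mem_cyclicCocycles {n : ℕ} (A : Cycle.{u, v, a, b} C n) :
    A.character ∈ cyclicCocycles C n := by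
  refine Submodule.mem_inf.2 ⟨(mem_cyclicCochains_iff _).2
    ⟨fun X => A.ρ.isMultilinear_word (A.T.toFun _), ?_⟩, LinearMap.mem_ker.2 ?_⟩
  · funext X c
    obtain - | n := n
    · simp [signedCyclic, Chain.rotate]
    · have h₁ := A.T.closed _ rfl
        (A.S.comp (add_zero _) (A.ρ.word c.init) (A.ρ.map c.last))
      rw [A.S.leibniz _ _ rfl (zero_add 1) (add_zero _) rfl, A.ρ.d_word, map_add, map_smul,
        ← A.T.toFun_comp_zero, ← A.ρ.word_splitLast, smul_eq_mul] at h₁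
      change (-1) ^ (n + 1) * A.T.toFun _ (A.ρ.word (.cons c.last c.init)) = A.T.toFun _ (A.ρ.word c)
      rw [A.ρ.word_cons, eq_neg_of_add_eq_zero_left h₁, pow_succ]
      have : (-1 : ℂ) ^ n * (-1) ^ n = 1 := by rw [← mul_pow]; simp
      linear_combination (A.T.toFun _ (A.ρ.word c)) * this
  · funext X c
    rw [hochschild_apply]
    have h₁ := congrArg (A.T.toFun _) (A.ρ.sum_word_contract c)
    simp only [map_sum, map_smul, smul_eq_mul] at h₁
    change ∑ i : Fin (n + 1), (-1 : ℂ) ^ (i : ℕ) * A.T.toFun _ (A.ρ.word (c.contract i)) +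
      (-1 : ℂ) ^ (n + 1) * A.T.toFun _ (A.ρ.word ((Chain.cons c.last c.init).contract 0)) = 0
    rw [h₁, A.ρ.word_contract_zero, A.T.toFun_comp_zero]
    ring

end Character

/-! ## Alternating words and transgression -/

theorem DGSemicategory.sub_comp (S : DGSemicategory.{a, b}) {X Y Z : S.Obj} {j i n : ℕ}
    (h : j + i = n) (x y : S.Hom Y Z j) (z : S.Hom X Y i) :
    S.comp h (x - y) z = S.comp h x z - S.comp h y z := by
  rw [map_sub, LinearMap.sub_apply]

namespace LinearSemifunctor

variable {C : Type u} [Category.{v} C] [Preadditive C] [Linear ℂ C]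
variable {S : DGSemicategory.{a, b}} (ρ : LinearSemifunctor C S)

/-- `∑ⱼ (-1)ʲ ∂(ρ f⁰) ⋯ ∂(ρ fʲ⁻¹) (ρ fʲ) ∂(ρ fʲ⁺¹) ⋯ ∂(ρ fⁿ)`. -/
def altWord : {n : ℕ} → {X Y : C} → Chain n X Y → S.Hom (ρ.obj Y) (ρ.obj X) n
  | 0, _, _, .single f => ρ.map f
  | _ + 1, _, _, .cons f c =>
      ρ.word (.cons f c) - S.comp (Nat.add_comm 1 _) (ρ.dmap f) (altWord c)

/-- `∑ᵢ ∂(ρ f⁰) ⋯ ∂(ρ fⁱ⁻¹) (ρ fⁱ) (ρ fⁱ⁺¹) ∂(ρ fⁱ⁺²) ⋯ ∂(ρ fⁿ⁺¹)`. -/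
def pairWord : {n : ℕ} → {X Y : C} → Chain (n + 1) X Y → S.Hom (ρ.obj Y) (ρ.obj X) n
  | 0, _, _, .cons f (.single g) => S.comp (zero_add 0) (ρ.map f) (ρ.map g)
  | _ + 1, _, _, .cons f (.cons g c) =>
      S.comp (zero_add _) (ρ.map f) (ρ.word (.cons g c)) +
        S.comp (Nat.add_comm 1 _) (ρ.dmap f) (pairWord (.cons g c))

theorem altWord_cons {n : ℕ} {X Y Z : C} (f : Z ⟶ X) (c : Chain n Z Y) :
    ρ.altWord (.cons f c) =
      ρ.word (.cons f c) - S.comp (Nat.add_comm 1 _) (ρ.dmap f) (ρ.altWord c) := rfl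

theorem pairWord_cons : ∀ {n : ℕ} {X Y Z : C} (f : Z ⟶ X) (c : Chain (n + 1) Z Y),
    ρ.pairWord (.cons f c) = S.comp (zero_add _) (ρ.map f) (ρ.word c) +
        S.comp (Nat.add_comm 1 _) (ρ.dmap f) (ρ.pairWord c)
  | _, _, _, _, _, .cons _ _ => rfl

theorem comp_dWord_init_cons {n : ℕ} {X Y Z W : C} (f : Z ⟶ X) (g : W ⟶ Z) (c : Chain n W Y) :
    S.comp (add_zero _) (ρ.dWord (Chain.cons f (.cons g c)).init)
        (ρ.map (Chain.cons f (.cons g c)).last) =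
      S.comp (Nat.add_comm 1 _) (ρ.dmap f) (S.comp (add_zero _) (ρ.dWord (Chain.cons g c).init)
        (ρ.map (Chain.cons g c).last)) := S.assoc _ _ _ _ _ _ _

theorem comp_word_init_cons {n : ℕ} {X Y Z W : C} (f : Z ⟶ X) (g : W ⟶ Z) (c : Chain n W Y) :
    S.comp (add_zero _) (ρ.word (Chain.cons f (.cons g c)).init)
        (ρ.map (Chain.cons f (.cons g c)).last) =
      S.comp (zero_add _) (ρ.map f) (S.comp (add_zero _) (ρ.dWord (Chain.cons g c).init)
        (ρ.map (Chain.cons g c).last)) := S.assoc _ _ _ _ _ _ _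

theorem altWord_splitLast : ∀ {n : ℕ} {X Y : C} (c : Chain (n + 1) X Y),
    ρ.altWord c = S.comp rfl (ρ.altWord c.init) (ρ.dmap c.last) +
      (-1 : ℂ) ^ (n + 1) • S.comp (add_zero _) (ρ.dWord c.init) (ρ.map c.last)
  | 0, _, _, .cons f (.single g) => by
    simp only [zero_add, pow_one, neg_smul, one_smul, ← sub_eq_add_neg]
    rfl
  | n + 1, _, _, .cons f (.cons g c) => by
    have h₁ : S.comp rfl (ρ.altWord (Chain.cons f (.cons g c)).init)
          (ρ.dmap (Chain.cons f (.cons g c)).last) =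
        S.comp rfl (ρ.word (Chain.cons f (.cons g c)).init)
          (ρ.dmap (Chain.cons f (.cons g c)).last) -
        S.comp (Nat.add_comm 1 _) (ρ.dmap f) (S.comp rfl (ρ.altWord (Chain.cons g c).init)
          (ρ.dmap (Chain.cons g c).last)) := by
      exact (S.sub_comp _ _ _ _).trans (congrArg _ (S.assoc _ _ _ _ _ _ _))
    rw [altWord_cons, altWord_splitLast (.cons g c), h₁, ← ρ.word_splitLast,
      ρ.comp_dWord_init_cons, map_add, map_smul, pow_succ _ (n + 1)]
    module

/-- `∑ⱼ (-1)ʲ ∂(ρ f⁰) ⋯ (ρ fʲ) ⋯ ∂(ρ fⁿ)` is cohomologous to `(n + 1) (ρ f⁰) ∂(ρ f¹) ⋯ ∂(ρ fⁿ)`. -/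
theorem apply_altWord : ∀ {n : ℕ} {X Y : C} (c : Chain n X Y)
    (L : S.Hom (ρ.obj Y) (ρ.obj X) n →ₗ[ℂ] ℂ)
    (_ : ∀ {k : ℕ} (h : k + 1 = n) (x : S.Hom (ρ.obj Y) (ρ.obj X) k), L (S.d h x) = 0),
    L (ρ.altWord c) = ((n : ℂ) + 1) * L (ρ.word c)
  | 0, _, _, .single f, L, _ => by simp [altWord, word]
  | n + 1, _, _, .cons f c, L, hL => by
    have h₁ : ∀ {k : ℕ} (h : k + 1 = n) (x : S.Hom _ _ k),
        (L ∘ₗ S.comp (Nat.add_comm 1 _) (ρ.dmap f)) (S.d h x) = 0 := fun {k} h x => by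
      have h₂ := S.leibniz (Nat.add_comm 1 k) (by omega : k + 1 + 1 = n + 1) rfl h (by omega)
        (Nat.add_comm 1 n) (ρ.dmap f) x
      rw [S.d_d, map_zero, LinearMap.zero_apply, zero_add, pow_one, neg_one_smul] at h₂
      have h₃ := hL (by omega : k + 1 + 1 = n + 1) (S.comp (Nat.add_comm 1 k) (ρ.dmap f) x)
      rw [h₂, map_neg, neg_eq_zero] at h₃
      exact h₃
    have h₄ := hL rfl (S.comp (zero_add n) (ρ.map f) (ρ.word c))
    rw [S.leibniz _ rfl (zero_add 1) rfl (Nat.add_comm 1 n) (zero_add _), d_word, pow_zero,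
      one_smul, ← word_cons, map_add] at h₄
    rw [altWord_cons, map_sub]
    have ih := apply_altWord c (L ∘ₗ S.comp (Nat.add_comm 1 _) (ρ.dmap f)) h₁
    simp only [LinearMap.comp_apply] at ih
    rw [ih, eq_neg_of_add_eq_zero_left h₄]
    push_cast
    ring

theorem altWord_cons_comp {n : ℕ} {X Y Z W : C} (f : Z ⟶ X) (g : W ⟶ Z) (c : Chain n W Y) :
    ρ.altWord (.cons (g ≫ f) c) = S.comp (zero_add _) (ρ.map f) (ρ.altWord (.cons g c)) -
      S.comp (Nat.add_comm 1 _) (ρ.dmap f) (S.comp (zero_add _) (ρ.map g) (ρ.altWord c)) := by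
  have h₁ : S.comp (zero_add _) (ρ.map f) (ρ.word (.cons g c)) = ρ.word (.cons (g ≫ f) c) := by
    rw [word_cons, word_cons, ρ.map_comp]
    exact (S.assoc _ _ _ _ _ _ _).symm
  have h₂ : S.comp (Nat.add_comm 1 _) (ρ.dmap f) (S.comp (zero_add _) (ρ.map g) (ρ.altWord c)) =
      S.comp (Nat.add_comm 1 _) (S.comp (add_zero 1) (ρ.dmap f) (ρ.map g)) (ρ.altWord c) :=
    (S.assoc _ _ _ _ _ _ _).symm
  have h₃ : S.comp (zero_add _) (ρ.map f)
      (S.comp (Nat.add_comm 1 _) (ρ.dmap g) (ρ.altWord c)) =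
      S.comp (Nat.add_comm 1 _) (S.comp (zero_add 1) (ρ.map f) (ρ.dmap g)) (ρ.altWord c) :=
    (S.assoc _ _ _ _ _ _ _).symm
  rw [altWord_cons, altWord_cons, d_map_comp, map_sub, h₁, h₂, h₃, map_add, LinearMap.add_apply]
  abel

theorem altWord_contract_zero : ∀ {n : ℕ} {X Y Z W : C} (f : Z ⟶ X) (g : W ⟶ Z) (c : Chain n W Y),
    ρ.altWord ((Chain.cons f (.cons g c)).contract 0) =
      S.comp (zero_add _) (ρ.map f) (ρ.altWord (.cons g c)) -
      S.comp (Nat.add_comm 1 _) (ρ.dmap f) (S.comp (zero_add _) (ρ.map g) (ρ.altWord c)) :=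
  ρ.altWord_cons_comp

/-- The telescoping of `sum_dWord_contract` with one factor left undifferentiated. What does not
cancel in the interior are the terms with two adjacent undifferentiated factors, hence the
`pairWord`. -/
theorem sum_altWord_contract : ∀ {n : ℕ} {X Y Z : C} (f : Z ⟶ X) (c : Chain n Z Y),
    ∑ i : Fin (n + 1), (-1 : ℂ) ^ (i : ℕ) • ρ.altWord ((Chain.cons f c).contract i) =
      S.comp (zero_add _) (ρ.map f) (ρ.altWord c) - ρ.pairWord (.cons f c) +
        (-1 : ℂ) ^ n • S.comp (add_zero _) (ρ.altWord (Chain.cons f c).init)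
          (ρ.map (Chain.cons f c).last)
  | 0, _, _, _, f, .single g => by
    simp only [Nat.reduceAdd, Finset.univ_unique, Fin.default_eq_zero, Finset.sum_singleton,
      Fin.val_zero, pow_zero, one_smul]
    have h : S.comp (zero_add 0) (ρ.map f) (ρ.altWord (.single g)) -
      ρ.pairWord (.cons f (.single g)) = 0 := sub_self _
    rw [h, zero_add]
    exact ρ.map_comp g f
  | n + 1, _, _, _, f, .cons g c => by
    have ih := sum_altWord_contract g c
    have h₁ : S.comp (add_zero _) (ρ.altWord (Chain.cons f (.cons g c)).init)
          (ρ.map (Chain.cons f (.cons g c)).last) =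
        S.comp (add_zero _) (ρ.word (Chain.cons f (.cons g c)).init)
          (ρ.map (Chain.cons f (.cons g c)).last) -
        S.comp (Nat.add_comm 1 _) (ρ.dmap f) (S.comp (add_zero _) (ρ.altWord (Chain.cons g c).init)
          (ρ.map (Chain.cons g c).last)) := by
      exact (S.sub_comp _ _ _ _).trans (congrArg _ (S.assoc _ _ _ _ _ _ _))
    have h₄ : ∑ i : Fin (n + 1), (-1 : ℂ) ^ ((i.succ : Fin (n + 2)) : ℕ) •
        ρ.altWord (.cons f ((Chain.cons g c).contract i)) =
        S.comp (Nat.add_comm 1 _) (ρ.dmap f)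
          (∑ i : Fin (n + 1), (-1 : ℂ) ^ (i : ℕ) • ρ.altWord ((Chain.cons g c).contract i)) -
        S.comp (zero_add _) (ρ.map f)
          (∑ i : Fin (n + 1), (-1 : ℂ) ^ (i : ℕ) • ρ.dWord ((Chain.cons g c).contract i)) := by
      rw [map_sum, map_sum, ← Finset.sum_sub_distrib]
      refine Finset.sum_congr rfl fun i _ => ?_
      rw [altWord_cons, word_cons, map_smul, map_smul, Fin.val_succ, pow_succ]
      module
    rw [Fin.sum_univ_succ]
    simp only [Chain.contract_cons_cons_zero, Chain.contract_cons_cons_succ]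
    rw [h₄, ih, ρ.sum_dWord_contract, h₁, ρ.comp_word_init_cons, altWord_cons_comp, pairWord_cons,
      pow_succ]
    simp only [map_add, map_sub, map_smul, Fin.val_zero, pow_zero, one_smul]
    module

/-- Differentiating either member of an adjacent pair gives a word with one undifferentiated factor.
The signs telescope and leave only the first and last positions. -/
theorem d_pairWord : ∀ {n : ℕ} {X Y : C} (c : Chain (n + 1) X Y),
    S.d rfl (ρ.pairWord c) =
      ρ.word c + (-1 : ℂ) ^ n • S.comp (add_zero _) (ρ.dWord c.init) (ρ.map c.last)
  | 0, _, _, .cons f (.single g) => by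
    rw [pow_zero, one_smul]
    refine Eq.trans ?_ (add_comm _ _)
    refine (S.leibniz _ rfl (zero_add 1) (zero_add 1) (add_zero 1) (zero_add 1) _ _).trans ?_
    rw [pow_zero, one_smul]
    rfl
  | n + 1, _, _, .cons f (.cons g c) => by
    rw [pairWord_cons, map_add, S.leibniz _ rfl (zero_add 1) rfl (Nat.add_comm 1 _) (zero_add _),
      S.leibniz _ rfl rfl rfl (by omega) (Nat.add_comm 1 _), d_word, d_pairWord (.cons g c), S.d_d,
      comp_dWord_init_cons, pow_succ, word_cons ρ f]
    simp only [map_add, map_smul, map_zero, LinearMap.zero_apply]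
    module

theorem isMultilinear_altWord : ∀ {n : ℕ} {X Y : C}
    (L : S.Hom (ρ.obj Y) (ρ.obj X) n →ₗ[ℂ] ℂ), IsMultilinear fun c : Chain n X Y => L (ρ.altWord c)
  | 0, _, _, L => (L ∘ₗ ρ.map).isLinear
  | n + 1, X, Y, L => by
    have h₁ := ρ.isMultilinear_word (n := n + 1) (X := X) (Y := Y) L
    have h₂ : IsMultilinear fun c : Chain (n + 1) X Y => match c with
        | .cons f c => L (S.comp (Nat.add_comm 1 _) (ρ.dmap f) (ρ.altWord c)) :=
      ⟨fun _ c => (L ∘ₗ (S.comp (Nat.add_comm 1 _)).flip (ρ.altWord c) ∘ₗ S.d (zero_add 1) ∘ₗ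
          ρ.map).isLinear,
        fun _ f => isMultilinear_altWord (L ∘ₗ S.comp (Nat.add_comm 1 _) (ρ.dmap f))⟩
    convert h₁.add (h₂.smul (-1)) using 2 with c
    cases c with
    | cons f c => rw [altWord_cons, map_sub, neg_one_mul, sub_eq_add_neg]; rfl

end LinearSemifunctor

/-- A transgression between closed graded traces `T` and `σ` of dimensions `n` and `n + 2`: a linear
form `τ` in degree `n + 1` with `T = ½ τ ∂` whose failure to be a trace is measured by `σ`. -/
structure Transgression {S : DGSemicategory.{a, b}} {n : ℕ} (T : ClosedGradedTrace S n)
    (σ : ClosedGradedTrace S (n + 2)) where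
  τ : ∀ X : S.Obj, S.Hom X X (n + 1) →ₗ[ℂ] ℂ
  toFun_eq : ∀ (X : S.Obj) (x : S.Hom X X n), T.toFun X x = (1 / 2) * τ X (S.d rfl x)
  comp_comm : ∀ {X Y : S.Obj} {i j j' : ℕ} (h : i + j = n + 1) (h' : j + i = n + 1)
    (hj : j + 1 = j') (hn : j' + i = n + 2) (x : S.Hom Y X i) (y : S.Hom X Y j),
    τ X (S.comp h x y) = τ Y (S.comp h' y x) - σ.toFun Y (S.comp hn (S.d hj y) x)

namespace Transgression

variable {C : Type u} [Category.{v} C] [Preadditive C] [Linear ℂ C]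
variable {S : DGSemicategory.{a, b}} {n : ℕ} {T : ClosedGradedTrace S n}
  {σ : ClosedGradedTrace S (n + 2)} (t : Transgression T σ) (ρ : LinearSemifunctor C S)

/-- The defect in `comp_comm` involves only `dy`, so it vanishes for closed `y`; there is no Koszul
sign. -/
theorem comp_comm_of_closed {X Y : S.Obj} {i j : ℕ} (h : i + j = n + 1) (h' : j + i = n + 1)
    (x : S.Hom Y X i) (y : S.Hom X Y j) (hy : S.d rfl y = 0) :
    t.τ X (S.comp h x y) = t.τ Y (S.comp h' y x) := by
  rw [t.comp_comm h h' rfl (by omega), hy]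
  simp

/-- `∑ⱼ (-1)ʲ τ(∂(ρ f⁰) ⋯ (ρ fʲ) ⋯ ∂(ρ fⁿ⁺¹))`. -/
def cochain : NerveFun C (n + 1) := fun X c => t.τ (ρ.obj X) (ρ.altWord c)

/-- Rotation moves either `d l` past an alternating word, or the closed element `df⁰ ⋯ dfⁿ` past the
last morphism `l`, so no defect of `τ` appears. Evenness of `n` makes the signs match. -/
theorem cochain_mem_cyclicCochains (hn : Even n) :
    t.cochain ρ ∈ cyclicCochains C (n + 1) := by
  refine (mem_cyclicCochains_iff _).2 ⟨fun X => ρ.isMultilinear_altWord (t.τ _), ?_⟩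
  funext X c
  change (-1 : ℂ) ^ (n + 1) * t.τ _ (ρ.altWord (.cons c.last c.init)) = t.τ _ (ρ.altWord c)
  rw [ρ.altWord_cons, ρ.altWord_splitLast c, map_sub, ρ.word_cons, map_add, map_smul,
    t.comp_comm_of_closed _ (add_zero _) _ _ (ρ.d_dWord _ rfl),
    t.comp_comm_of_closed rfl (Nat.add_comm 1 _) _ _ (S.d_d _ _ _), hn.add_one.neg_one_pow]
  simp only [smul_eq_mul]
  ring

/-- The identity behind the theorem. All `τ` terms cancel between the faces, and the defect of one
commutation remains. -/
theorem two_mul_add_hochschild (hn : Even n) {X Z : C} (f : Z ⟶ X) (c : Chain (n + 1) Z X) :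
    2 * T.toFun _ (S.comp (zero_add n) (ρ.map f) (ρ.pairWord c)) +
        hochschild (n + 1) (t.cochain ρ) X (.cons f c) =
      -((n : ℂ) + 2) * σ.toFun _ (ρ.word (.cons f c)) := by
  obtain _ | ⟨g, c⟩ := c
  set l := (Chain.cons g c).last
  set i := (Chain.cons g c).init
  have e₁ := hn.neg_one_pow (α := ℂ)
  have e₂ := hn.add_one.neg_one_pow (α := ℂ)
  have e₃ : (-1 : ℂ) ^ (n + 1 + 1) = 1 := by rw [pow_succ, e₂]; norm_num
  have hT : 2 * T.toFun _ (S.comp (zero_add n) (ρ.map f) (ρ.pairWord (.cons g c))) =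
      t.τ _ (ρ.pairWord (.cons f (.cons g c))) +
        t.τ _ (S.comp (zero_add _) (ρ.map f) (S.comp (add_zero _) (ρ.dWord i) (ρ.map l))) := by
    rw [t.toFun_eq, S.leibniz _ rfl (zero_add 1) rfl (Nat.add_comm 1 n) (zero_add _),
      ρ.d_pairWord, ρ.pairWord_cons f, e₁, pow_zero, one_smul, one_smul]
    simp only [map_add]
    ring
  have hB := congrArg (t.τ _) (ρ.sum_altWord_contract f (.cons g c))
  simp only [map_sum, map_add, map_sub, map_smul, smul_eq_mul, e₂] at hB
  -- Here the last factor `d l` is moved to the front; it is closed, so there is no `σ` term.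
  have hA : t.τ _ (S.comp (zero_add _) (ρ.map f) (ρ.altWord (.cons g c))) =
      t.τ _ (S.comp (Nat.add_comm 1 _) (ρ.dmap l) (S.comp (zero_add _) (ρ.map f) (ρ.altWord i))) -
        t.τ _ (S.comp (zero_add _) (ρ.map f) (S.comp (add_zero _) (ρ.dWord i) (ρ.map l))) := by
    rw [ρ.altWord_splitLast, e₂, ← t.comp_comm_of_closed rfl (Nat.add_comm 1 _) _ _ (S.d_d _ _ _),
      S.assoc (zero_add n) rfl rfl (zero_add _)]
    simp only [map_add, map_smul, smul_eq_mul]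
    ring
  -- The only commutation past a non-closed element, namely the degree `0` morphism `l`: it is the
  -- source of `σ`.
  have hC : t.τ _ (S.comp (add_zero _) (ρ.altWord (Chain.cons f (.cons g c)).init)
        (ρ.map (Chain.cons f (.cons g c)).last)) =
      t.τ _ (S.comp (zero_add _) (ρ.map l) (ρ.altWord (.cons f i))) -
        σ.toFun _ (S.comp (Nat.add_comm 1 _) (ρ.dmap l) (ρ.altWord (.cons f i))) :=
    t.comp_comm _ _ _ _ _ _
  -- The alternating word has `n + 2` terms, equal to one another modulo exact elements by
  -- `apply_altWord`; the sign comes from moving the degree `1` factor `d l` past degree `n + 1`,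
  -- which is odd.
  have hD : σ.toFun _ (S.comp (Nat.add_comm 1 _) (ρ.dmap l) (ρ.altWord (.cons f i))) =
      -((n : ℂ) + 2) * σ.toFun _ (ρ.word (.cons f (.cons g c))) := by
    have h₁ : ∀ {k : ℕ} (h : k + 1 = n + 1) (x : S.Hom _ _ k),
        (σ.toFun _ ∘ₗ S.comp (Nat.add_comm 1 _) (ρ.dmap l)) (S.d h x) = 0 := fun {k} h x => by
      have h₂ := S.leibniz (Nat.add_comm 1 k) (by omega : k + 1 + 1 = n + 2) rfl h (by omega)
        (Nat.add_comm 1 (n + 1)) (ρ.dmap l) x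
      rw [S.d_d, map_zero, LinearMap.zero_apply, zero_add, pow_one, neg_one_smul] at h₂
      have h₃ := σ.closed _ (by omega : k + 1 + 1 = n + 2) (S.comp (Nat.add_comm 1 k) (ρ.dmap l) x)
      rw [h₂, map_neg, neg_eq_zero] at h₃
      exact h₃
    have h₄ := ρ.apply_altWord (.cons f i) (σ.toFun _ ∘ₗ S.comp (Nat.add_comm 1 _) (ρ.dmap l)) h₁
    simp only [LinearMap.comp_apply] at h₄
    have h₅ : σ.toFun _ (S.comp (Nat.add_comm 1 _) (ρ.dmap l) (ρ.word (.cons f i))) =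
        -σ.toFun _ (ρ.word (.cons f (.cons g c))) := by
      refine (σ.graded (Nat.add_comm 1 (n + 1)) rfl (ρ.dmap l) (ρ.word (.cons f i))).trans ?_
      rw [one_mul, e₂, neg_one_mul, ρ.word_splitLast (.cons f (.cons g c))]
      rfl
    rw [h₄, h₅]
    push_cast
    ring
  rw [hochschild_apply]
  change 2 * T.toFun _ (S.comp (zero_add n) (ρ.map f) (ρ.pairWord (.cons g c))) +
    (∑ j : Fin (n + 2), (-1 : ℂ) ^ (j : ℕ) *
      t.τ _ (ρ.altWord ((Chain.cons f (.cons g c)).contract j)) +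
    (-1 : ℂ) ^ (n + 1 + 1) * t.τ _ (ρ.altWord ((Chain.cons l (.cons f i)).contract 0))) = _
  rw [ρ.altWord_contract_zero, map_sub]
  linear_combination hT + hB + hA - hC + hD + (t.τ _ (S.comp (zero_add _) (ρ.map l)
    (ρ.altWord (.cons f i))) - t.τ _ (S.comp (Nat.add_comm 1 _) (ρ.dmap l)
      (S.comp (zero_add _) (ρ.map f) (ρ.altWord i)))) * e₃

end Transgression

/-! ## The periodicity operator on characters -/

section WordRel

variable {C : Type u} [Category.{v} C] [Preadditive C] [Linear ℂ C]
variable {S : DGSemicategory.{a, b}} {S' : DGSemicategory.{a', b'}}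

/-- The relation between the morphisms of two DG-semicategories which is spanned by the pairs of
corresponding words. -/
inductive WordRel (ρ : LinearSemifunctor C S) (ρ' : LinearSemifunctor C S') {X Y : C} :
    ∀ {n : ℕ}, S.Hom (ρ.obj Y) (ρ.obj X) n → S'.Hom (ρ'.obj Y) (ρ'.obj X) n → Prop
  | word {n : ℕ} (c : Chain n X Y) : WordRel ρ ρ' (ρ.word c) (ρ'.word c)
  | dWord {n : ℕ} (c : Chain n X Y) : WordRel ρ ρ' (ρ.dWord c) (ρ'.dWord c)
  | add {n : ℕ} {x y : S.Hom (ρ.obj Y) (ρ.obj X) n} {x' y' : S'.Hom (ρ'.obj Y) (ρ'.obj X) n} :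
      WordRel ρ ρ' x x' → WordRel ρ ρ' y y' → WordRel ρ ρ' (x + y) (x' + y')
  | sub {n : ℕ} {x y : S.Hom (ρ.obj Y) (ρ.obj X) n} {x' y' : S'.Hom (ρ'.obj Y) (ρ'.obj X) n} :
      WordRel ρ ρ' x x' → WordRel ρ ρ' y y' → WordRel ρ ρ' (x - y) (x' - y')

/-- The rewriting rule `(df) g = d(fg) - f dg`, which keeps left multiplication by `df` within the
span of words and their differentials. -/
theorem LinearSemifunctor.dmap_comp_word (ρ : LinearSemifunctor C S) : ∀ {n : ℕ} {X Y Z : C}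
    (f : Z ⟶ X) (c : Chain n Z Y), S.comp (Nat.add_comm 1 n) (ρ.dmap f) (ρ.word c) =
      ρ.dWord ((Chain.cons f c).contract 0) - ρ.word (.cons f c)
  | 0, _, _, _, f, .single g => by
    refine eq_sub_of_add_eq ?_
    exact (ρ.d_map_comp g f).symm
  | n + 1, _, _, _, f, .cons g c => by
    have h₁ : S.comp (Nat.add_comm 1 _) (ρ.dmap f) (ρ.word (.cons g c)) =
        S.comp (Nat.add_comm 1 _) (S.comp (add_zero 1) (ρ.dmap f) (ρ.map g)) (ρ.dWord c) :=
      (S.assoc _ _ _ _ _ _ _).symm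
    have h₂ : ρ.word (.cons f (.cons g c)) =
        S.comp (Nat.add_comm 1 _) (S.comp (zero_add 1) (ρ.map f) (ρ.dmap g)) (ρ.dWord c) :=
      (S.assoc _ _ _ _ _ _ _).symm
    rw [h₁, h₂, Chain.contract_cons_cons_zero, ρ.dWord_cons, ρ.d_map_comp, map_add,
      LinearMap.add_apply, add_sub_cancel_right]

variable {ρ : LinearSemifunctor C S} {ρ' : LinearSemifunctor C S'}

theorem WordRel.map_comp {X Y Z : C} (f : Z ⟶ X) {n : ℕ} {x : S.Hom (ρ.obj Y) (ρ.obj Z) n}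
    {x' : S'.Hom (ρ'.obj Y) (ρ'.obj Z) n} (h : WordRel ρ ρ' x x') :
    WordRel ρ ρ' (S.comp (zero_add n) (ρ.map f) x) (S'.comp (zero_add n) (ρ'.map f) x') := by
  induction h with
  | word c => rw [← ρ.word_contract_zero, ← ρ'.word_contract_zero]; exact .word _
  | dWord c => exact .word (.cons f c)
  | add _ _ h₁ h₂ => rw [map_add, map_add]; exact h₁.add h₂
  | sub _ _ h₁ h₂ => rw [map_sub, map_sub]; exact h₁.sub h₂

theorem WordRel.dmap_comp {X Y Z : C} (f : Z ⟶ X) {n : ℕ} {x : S.Hom (ρ.obj Y) (ρ.obj Z) n}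
    {x' : S'.Hom (ρ'.obj Y) (ρ'.obj Z) n} (h : WordRel ρ ρ' x x') :
    WordRel ρ ρ' (S.comp (Nat.add_comm 1 n) (ρ.dmap f) x)
      (S'.comp (Nat.add_comm 1 n) (ρ'.dmap f) x') := by
  induction h with
  | word c =>
    rw [ρ.dmap_comp_word, ρ'.dmap_comp_word]
    exact (WordRel.dWord _).sub (.word _)
  | dWord c => exact .dWord (.cons f c)
  | add _ _ h₁ h₂ => rw [map_add, map_add]; exact h₁.add h₂
  | sub _ _ h₁ h₂ => rw [map_sub, map_sub]; exact h₁.sub h₂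

theorem wordRel_pairWord : ∀ {n : ℕ} {X Y : C} (c : Chain (n + 1) X Y),
    WordRel ρ ρ' (ρ.pairWord c) (ρ'.pairWord c)
  | 0, _, _, .cons f (.single g) => (WordRel.word (.single g)).map_comp f
  | _ + 1, _, _, .cons f (.cons g c) =>
    ((WordRel.word (.cons g c)).map_comp f).add ((wordRel_pairWord (.cons g c)).dmap_comp f)

/-- On words the traces agree by assumption; on `dWord` both vanish, as it is the differential of
the corresponding word. -/
theorem WordRel.toFun_eq {X : C} {n : ℕ} {x : S.Hom (ρ.obj X) (ρ.obj X) n}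
    {x' : S'.Hom (ρ'.obj X) (ρ'.obj X) n} (h : WordRel ρ ρ' x x') (T : ClosedGradedTrace S n)
    (T' : ClosedGradedTrace S' n) (hT : ∀ c : Chain n X X,
      T.toFun _ (ρ.word c) = T'.toFun _ (ρ'.word c)) : T.toFun _ x = T'.toFun _ x' := by
  induction h with
  | word c => exact hT c
  | dWord c => rw [← ρ.d_word, ← ρ'.d_word, T.closed, T'.closed]
  | add _ _ h₁ h₂ => rw [map_add, map_add, h₁ T T' hT, h₂ T T' hT]
  | sub _ _ h₁ h₂ => rw [map_sub, map_sub, h₁ T T' hT, h₂ T T' hT]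

end WordRel

section Periodicity

variable {C : Type u} [Category.{v} C] [Preadditive C] [Linear ℂ C]

/-- `∑ᵢ T(ρ(f⁰) ∂(ρ f¹) ⋯ ∂(ρ fⁱ⁻¹) ρ(fⁱ) ρ(fⁱ⁺¹) ∂(ρ fⁱ⁺²) ⋯ ∂(ρ fⁿ⁺²))`. -/
def Cycle.periodicity {n : ℕ} (A : Cycle.{u, v, a, b} C n) : NerveFun C (n + 2) :=
  fun _ c => match c with
    | .cons f c => A.T.toFun _ (A.S.comp (zero_add n) (A.ρ.map f) (A.ρ.pairWord c))

/-- The argument of the trace is the same universal combination of words in both cycles, so only the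
characters enter. -/
theorem Cycle.periodicity_congr {n : ℕ} (A : Cycle.{u, v, a, b} C n)
    (B : Cycle.{u, v, a', b'} C n) (h : A.character = B.character) :
    A.periodicity = B.periodicity := by
  funext X c
  obtain _ | ⟨f, c⟩ := c
  exact ((wordRel_pairWord c).map_comp f).toFun_eq A.T B.T fun c => congrFun (congrFun h X) c

end Periodicity

/-! ### Expansion of words in a tensor product along an idempotent -/

section TensorWord

variable {S : DGSemicategory.{a, b}} {S' : DGSemicategory.{a', b'}}

/-- The span of the `x ⊗ y` with `deg y ≥ 3`, or `deg y = 2` and `e y = 0`. -/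
inductive IsNegligible {P : S'.Obj} (e : S'.Hom P P 0) {X Y : S.Obj} :
    ∀ {n : ℕ}, DGSemicategory.TensorHom S S' (X, P) (Y, P) n → Prop
  | zero {n : ℕ} : IsNegligible e (0 : DGSemicategory.TensorHom S S' (X, P) (Y, P) n)
  | add {n : ℕ} {x y : DGSemicategory.TensorHom S S' (X, P) (Y, P) n} : IsNegligible e x →
      IsNegligible e y → IsNegligible e (x + y)
  | two {i n : ℕ} (h : i + 2 = n) (x : S.Hom X Y i) (y : S'.Hom P P 2)
      (hy : S'.comp (zero_add 2) e y = 0) :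
      IsNegligible e (DGSemicategory.tensorIncl (X, P) (Y, P) h (x ⊗ₜ y))
  | three {i j n : ℕ} (h : i + j = n) (hj : 2 < j) (x : S.Hom X Y i) (y : S'.Hom P P j) :
      IsNegligible e (DGSemicategory.tensorIncl (X, P) (Y, P) h (x ⊗ₜ y))

open DGSemicategory in
theorem IsNegligible.comp_left {P : S'.Obj} {e : S'.Hom P P 0} {X Y Z : S.Obj} {n i k : ℕ}
    {z : TensorHom S S' (X, P) (Y, P) n} (hz : IsNegligible e z) (h : i + n = k) (hi : i + 0 = i)
    (x : S.Hom Y Z i) :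
    IsNegligible e (tensorCompDG h (tensorIncl (Y, P) (Z, P) hi (x ⊗ₜ e)) z) := by
  induction hz with
  | zero => rw [map_zero]; exact .zero
  | add _ _ h₁ h₂ => rw [map_add]; exact (h₁ h).add (h₂ h)
  | two h' y y' hy =>
    rw [tensorCompDG_incl h hi h' rfl (zero_add 2) (by omega), hy, TensorProduct.tmul_zero,
      map_zero, smul_zero]
    exact .zero
  | three h' hj y y' =>
    rw [tensorCompDG_incl h hi h' rfl (zero_add _) (by omega), zero_mul, pow_zero, one_smul]
    exact .three _ hj _ _

open DGSemicategory in
-- Every negligible term has second degree at least `2`; multiplying by a factor of second degree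
-- `1` pushes it to at least `3`.
theorem IsNegligible.comp_left_one {P : S'.Obj} {e : S'.Hom P P 0} {X Y Z : S.Obj} {n k : ℕ}
    {z : TensorHom S S' (X, P) (Y, P) n} (hz : IsNegligible e z) (h : 1 + n = k)
    (x : S.Hom Y Z 0) (y : S'.Hom P P 1) :
    IsNegligible e (tensorCompDG h (tensorIncl (Y, P) (Z, P) (zero_add 1) (x ⊗ₜ y)) z) := by
  have key : ∀ {i j m : ℕ} (h' : i + j = m) (hm : 1 + m = k) (hj : 1 < j) (w : S.Hom X Y i)
      (w' : S'.Hom P P j), IsNegligible e (tensorCompDG hm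
        (tensorIncl (Y, P) (Z, P) (zero_add 1) (x ⊗ₜ y))
        (tensorIncl (X, P) (Y, P) h' (w ⊗ₜ w'))) := fun {i j m} h' hm hj w w' => by
    rw [tensorCompDG_incl hm (zero_add 1) h' (zero_add _) rfl (by omega), ← map_smul,
      TensorProduct.smul_tmul']
    exact .three _ (by omega) _ _
  induction hz with
  | zero => rw [map_zero]; exact .zero
  | add _ _ h₁ h₂ => rw [map_add]; exact (h₁ h).add (h₂ h)
  | two h' y y' hy => exact key h' h one_lt_two _ _
  | three h' hj y y' => exact key h' h (by omega) _ _

/-- `z` is, up to negligible terms, of the form `D ⊗ e + U ⊗ e ∂e + (-1)ⁿ W ⊗ (∂e) e`. -/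
def HasLeadingTerms {P : S'.Obj} (e : S'.Hom P P 0) {X Y : S.Obj} {n : ℕ}
    (D : S.Hom X Y (n + 1)) (W : S.Hom X Y n)
    (z : DGSemicategory.TensorHom S S' (X, P) (Y, P) (n + 1)) : Prop :=
  ∃ (U : S.Hom X Y n) (y : DGSemicategory.TensorHom S S' (X, P) (Y, P) (n + 1)),
    IsNegligible e y ∧ z = DGSemicategory.tensorIncl (X, P) (Y, P) rfl (D ⊗ₜ e) +
      DGSemicategory.tensorIncl (X, P) (Y, P) rfl
        (U ⊗ₜ S'.comp (zero_add 1) e (S'.d (zero_add 1) e)) +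
      (-1 : ℂ) ^ n • DGSemicategory.tensorIncl (X, P) (Y, P) rfl
        (W ⊗ₜ S'.comp (add_zero 1) (S'.d (zero_add 1) e) e) + y

section Idempotent

open DGSemicategory

variable {P : S'.Obj} {e : S'.Hom P P 0}

theorem DGSemicategory.d_eq_of_idem (he : S'.comp (zero_add 0) e e = e) :
    S'.d (zero_add 1) e =
    S'.comp (add_zero 1) (S'.d (zero_add 1) e) e +
      S'.comp (zero_add 1) e (S'.d (zero_add 1) e) := by
  have h := S'.leibniz (zero_add 0) (zero_add 1) (zero_add 1) (zero_add 1) (add_zero 1) (zero_add 1)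
    e e
  rwa [he, pow_zero, one_smul] at h

/-- Multiply `de = (de) e + e de` by `e` on the left. -/
theorem DGSemicategory.idem_comp_d_comp_idem (he : S'.comp (zero_add 0) e e = e) :
    S'.comp (zero_add 1) e (S'.comp (add_zero 1) (S'.d (zero_add 1) e) e) = 0 := by
  have h := congrArg (S'.comp (zero_add 1) e) (S'.d_eq_of_idem he)
  rwa [map_add, ← S'.assoc (zero_add 0) (zero_add 1) (zero_add 1) (zero_add 1) e e, he,
    right_eq_add] at h

theorem DGSemicategory.idem_comp_comp (he : S'.comp (zero_add 0) e e = e)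
    {Q : S'.Obj} {n : ℕ} (x : S'.Hom Q P n) :
    S'.comp (zero_add n) e (S'.comp (zero_add n) e x) = S'.comp (zero_add n) e x := by
  rw [← S'.assoc (zero_add 0) (zero_add n) (zero_add n) (zero_add n) e e, he]

/-- Differentiate `e (de) e = 0`: the idempotent `e` commutes with `de de`. -/
theorem DGSemicategory.d_comp_d_comp_idem (he : S'.comp (zero_add 0) e e = e) :
    S'.comp rfl (S'.d (zero_add 1) e) (S'.comp (add_zero 1) (S'.d (zero_add 1) e) e) =
      S'.comp (zero_add 2) e (S'.comp rfl (S'.d (zero_add 1) e) (S'.d (zero_add 1) e)) := by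
  have h := S'.leibniz (zero_add 1) rfl (zero_add 1) rfl rfl (zero_add 2) e
    (S'.comp (add_zero 1) (S'.d (zero_add 1) e) e)
  rw [S'.leibniz (add_zero 1) rfl rfl (zero_add 1) (add_zero 2) rfl, S'.d_d,
    S'.idem_comp_d_comp_idem he, map_zero, map_zero, LinearMap.zero_apply, zero_add, pow_zero,
    one_smul, pow_one, neg_one_smul, map_neg, ← sub_eq_add_neg] at h
  exact (sub_eq_zero.mp h.symm)

theorem DGSemicategory.idem_comp_d_comp_idem_comp_d (he : S'.comp (zero_add 0) e e = e) :
    S'.comp (zero_add 2) e (S'.comp rfl (S'.d (zero_add 1) e)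
      (S'.comp (zero_add 1) e (S'.d (zero_add 1) e))) = 0 := by
  rw [← S'.assoc (add_zero 1) rfl (zero_add 1) rfl,
    ← S'.assoc (zero_add 1) (Nat.add_comm 1 1) (Nat.add_comm 1 1) (zero_add 2),
    S'.idem_comp_d_comp_idem he, map_zero, LinearMap.zero_apply]

/-- Multiply the leading terms by `df ⊗ e + f ⊗ de`. The factor `f ⊗ de` turns `D ⊗ e` into the new
`(de) e` term and `W ⊗ (de) e` into `f W ⊗ e de de`; the sign `(-1)ⁿ` in `HasLeadingTerms` cancels
the Koszul sign. The product `f U ⊗ de e de` is negligible because `e de e = 0`. -/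
theorem HasLeadingTerms.comp_left (he : S'.comp (zero_add 0) e e = e)
    {X Y Z : S.Obj} {n : ℕ} {D : S.Hom X Y (n + 1)}
    {W : S.Hom X Y n} {z : TensorHom S S' (X, P) (Y, P) (n + 1)} (h : HasLeadingTerms e D W z)
    (f : S.Hom Y Z 0) : ∃ z', HasLeadingTerms e
        (S.comp (Nat.add_comm 1 _) (S.d (zero_add 1) f) D) (S.comp (zero_add _) f D) z' ∧
      tensorCompDG (Nat.add_comm 1 _)
        (tensorD (zero_add 1) (tensorIncl (Y, P) (Z, P) (zero_add 0) (f ⊗ₜ e))) z =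
      z' + tensorIncl (X, P) (Z, P) rfl (S.comp (zero_add n) f W ⊗ₜ S'.comp (zero_add 2) e
        (S'.comp rfl (S'.d (zero_add 1) e) (S'.d (zero_add 1) e))) := by
  obtain ⟨U, y, hy, rfl⟩ := h
  refine ⟨_, ⟨S.comp (Nat.add_comm 1 _) (S.d (zero_add 1) f) U, _,
    ((hy.comp_left (Nat.add_comm 1 _) (add_zero 1) (S.d (zero_add 1) f)).add
      (hy.comp_left_one (Nat.add_comm 1 _) f (S'.d (zero_add 1) e))).add
      (.two rfl (((-1 : ℂ) ^ (1 * n)) • S.comp (zero_add n) f U) _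
        (S'.idem_comp_d_comp_idem_comp_d he)), rfl⟩, ?_⟩
  rw [tensorD_incl (zero_add 1) (zero_add 0) (zero_add 1) (zero_add 1) (add_zero 1) (zero_add 1)]
  simp only [map_add, LinearMap.add_apply, map_smul, LinearMap.smul_apply]
  rw [tensorCompDG_incl _ _ _ (Nat.add_comm 1 _) (zero_add 0) rfl,
    tensorCompDG_incl _ _ _ (zero_add (n + 1)) (add_zero 1) rfl,
    tensorCompDG_incl _ _ _ (Nat.add_comm 1 n) (zero_add 1) rfl,
    tensorCompDG_incl _ _ _ (zero_add n) (Nat.add_comm 1 1) rfl,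
    tensorCompDG_incl _ _ _ (Nat.add_comm 1 n) (zero_add 1) rfl,
    tensorCompDG_incl _ _ _ (zero_add n) (Nat.add_comm 1 1) rfl,
    S'.idem_comp_d_comp_idem he, he, S'.d_comp_d_comp_idem he, S'.idem_comp_comp he]
  simp only [zero_mul, pow_zero, one_smul, one_mul, TensorProduct.tmul_zero, map_zero, smul_zero,
    ← TensorProduct.smul_tmul', map_smul, zero_add]
  have hn : (-1 : ℂ) ^ n * (-1) ^ n = 1 := by rw [← mul_pow]; simp
  rw [smul_smul ((-1 : ℂ) ^ n) ((-1) ^ n), hn, one_smul]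
  abel

end Idempotent

end TensorWord

section TensorOne

open DGSemicategory

variable {C : Type u} [Category.{v} C] [Preadditive C] [Linear ℂ C]
variable {S : DGSemicategory.{a, b}} {S' : DGSemicategory.{a', b'}}

theorem HasLeadingTerms.add_negligible {P : S'.Obj} {e : S'.Hom P P 0} {X Y : S.Obj} {n : ℕ}
    {D : S.Hom X Y (n + 1)} {W : S.Hom X Y n} {z y : TensorHom S S' (X, P) (Y, P) (n + 1)}
    (hz : HasLeadingTerms e D W z) (hy : IsNegligible e y) : HasLeadingTerms e D W (z + y) := by
  obtain ⟨U, y', hy', rfl⟩ := hz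
  exact ⟨U, _, hy'.add hy, add_assoc _ _ _⟩

theorem HasLeadingTerms.add_comp_left {P : S'.Obj} {e : S'.Hom P P 0}
    (he : S'.comp (zero_add 0) e e = e) {X Y Z : S.Obj} {n : ℕ} {D : S.Hom X Y (n + 1 + 1)}
    {W : S.Hom X Y (n + 1)} {z : TensorHom S S' (X, P) (Y, P) (n + 1 + 1)}
    (h : HasLeadingTerms e D W z) (f : S.Hom Y Z 0) (R : S.Hom X Y n) :
    ∃ z', HasLeadingTerms e
        (S.comp (Nat.add_comm 1 _) (S.d (zero_add 1) f) D) (S.comp (zero_add _) f D) z' ∧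
      tensorCompDG (Nat.add_comm 1 _)
        (tensorD (zero_add 1) (tensorIncl (Y, P) (Z, P) (zero_add 0) (f ⊗ₜ e)))
        (z + tensorIncl (X, P) (Y, P) rfl (R ⊗ₜ S'.comp (zero_add 2) e
          (S'.comp rfl (S'.d (zero_add 1) e) (S'.d (zero_add 1) e)))) =
      z' + tensorIncl (X, P) (Z, P) rfl ((S.comp (zero_add _) f W +
        S.comp (Nat.add_comm 1 _) (S.d (zero_add 1) f) R) ⊗ₜ S'.comp (zero_add 2) e
        (S'.comp rfl (S'.d (zero_add 1) e) (S'.d (zero_add 1) e))) := by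
  obtain ⟨z', hz', h'⟩ := h.comp_left he f
  refine ⟨_, hz'.add_negligible (.three (i := n) (j := 3) rfl (by norm_num)
    ((-1 : ℂ) ^ (1 * n) • S.comp (zero_add _) f R)
    (S'.comp rfl (S'.d (zero_add 1) e) (S'.comp (zero_add 2) e
          (S'.comp rfl (S'.d (zero_add 1) e) (S'.d (zero_add 1) e))))), ?_⟩
  rw [map_add, h',
    tensorD_incl (zero_add 1) (zero_add 0) (zero_add 1) (zero_add 1) (add_zero 1) (zero_add 1)]
  simp only [map_add, LinearMap.add_apply, map_smul, LinearMap.smul_apply]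
  rw [tensorCompDG_incl _ _ _ (Nat.add_comm 1 _) (zero_add 2) rfl,
    tensorCompDG_incl _ _ _ (zero_add n) (Nat.add_comm 1 2) rfl, S'.idem_comp_comp he,
    TensorProduct.add_tmul, map_add, ← TensorProduct.smul_tmul', map_smul]
  simp only [zero_mul, pow_zero, one_smul]
  abel

namespace LinearSemifunctor

variable (ρ : LinearSemifunctor C S) (ρ' : LinearSemifunctor (SingleObj ℂ) S')

/-- The idempotent `ρ(1)`. -/
def unit : S'.Hom (ρ'.obj (SingleObj.star ℂ)) (ρ'.obj (SingleObj.star ℂ)) 0 :=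
  ρ'.map (𝟙 (SingleObj.star ℂ))

theorem unit_comp_unit : S'.comp (zero_add 0) ρ'.unit ρ'.unit = ρ'.unit := by
  rw [unit, ← ρ'.map_comp, Category.comp_id]

/-- `ρ(1) ∂(ρ 1) ∂(ρ 1)`. -/
def unitWord : S'.Hom (ρ'.obj (SingleObj.star ℂ)) (ρ'.obj (SingleObj.star ℂ)) 2 :=
  S'.comp (zero_add 2) ρ'.unit
    (S'.comp rfl (S'.d (zero_add 1) ρ'.unit) (S'.d (zero_add 1) ρ'.unit))

theorem unit_comp_unitWord : S'.comp (zero_add 2) ρ'.unit ρ'.unitWord = ρ'.unitWord :=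
  S'.idem_comp_comp ρ'.unit_comp_unit _

theorem hasLeadingTerms_dWord_tensorOne {X Y : C} : ∀ (c : Chain 0 X Y),
    HasLeadingTerms (S := S) (X := ρ.obj Y) (Y := ρ.obj X) ρ'.unit (ρ.dWord c) (ρ.word c)
      ((ρ.tensor ρ').dWord c.tensorOne)
  | .single f => by
    refine ⟨ρ.map f, 0, .zero, ?_⟩
    change tensorD (zero_add 1) (tensorIncl (ρ.obj Y, ρ'.obj (SingleObj.star ℂ))
      (ρ.obj X, ρ'.obj (SingleObj.star ℂ)) (zero_add 0) (ρ.map f ⊗ₜ ρ'.unit)) = _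
    rw [tensorD_incl (zero_add 1) (zero_add 0) (zero_add 1) (zero_add 1) (add_zero 1) (zero_add 1),
      d_eq_of_idem ρ'.unit_comp_unit, TensorProduct.tmul_add, map_add, pow_zero, one_smul,
      one_smul, add_zero, add_comm (tensorIncl _ _ _ _) (tensorIncl _ _ _ _), ← add_assoc,
      ← d_eq_of_idem ρ'.unit_comp_unit]
    rfl

/-- The recursion for the coefficient of `e de de`, prefixing `f W` and multiplying earlier pairs by
`df`, is the one defining `pairWord`. The other leading terms have second degree below `2`, so the
trace will not see them. -/
theorem dWord_tensorOne : ∀ {n : ℕ} {X Y : C} (c : Chain (n + 1) X Y),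
    ∃ z, HasLeadingTerms (S := S) (X := ρ.obj Y) (Y := ρ.obj X) ρ'.unit (ρ.dWord c) (ρ.word c) z ∧
      (ρ.tensor ρ').dWord c.tensorOne = z + tensorIncl (ρ.obj Y, ρ'.obj (SingleObj.star ℂ))
        (ρ.obj X, ρ'.obj (SingleObj.star ℂ)) rfl (ρ.pairWord c ⊗ₜ ρ'.unitWord)
  | 0, _, _, .cons f (.single g) =>
    (ρ.hasLeadingTerms_dWord_tensorOne ρ' (.single g)).comp_left ρ'.unit_comp_unit (ρ.map f)
  | n + 1, X, Y, .cons f (.cons g c) => by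
    obtain ⟨z, hz, h⟩ := dWord_tensorOne (.cons g c)
    obtain ⟨z', hz', h'⟩ := hz.add_comp_left ρ'.unit_comp_unit (ρ.map f) (ρ.pairWord (.cons g c))
    exact ⟨z', hz', (congrArg _ h).trans h'⟩

end LinearSemifunctor

end TensorOne

/-! ### The cup product with `ψ` as an explicit cochain -/

section Character

open DGSemicategory

variable {S : DGSemicategory.{a, b}} {S' : DGSemicategory.{a', b'}}

theorem IsNegligible.traceTensorFun_comp_left {P : S'.Obj} {e : S'.Hom P P 0} {X Y : S.Obj}
    {m n : ℕ} {z : TensorHom S S' (X, P) (Y, P) m} (hz : IsNegligible e z) (hm : 0 + m = n + 2)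
    (T : ClosedGradedTrace S n) (T' : ClosedGradedTrace S' 2) (f : S.Hom Y X 0) :
    traceTensorFun T T' (X, P)
      (tensorCompDG hm (tensorIncl (Y, P) (X, P) (zero_add 0) (f ⊗ₜ e)) z) = 0 := by
  induction hz with
  | zero => rw [map_zero, map_zero]
  | add _ _ h₁ h₂ => rw [map_add, map_add, h₁, h₂, add_zero]
  | two h x y hy =>
    rw [tensorCompDG_incl hm (zero_add 0) h (zero_add _) (zero_add 2) (by omega), hy,
      TensorProduct.tmul_zero, map_zero, smul_zero, map_zero]
  | three h hj x y =>
    rw [tensorCompDG_incl hm (zero_add 0) h (zero_add _) (zero_add _) (by omega), map_smul,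
      traceTensorFun_incl_of_ne _ _ _ _ (by omega), smul_zero]

/-- The terms built from `e`, `e de` and `(de) e` have second degree at most `1` and miss the
bidegree `(n, 2)`; left multiplication by `e` disposes of the negligible ones. -/
theorem HasLeadingTerms.traceTensorFun_comp_left {P : S'.Obj} {e : S'.Hom P P 0} {X Y : S.Obj}
    {n : ℕ} {D : S.Hom X Y (n + 1 + 1)} {W : S.Hom X Y (n + 1)}
    {z : TensorHom S S' (X, P) (Y, P) (n + 1 + 1)} (hz : HasLeadingTerms e D W z)
    (T : ClosedGradedTrace S n) (T' : ClosedGradedTrace S' 2) (f : S.Hom Y X 0) :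
    traceTensorFun T T' (X, P) (tensorCompDG (zero_add (n + 2))
      (tensorIncl (Y, P) (X, P) (zero_add 0) (f ⊗ₜ e)) z) = 0 := by
  obtain ⟨U, y, hy, rfl⟩ := hz
  simp only [map_add, map_smul]
  rw [hy.traceTensorFun_comp_left, tensorCompDG_incl _ _ _ (zero_add _) (zero_add 0) rfl,
    tensorCompDG_incl _ _ _ (zero_add _) (zero_add 1) rfl,
    tensorCompDG_incl _ _ _ (zero_add _) (zero_add 1) rfl, map_smul, map_smul, map_smul,
    traceTensorFun_incl_of_ne _ _ _ _ (by omega), traceTensorFun_incl_of_ne _ _ _ _ (by omega),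
    traceTensorFun_incl_of_ne _ _ _ _ (by omega)]
  simp

variable {C : Type u} [Category.{v} C] [Preadditive C] [Linear ℂ C]

theorem Cycle.toFun_unitWord (A' : Cycle.{0, 0, a', b'} (SingleObj ℂ) 2)
    (h : A'.character = unitTwoCocycle) : A'.T.toFun _ A'.ρ.unitWord = 1 := by
  have h' := congrFun (congrFun h (SingleObj.star ℂ)) (.cons (𝟙 (SingleObj.star ℂ))
    (.cons (𝟙 (SingleObj.star ℂ)) (.single (𝟙 (SingleObj.star ℂ)))))
  refine Eq.trans (by rfl) (h'.trans ?_)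
  change (1 : ℂ) * 1 * 1 = 1
  norm_num

theorem Cycle.character_tensor_tensorOne {n : ℕ} (A : Cycle.{u, v, a, b} C n)
    (A' : Cycle.{0, 0, a', b'} (SingleObj ℂ) 2) (h : A'.character = unitTwoCocycle) (X : C)
    (c : Chain (n + 2) X X) :
    (A.tensor A').character ⟨X, SingleObj.star ℂ⟩ c.tensorOne = A.periodicity X c := by
  obtain _ | ⟨f, c⟩ := c
  obtain ⟨z, hz, hc⟩ := A.ρ.dWord_tensorOne A'.ρ c
  refine (congrArg (fun x => traceTensorFun A.T A'.T (A.ρ.obj X, A'.ρ.obj (SingleObj.star ℂ))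
    (tensorCompDG (zero_add (n + 2)) (tensorIncl (A.ρ.obj _, A'.ρ.obj (SingleObj.star ℂ))
      (A.ρ.obj X, A'.ρ.obj (SingleObj.star ℂ)) (zero_add 0)
      (A.ρ.map f ⊗ₜ A'.ρ.unit)) x)) hc).trans ?_
  simp only [map_add]
  rw [hz.traceTensorFun_comp_left, tensorCompDG_incl _ _ _ (zero_add _) (zero_add 2) rfl,
    A'.ρ.unit_comp_unitWord, map_smul, traceTensorFun_incl, A'.toFun_unitWord h, zero_mul,
    pow_zero, one_smul, mul_one, zero_add]
  rfl

/-- The restriction of a semifunctor on `C ⊗ ℂ` along `C ≅ C ⊗ ℂ`, `f ↔ f ⊗ 1`. -/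
def LinearSemifunctor.restrict (σ : LinearSemifunctor (TensorCat C (SingleObj ℂ)) S) :
    LinearSemifunctor C S where
  obj X := σ.obj ⟨X, SingleObj.star ℂ⟩
  map {X Y} := (σ.map (X := ⟨X, SingleObj.star ℂ⟩) (Y := ⟨Y, SingleObj.star ℂ⟩)) ∘ₗ
    ((TensorProduct.mk ℂ (X ⟶ Y) (SingleObj.star ℂ ⟶ SingleObj.star ℂ)).flip
      (𝟙 (SingleObj.star ℂ)))
  map_comp {X Y Z} f g := by
    refine Eq.trans ?_ (σ.map_comp (X := ⟨X, SingleObj.star ℂ⟩) (Y := ⟨Y, SingleObj.star ℂ⟩)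
      (Z := ⟨Z, SingleObj.star ℂ⟩) (f ⊗ₜ[ℂ] 𝟙 (SingleObj.star ℂ))
      (g ⊗ₜ[ℂ] 𝟙 (SingleObj.star ℂ)))
    refine congrArg (σ.map (X := ⟨X, SingleObj.star ℂ⟩) (Y := ⟨Z, SingleObj.star ℂ⟩)) ?_
    change (f ≫ g) ⊗ₜ[ℂ] 𝟙 (SingleObj.star ℂ) = tensorComp (C := C) (D := SingleObj ℂ)
      ⟨X, SingleObj.star ℂ⟩ ⟨Y, SingleObj.star ℂ⟩ ⟨Z, SingleObj.star ℂ⟩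
      (f ⊗ₜ[ℂ] 𝟙 (SingleObj.star ℂ)) (g ⊗ₜ[ℂ] 𝟙 (SingleObj.star ℂ))
    simp [tensorComp]

theorem LinearSemifunctor.dWord_restrict (σ : LinearSemifunctor (TensorCat C (SingleObj ℂ)) S) :
    ∀ {n : ℕ} {X Y : C} (c : Chain n X Y), σ.restrict.dWord c = σ.dWord c.tensorOne
  | 0, _, _, .single _ => rfl
  | _ + 1, _, _, .cons f c => congrArg (S.comp (Nat.add_comm 1 _)
      (S.d (zero_add 1) (σ.restrict.map f))) (σ.dWord_restrict c)

theorem LinearSemifunctor.word_restrict (σ : LinearSemifunctor (TensorCat C (SingleObj ℂ)) S) :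
    ∀ {n : ℕ} {X Y : C} (c : Chain n X Y), σ.restrict.word c = σ.word c.tensorOne
  | 0, _, _, .single _ => rfl
  | _ + 1, _, _, .cons f c => congrArg (S.comp (zero_add _) (σ.restrict.map f))
      (σ.dWord_restrict c)

/-- Restricting the tensor product cycle along `f ↦ f ⊗ 1` exhibits this cochain as the character of
a cycle over `C` itself. -/
theorem Cycle.periodicity_mem_cyclicCocycles {n : ℕ} (A : Cycle.{u, v, a, b} C n)
    (A' : Cycle.{0, 0, a', b'} (SingleObj ℂ) 2) (h : A'.character = unitTwoCocycle) :
    A.periodicity ∈ cyclicCocycles C (n + 2) := by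
  let B : Cycle C (n + 2) := ⟨_, (A.tensor A').T, (A.tensor A').ρ.restrict⟩
  have hB : A.periodicity = B.character := by
    funext X c
    rw [← A.character_tensor_tensorOne A' h]
    exact congrArg ((A.tensor A').T.toFun _) ((A.tensor A').ρ.word_restrict c).symm
  rw [hB]
  exact B.character_mem_cyclicCocycles

theorem Cycle.isPeriodicity {n : ℕ} (A : Cycle.{u, v, a, b} C n)
    (A' : Cycle.{0, 0, a', b'} (SingleObj ℂ) 2) (h : A'.character = unitTwoCocycle) :
    IsPeriodicity.{u, v, a, b, a', b'} A.character A.periodicity :=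
  ⟨_, ⟨A, A', rfl, h, rfl⟩, by funext X c; exact (A.character_tensor_tensorOne A' h X c).symm⟩

universe a₁ b₁

theorem IsPeriodicity.eq_periodicity {n : ℕ} {φ : NerveFun C n} {χ : NerveFun C (n + 2)}
    (hχ : IsPeriodicity.{u, v, a, b, a', b'} φ χ) (A : Cycle.{u, v, a₁, b₁} C n)
    (hA : A.character = φ) : χ = A.periodicity := by
  obtain ⟨_, ⟨B, B', hB, h, rfl⟩, rfl⟩ := hχ
  rw [A.periodicity_congr B (hA.trans hB.symm)]
  funext X c
  exact B.character_tensor_tensorOne B' h X c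

end Character

/-! ## The cycles of a summable Fredholm module -/

namespace FredholmPair

open ContinuousLinearMap

variable {C : Type u} [Category.{v} C] [Preadditive C] [Linear ℂ C] (M : FredholmPair.{u, v, w} C)

theorem gradedComm_apply {X Y : C} (k : ℕ) (T : (M.H.obj X).carrier →L[ℂ] (M.H.obj Y).carrier)
    (x : (M.H.obj X).carrier) :
    M.gradedComm k T x = M.F Y (T x) - (-1 : ℂ) ^ k • T (M.F X x) := rfl

theorem F_F (X : C) (x : (M.H.obj X).carrier) : M.F X (M.F X x) = x :=
  congrArg (fun T => T x) (M.F_sq X)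

theorem F_ε (X : C) (x : (M.H.obj X).carrier) :
    M.F X ((M.H.obj X).ε x) = -(M.H.obj X).ε (M.F X x) :=
  congrArg (fun T => T x) (M.F_degree_one X)

theorem gradedComm_add {X Y : C} (k : ℕ) (S T : (M.H.obj X).carrier →L[ℂ] (M.H.obj Y).carrier) :
    M.gradedComm k (S + T) = M.gradedComm k S + M.gradedComm k T := by
  ext x
  simp only [gradedComm_apply, add_apply, map_add, smul_add]
  abel

theorem gradedComm_smul {X Y : C} (k : ℕ) (t : ℂ)
    (T : (M.H.obj X).carrier →L[ℂ] (M.H.obj Y).carrier) :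
    M.gradedComm k (t • T) = t • M.gradedComm k T := by
  ext x
  simp only [gradedComm_apply, smul_apply, map_smul, smul_sub, smul_comm t]

theorem gradedComm_zero {X Y : C} (k : ℕ) :
    M.gradedComm k (0 : (M.H.obj X).carrier →L[ℂ] (M.H.obj Y).carrier) = 0 := by
  simpa using M.gradedComm_smul (X := X) (Y := Y) k 0 0

theorem gradedComm_gradedComm {X Y : C} (k : ℕ)
    (T : (M.H.obj X).carrier →L[ℂ] (M.H.obj Y).carrier) :
    M.gradedComm (k + 1) (M.gradedComm k T) = 0 := by
  ext x
  rcases neg_one_pow_eq_or ℂ k with h | h <;>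
    simp [gradedComm_apply, F_F, pow_succ, h, add_comm]

theorem gradedComm_comp {X Y Z : C} (j i : ℕ)
    (S : (M.H.obj Y).carrier →L[ℂ] (M.H.obj Z).carrier)
    (T : (M.H.obj X).carrier →L[ℂ] (M.H.obj Y).carrier) :
    M.gradedComm (j + i) (S ∘L T) =
      M.gradedComm j S ∘L T + (-1 : ℂ) ^ j • (S ∘L M.gradedComm i T) := by
  ext x
  simp only [gradedComm_apply, add_apply, smul_apply, ContinuousLinearMap.comp_apply, map_sub,
    map_smul, pow_add, smul_sub, smul_smul]
  abel

/-- The operators of parity `k` which lie, together with their graded commutators with `F`, in the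
powers `k` and `k + 1` of the Schatten class `B^{r + 1}`. -/
def homSubmodule (r k : ℕ) (X Y : C) :
    Submodule ℂ ((M.H.obj X).carrier →L[ℂ] (M.H.obj Y).carrier) where
  carrier := {T | (M.H.obj Y).ε ∘L T = (-1 : ℂ) ^ k • (T ∘L (M.H.obj X).ε) ∧
    IsIdeal (r + 1) k T ∧ IsIdeal (r + 1) (k + 1) (M.gradedComm k T)}
  zero_mem' := ⟨by simp, isIdeal_zero r.succ_ne_zero _, by
    rw [gradedComm_zero]; exact isIdeal_zero r.succ_ne_zero _⟩
  add_mem' {S T} hS hT := ⟨by rw [comp_add, add_comp, smul_add, hS.1, hT.1], hS.2.1.add hT.2.1, by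
    rw [gradedComm_add]; exact hS.2.2.add hT.2.2⟩
  smul_mem' t T hT := ⟨by rw [comp_smul, smul_comp, hT.1, smul_comm], hT.2.1.smul t, by
    rw [gradedComm_smul]; exact hT.2.2.smul t⟩

variable {M} {r : ℕ}

theorem comp_mem_homSubmodule {X Y Z : C} {j i n : ℕ} (h : j + i = n)
    {S : (M.H.obj Y).carrier →L[ℂ] (M.H.obj Z).carrier}
    {T : (M.H.obj X).carrier →L[ℂ] (M.H.obj Y).carrier}
    (hS : S ∈ M.homSubmodule r j Y Z) (hT : T ∈ M.homSubmodule r i X Y) :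
    S ∘L T ∈ M.homSubmodule r n X Z := by
  subst h
  refine ⟨?_, hS.2.1.comp hT.2.1 rfl, ?_⟩
  · rw [← comp_assoc, hS.1, smul_comp, comp_assoc, hT.1, comp_smul, smul_smul, pow_add, comp_assoc]
  · rw [gradedComm_comp]
    exact (hS.2.2.comp hT.2.1 (by omega)).add ((hS.2.1.comp hT.2.2 (by omega)).smul _)

theorem gradedComm_mem_homSubmodule {X Y : C} {i j : ℕ} (h : i + 1 = j)
    {T : (M.H.obj X).carrier →L[ℂ] (M.H.obj Y).carrier} (hT : T ∈ M.homSubmodule r i X Y) :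
    M.gradedComm i T ∈ M.homSubmodule r j X Y := by
  subst h
  refine ⟨?_, hT.2.2, ?_⟩
  · ext x
    have h : ∀ x, (M.H.obj Y).ε (T x) = (-1 : ℂ) ^ i • T ((M.H.obj X).ε x) :=
      fun x => congrArg (fun T => T x) hT.1
    have h' : ∀ x, (M.H.obj Y).ε (M.F Y x) = -M.F Y ((M.H.obj Y).ε x) := fun x => by
      rw [F_ε, neg_neg]
    simp only [ContinuousLinearMap.comp_apply, smul_apply, neg_apply, gradedComm_apply, map_sub,
      map_smul, h, h', F_ε, map_neg, pow_succ, smul_sub, smul_smul, smul_neg, neg_smul, mul_neg, mul_one]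
    abel
  · rw [gradedComm_gradedComm]
    exact isIdeal_zero r.succ_ne_zero _

variable (M r)

/-- The DG-semicategory generated by the Fredholm module, with the differential `[F, ·]`. -/
def dgSemicategory : DGSemicategory.{u, w} where
  Obj := C
  Hom X Y k := M.homSubmodule r k X Y
  comp h := LinearMap.mk₂ ℂ (fun S T => ⟨S.1 ∘L T.1, comp_mem_homSubmodule h S.2 T.2⟩)
    (fun _ _ _ => Subtype.ext (add_comp _ _ _)) (fun _ _ _ => Subtype.ext (smul_comp _ _ _))
    (fun _ _ _ => Subtype.ext (comp_add _ _ _)) (fun _ _ _ => Subtype.ext (comp_smul _ _ _))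
  assoc _ _ _ _ _ _ _ := Subtype.ext (comp_assoc _ _ _)
  d {_ _ i _} h :=
    { toFun T := ⟨M.gradedComm i T.1, gradedComm_mem_homSubmodule h T.2⟩
      map_add' _ _ := Subtype.ext (M.gradedComm_add _ _ _)
      map_smul' _ _ := Subtype.ext (M.gradedComm_smul _ _ _) }
  d_d h _ _ := by subst h; exact Subtype.ext (M.gradedComm_gradedComm _ _)
  leibniz h _ _ _ _ _ _ _ := by subst h; exact Subtype.ext (M.gradedComm_comp _ _ _ _)

variable {M r}

theorem isTraceClass_comp {X Y : C} {k : ℕ} (hk : r + 1 ≤ k)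
    (A : (M.H.obj Y).carrier →L[ℂ] (M.H.obj X).carrier) (T : M.homSubmodule r k X Y) :
    IsTraceClass (A ∘L T.1) :=
  ((isIdeal_bounded r.succ_ne_zero A).comp T.2.2.1 rfl).isTraceClass r.succ_ne_zero (by omega)

/-- Here `T` itself is of trace class, so `Tr_s(T) = ½ (Tr(εT) - Tr(εFTF))` can be split, and
cyclicity with `FεF = -ε` makes the two halves equal. -/
theorem superTrace_eq_opTrace {k : ℕ} (hk : r + 1 ≤ k) (hk₂ : Even k) {X : C}
    (T : M.homSubmodule r k X X) : M.superTrace k T.1 = opTrace ((M.H.obj X).ε ∘L T.1) := by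
  have h₁ : opTrace (((M.H.obj X).ε ∘L M.F X ∘L T.1) ∘L M.F X) =
      opTrace (M.F X ∘L ((M.H.obj X).ε ∘L M.F X ∘L T.1)) :=
    opTrace_comp_comm (j := 0) r.succ_ne_zero hk
      ((isIdeal_bounded r.succ_ne_zero _).comp ((isIdeal_bounded r.succ_ne_zero _).comp T.2.2.1
        (zero_add k)) (zero_add k)) (isIdeal_bounded r.succ_ne_zero _)
  have h₂ : M.F X ∘L ((M.H.obj X).ε ∘L M.F X ∘L T.1) = -((M.H.obj X).ε ∘L T.1) := by
    ext x
    simp [F_ε, F_F]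
  have h₃ : (M.H.obj X).ε ∘L M.F X ∘L M.gradedComm k T.1 =
      (M.H.obj X).ε ∘L T.1 + (-1 : ℂ) • (((M.H.obj X).ε ∘L M.F X ∘L T.1) ∘L M.F X) := by
    ext x
    simp [gradedComm_apply, F_F, hk₂.neg_one_pow, sub_eq_add_neg]
  have h₄ : IsTraceClass (((M.H.obj X).ε ∘L M.F X ∘L T.1) ∘L M.F X) :=
    (((isIdeal_bounded r.succ_ne_zero _).comp ((isIdeal_bounded r.succ_ne_zero _).comp T.2.2.1
      rfl) rfl).comp (isIdeal_bounded r.succ_ne_zero _) rfl).isTraceClass r.succ_ne_zero (by omega)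
  rw [superTrace, h₃, opTrace_add (isTraceClass_comp hk _ T) (h₄.smul _), opTrace_smul, h₁, h₂,
    opTrace_neg]
  ring

/-- Cyclicity moves `y` to the front. Passing `ε` through `y` gives the sign `(-1)ʲ`, and `(-1)ʲ y F
= F y - [F, y]`; the commutator is the correction term. -/
theorem opTrace_εF_comp_comm {X Y : C} {i j k : ℕ} (h : i + j = k) (h' : j + i = k)
    (hk : r + 1 ≤ k) (x : M.homSubmodule r i Y X) (y : M.homSubmodule r j X Y) :
    opTrace (((M.H.obj X).ε ∘L M.F X) ∘L (x.1 ∘L y.1)) =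
      opTrace (((M.H.obj Y).ε ∘L M.F Y) ∘L (y.1 ∘L x.1)) -
        opTrace ((M.H.obj Y).ε ∘L (M.gradedComm j y.1 ∘L x.1)) := by
  have h₁ := opTrace_comp_comm r.succ_ne_zero (by omega : r + 1 ≤ i + j)
    ((isIdeal_bounded r.succ_ne_zero ((M.H.obj X).ε ∘L M.F X)).comp x.2.2.1 (zero_add i)) y.2.2.1
  have h₂ : ∀ x, (M.H.obj Y).ε (y.1 x) = (-1 : ℂ) ^ j • y.1 ((M.H.obj X).ε x) :=
    fun x => congrArg (fun T => T x) y.2.1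
  have h₃ : y.1 ∘L (((M.H.obj X).ε ∘L M.F X) ∘L x.1) =
      ((M.H.obj Y).ε ∘L M.F Y) ∘L (y.1 ∘L x.1) +
        (-1 : ℂ) • ((M.H.obj Y).ε ∘L (M.gradedComm j y.1 ∘L x.1)) := by
    ext z
    have hj : (-1 : ℂ) ^ j * (-1) ^ j = 1 := by rw [← mul_pow]; simp
    simp only [ContinuousLinearMap.comp_apply, add_apply, neg_apply, gradedComm_apply,
      map_sub, map_smul, h₂, smul_smul, hj, one_smul, neg_one_smul]
    abel
  rw [← comp_assoc, h₁, h₃, opTrace_add, opTrace_smul]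
  · ring
  · exact isTraceClass_comp (X := Y) (Y := Y) hk _ ⟨_, comp_mem_homSubmodule h' y.2 x.2⟩
  · exact (isTraceClass_comp (X := Y) (Y := Y) (by omega : r + 1 ≤ k + 1) _
      ⟨_, comp_mem_homSubmodule (by omega) (gradedComm_mem_homSubmodule rfl y.2) x.2⟩).smul _

end FredholmPair

/-! ## A cycle with character `ψ` -/

section Swap

/-- The flip of the two factors of `ℂ × ℂ`. -/
def swapEquiv : (ℂ × ℂ) ≃ₐ[ℂ] (ℂ × ℂ) :=
  AlgEquiv.ofRingEquiv (f := RingEquiv.prodComm) fun _ => rfl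

theorem swapEquiv_apply (x : ℂ × ℂ) : swapEquiv x = x.swap := rfl

theorem swapEquiv_sq : swapEquiv ^ 2 = 1 := rfl

theorem swapEquiv_pow_of_even {j : ℕ} (hj : Even j) : swapEquiv ^ j = 1 := by
  obtain ⟨k, rfl⟩ := hj
  rw [← two_mul, pow_mul, swapEquiv_sq, one_pow]

theorem swapEquiv_pow_of_odd {j : ℕ} (hj : Odd j) : swapEquiv ^ j = swapEquiv := by
  obtain ⟨k, rfl⟩ := hj
  rw [pow_succ, pow_mul, swapEquiv_sq, one_pow, one_mul]

/-- The graded algebra of polynomials in `F` with coefficients in `ℂ × ℂ` and with `F x = x.swap F`,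
and its derivation which is the graded commutator with `F`, up to the identification `F² = 1`. -/
def swapDGSemicategory : DGSemicategory.{0, 0} where
  Obj := Unit
  Hom _ _ _ := ℂ × ℂ
  -- A pair `x` in degree `k` stands for `x Fᵏ`, so moving `Fʲ` past the second factor applies the
  -- flip `j` times.
  comp {_ _ _ j _ _} _ := (LinearMap.mul ℂ (ℂ × ℂ)).compl₂ (swapEquiv ^ j).toLinearMap
  assoc {_ _ _ _ k j _ _ _ _} h₁ _ _ _ h g f := by
    subst h₁
    change h * (swapEquiv ^ k) g * (swapEquiv ^ (k + j)) f =
      h * (swapEquiv ^ k) (g * (swapEquiv ^ j) f)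
    rw [pow_add, AlgEquiv.mul_apply, map_mul, mul_assoc]
  d {_ _ i _} _ := swapEquiv.toLinearMap - (-1 : ℂ) ^ i • LinearMap.id
  d_d {_ _ i _ _} h₁ _ f := by
    subst h₁
    change (f.swap - (-1 : ℂ) ^ i • f).swap - (-1 : ℂ) ^ (i + 1) • (f.swap - (-1 : ℂ) ^ i • f) = 0
    have hi : (-1 : ℂ) ^ i * (-1) ^ i = 1 := by rw [← mul_pow]; simp
    ext <;> simp [pow_succ, mul_sub, ← mul_assoc, hi]
  leibniz {_ _ _ j i _ _ _ _} h _ hj _ _ _ g f := by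
    subst h hj
    change (g * (swapEquiv ^ j) f).swap - (-1 : ℂ) ^ (j + i) • (g * (swapEquiv ^ j) f) =
      (g.swap - (-1 : ℂ) ^ j • g) * (swapEquiv ^ (j + 1)) f +
        (-1 : ℂ) ^ j • (g * (swapEquiv ^ j) (f.swap - (-1 : ℂ) ^ i • f))
    rw [pow_succ, AlgEquiv.mul_apply, swapEquiv_apply]
    rcases Nat.even_or_odd j with hj | hj
    · rw [swapEquiv_pow_of_even hj, pow_add, hj.neg_one_pow]
      ext <;> simp <;> ring
    · rw [swapEquiv_pow_of_odd hj, pow_add, hj.neg_one_pow]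
      ext <;> simp [swapEquiv_apply] <;> ring

/-- The closed graded trace `(x, y) ↦ y - x`. -/
def swapTrace : ClosedGradedTrace swapDGSemicategory 2 where
  toFun _ := LinearMap.snd ℂ ℂ ℂ - LinearMap.fst ℂ ℂ ℂ
  closed _ k h f := by
    obtain rfl : k = 1 := by omega
    obtain ⟨x, y⟩ : ℂ × ℂ := f
    change (x - (-1 : ℂ) ^ 1 * y) - (y - (-1 : ℂ) ^ 1 * x) = 0
    ring
  graded {_ _ i j} h₁ h₂ g g' := by
    obtain ⟨x, y⟩ : ℂ × ℂ := g
    obtain ⟨x', y'⟩ : ℂ × ℂ := g'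
    obtain ⟨rfl, rfl⟩ | ⟨rfl, rfl⟩ | ⟨rfl, rfl⟩ :
      i = 0 ∧ j = 2 ∨ i = 1 ∧ j = 1 ∨ i = 2 ∧ j = 0 := by omega
    · change y * y' - x * x' = (-1 : ℂ) ^ (0 * 2) * (y' * y - x' * x)
      ring
    · change y * x' - x * y' = (-1 : ℂ) ^ (1 * 1) * (y' * x - x' * y)
      ring
    · change y * y' - x * x' = (-1 : ℂ) ^ (2 * 0) * (y' * y - x' * x)
      ring

/-- The cycle over `ℂ` with character `ψ`. -/
def unitCycle : Cycle.{0, 0, 0, 0} (SingleObj ℂ) 2 where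
  S := swapDGSemicategory
  T := swapTrace
  ρ :=
    { obj _ := ()
      -- The semifunctor must not be unital: `1` goes to the idempotent `(1, 0)`, whose differential
      -- is nonzero, whereas `(1, 1)` is closed.
      map {_ _} := LinearMap.inl ℂ ℂ ℂ
      map_comp f g := by
        change (((show ℂ from g) * (show ℂ from f) : ℂ), (0 : ℂ)) =
          ((show ℂ from g), 0) * ((show ℂ from f), 0)
        simp }

theorem character_unitCycle : unitCycle.character = unitTwoCocycle := by
  funext X c
  obtain _ | ⟨x, c⟩ := c
  obtain _ | ⟨y, c⟩ := c
  obtain ⟨z⟩ := c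
  change ℂ at x y z
  change (0 : ℂ) * _ - x * (((0 : ℂ) - (-1) ^ 0 * y) * (z - (-1) ^ 0 * 0)) = x * y * z
  ring

end Swap

/-! ### Closed graded traces and transgression of a Fredholm module -/

namespace FredholmPair

open ContinuousLinearMap

variable {C : Type u} [Category.{v} C] [Preadditive C] [Linear ℂ C] (M : FredholmPair.{u, v, w} C)
variable {r n : ℕ}

/-- `T ↦ Tr(ε F T)`. -/
def traceεF {k : ℕ} (hk : r + 1 ≤ k) (X : C) : M.homSubmodule r k X X →ₗ[ℂ] ℂ where
  toFun T := opTrace (((M.H.obj X).ε ∘L M.F X) ∘L T.1)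
  map_add' S T := by
    rw [← opTrace_add (isTraceClass_comp hk _ S) (isTraceClass_comp hk _ T), ← comp_add]
    rfl
  map_smul' t T := by
    rw [RingHom.id_apply, smul_eq_mul, ← opTrace_smul, ← comp_smul]
    rfl

variable {M}

theorem superTrace_gradedComm {X : C} (k : ℕ) (T : (M.H.obj X).carrier →L[ℂ] (M.H.obj X).carrier) :
    M.superTrace (k + 1) (M.gradedComm k T) = 0 := by
  rw [superTrace, gradedComm_gradedComm, comp_zero, comp_zero]
  simpa using opTrace_smul 0 (0 : (M.H.obj X).carrier →L[ℂ] (M.H.obj X).carrier)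

/-- The correction in `opTrace_εF_comp_comm` vanishes since `[F, [F, y]] = 0`. This alone makes
`Tr_s` a graded trace, even in dimension `n = r` where its argument need not be of trace class. -/
theorem opTrace_comp_gradedComm {X Y : C} {i j k : ℕ} (h : i + (j + 1) = k) (hk : r + 1 ≤ k)
    (x : M.homSubmodule r i Y X) (y : M.homSubmodule r j X Y) :
    opTrace (((M.H.obj X).ε ∘L M.F X) ∘L (x.1 ∘L M.gradedComm j y.1)) =
      opTrace (((M.H.obj Y).ε ∘L M.F Y) ∘L (M.gradedComm j y.1 ∘L x.1)) := by
  rw [opTrace_εF_comp_comm h (by omega) hk x ⟨_, gradedComm_mem_homSubmodule rfl y.2⟩,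
    gradedComm_gradedComm, zero_comp, comp_zero]
  simpa using opTrace_smul 0 (0 : (M.H.obj Y).carrier →L[ℂ] (M.H.obj Y).carrier)

theorem superTrace_comp {X Y : C} {i j : ℕ} (h : i + j = n) (hr : r ≤ n)
    (x : M.homSubmodule r i Y X) (y : M.homSubmodule r j X Y) :
    M.superTrace n (x.1 ∘L y.1) =
      (1 / 2) * (opTrace (((M.H.obj X).ε ∘L M.F X) ∘L (M.gradedComm i x.1 ∘L y.1)) +
        (-1 : ℂ) ^ i * opTrace (((M.H.obj X).ε ∘L M.F X) ∘L (x.1 ∘L M.gradedComm j y.1))) := by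
  subst h
  rw [superTrace, gradedComm_comp, ← comp_assoc, comp_add, comp_smul, opTrace_add, opTrace_smul]
  · exact isTraceClass_comp (X := X) (Y := X) (by omega : r + 1 ≤ i + j + 1) _
      ⟨_, comp_mem_homSubmodule (by omega) (gradedComm_mem_homSubmodule rfl x.2) y.2⟩
  · exact (isTraceClass_comp (X := X) (Y := X) (by omega : r + 1 ≤ i + j + 1) _
      ⟨_, comp_mem_homSubmodule (by omega) x.2 (gradedComm_mem_homSubmodule rfl y.2)⟩).smul _

/-- Expand both sides by Leibniz and rotate each commutator to the front: the same two terms appear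
with swapped coefficients. As `n` is even, `i` and `j` have equal parity, so the ratio is `(-1)ⁱ =
(-1)^{ij}`. -/
theorem superTrace_comp_comm {X Y : C} {i j : ℕ} (h : i + j = n) (hn : Even n) (hr : r ≤ n)
    (x : M.homSubmodule r i Y X) (y : M.homSubmodule r j X Y) :
    M.superTrace n (x.1 ∘L y.1) = (-1 : ℂ) ^ (i * j) * M.superTrace n (y.1 ∘L x.1) := by
  rw [superTrace_comp h hr, superTrace_comp (by omega) hr,
    opTrace_comp_gradedComm (by omega : i + (j + 1) = n + 1) (by omega),
    opTrace_comp_gradedComm (by omega : j + (i + 1) = n + 1) (by omega)]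
  rcases Nat.even_or_odd i with hi | hi
  · have hj : Even j := (Nat.even_add.1 (h ▸ hn)).1 hi
    rw [hi.neg_one_pow, hj.neg_one_pow, (hi.mul_right j).neg_one_pow]
    ring
  · have hj : Odd j := by
      rw [← Nat.not_even_iff_odd] at hi ⊢
      exact fun hj => hi ((Nat.even_add.1 (h ▸ hn)).2 hj)
    rw [hi.neg_one_pow, hj.neg_one_pow, (hi.mul hj).neg_one_pow]
    ring

theorem opTrace_εF_comp_comm_eq_sub_superTrace {X Y : C} {i j : ℕ} (h : i + j = n + 1)
    (h' : j + i = n + 1) (hn' : j + 1 + i = n + 2) (hn : Even n) (hr : r ≤ n) (x : M.homSubmodule r i Y X)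
    (y : M.homSubmodule r j X Y) :
    opTrace (((M.H.obj X).ε ∘L M.F X) ∘L (x.1 ∘L y.1)) =
      opTrace (((M.H.obj Y).ε ∘L M.F Y) ∘L (y.1 ∘L x.1)) -
        M.superTrace (n + 2) (M.gradedComm j y.1 ∘L x.1) := by
  rw [opTrace_εF_comp_comm h h' (Nat.succ_le_succ hr) x y, superTrace_eq_opTrace
    (by omega : r + 1 ≤ n + 2) (hn.add even_two)
    ⟨_, comp_mem_homSubmodule hn' (gradedComm_mem_homSubmodule rfl y.2) x.2⟩]

variable (M)

/-- `Tr_s` as a linear form on the operators of degree `n ≥ r`. -/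
def superTraceForm (hr : r ≤ n) (X : C) : M.homSubmodule r n X X →ₗ[ℂ] ℂ where
  toFun T := M.superTrace n T.1
  map_add' S T := by
    have h : ∀ T : M.homSubmodule r n X X,
        IsTraceClass ((M.H.obj X).ε ∘L M.F X ∘L M.gradedComm n T.1) := fun T =>
      isTraceClass_comp (by omega : r + 1 ≤ n + 1) ((M.H.obj X).ε ∘L M.F X)
        ⟨_, gradedComm_mem_homSubmodule rfl T.2⟩
    unfold superTrace
    rw [Submodule.coe_add, gradedComm_add, comp_add, comp_add, opTrace_add (h S) (h T), mul_add]
  map_smul' t T := by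
    unfold superTrace
    rw [Submodule.coe_smul, gradedComm_smul, comp_smul, comp_smul, opTrace_smul, RingHom.id_apply,
      smul_eq_mul, mul_left_comm]

/-- The closed graded trace `Tr_s` in an even dimension `n ≥ r`. -/
def closedGradedTrace (hn : Even n) (hr : r ≤ n) : ClosedGradedTrace (M.dgSemicategory r) n where
  toFun X := M.superTraceForm hr X
  closed X k h f := by
    subst h
    exact superTrace_gradedComm k f.1
  graded h₁ _ g g' := superTrace_comp_comm h₁ hn hr g g'

/-- The transgression `T ↦ Tr(ε F T)` between the closed graded traces in the dimensions `n` and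
`n + 2`. -/
def transgression (hn : Even n) (hr : r ≤ n) :
    Transgression (M.closedGradedTrace hn hr)
      (M.closedGradedTrace (hn.add even_two) (hr.trans (Nat.le_add_right n 2))) where
  τ X := M.traceεF (Nat.succ_le_succ hr) X
  toFun_eq X x := rfl
  comp_comm h h' hj hn' x y := by
    subst hj
    exact opTrace_εF_comp_comm_eq_sub_superTrace h h' hn' hn hr x y

variable {M}

theorem op_mem_homSubmodule
    (hM : ∀ {X Y : C} (f : X ⟶ Y), IsIdeal (r + 1) 1 (M.gradedComm 0 (M.op f)))
    {X Y : C} (f : X ⟶ Y) : M.op f ∈ M.homSubmodule r 0 X Y :=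
  ⟨by rw [pow_zero, one_smul]; exact M.H_degree_zero f, isIdeal_bounded r.succ_ne_zero _, hM f⟩

/-- `f ↦ H(f)` as a linear map to the operators of degree `0`. -/
def opHom (hM : ∀ {X Y : C} (f : X ⟶ Y), IsIdeal (r + 1) 1 (M.gradedComm 0 (M.op f))) (X Y : C) :
    (X ⟶ Y) →ₗ[ℂ] M.homSubmodule r 0 X Y where
  toFun f := ⟨M.op f, op_mem_homSubmodule hM f⟩
  map_add' _ _ := Subtype.ext (M.additive.map_add)
  map_smul' t f := Subtype.ext (M.linear.map_smul f t)

/-- The semifunctor `f ↦ H(f)`. -/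
def semifunctor (hM : ∀ {X Y : C} (f : X ⟶ Y), IsIdeal (r + 1) 1 (M.gradedComm 0 (M.op f))) :
    LinearSemifunctor C (M.dgSemicategory r) where
  obj X := X
  map {X Y} := opHom hM X Y
  map_comp f g := Subtype.ext (M.H.map_comp f g)

section Cycle

variable (hM : ∀ {X Y : C} (f : X ⟶ Y), IsIdeal (r + 1) 1 (M.gradedComm 0 (M.op f)))

theorem coe_dWord : ∀ {n : ℕ} {X Y : C} (c : Chain n X Y),
    ((semifunctor hM).dWord c : M.homSubmodule r (n + 1) Y X).1 = M.commProd c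
  | 0, _, _, .single _ => rfl
  | _ + 1, _, _, .cons f c => congrArg (M.gradedComm 0 (M.op f) ∘L ·) (coe_dWord c)

theorem coe_word : ∀ {n : ℕ} {X Y : C} (c : Chain n X Y),
    ((semifunctor hM).word c : M.homSubmodule r n Y X).1 = M.charOp c
  | 0, _, _, .single _ => rfl
  | _ + 1, _, _, .cons f c => congrArg (M.op f ∘L ·) (coe_dWord hM c)

theorem isIdeal_gradedComm_charOp
    (hM : ∀ {X Y : C} (f : X ⟶ Y), IsIdeal (r + 1) 1 (M.gradedComm 0 (M.op f)))
    {X Y : C} (c : Chain n X Y) :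
    IsIdeal (r + 1) (n + 1) (M.gradedComm n (M.charOp c)) := by
  rw [← coe_word hM c]
  exact ((semifunctor hM).word c : M.homSubmodule r n Y X).2.2.2

/-- The `n`-dimensional cycle of a Fredholm module, for even `n ≥ r`. -/
def cycle (hn : Even n) (hr : r ≤ n) : Cycle.{u, v, u, w} C n :=
  ⟨_, M.closedGradedTrace hn hr, semifunctor hM⟩

theorem character_cycle (hn : Even n) (hr : r ≤ n) : (cycle hM hn hr).character = M.character n := by
  funext X c
  exact congrArg (M.superTrace n) (coe_word hM c)

/-- Half of `two_mul_add_hochschild`: the coefficient is half the number `n + 2` of terms in the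
alternating word, and `-½` times the transgression cochain has the difference as its coboundary. -/
theorem periodicity_cycle (hn : Even n) (hr : r ≤ n) :
    (cycle hM hn hr).periodicity = -((n : ℂ) / 2 + 1) • M.character (n + 2) +
      hochschild (n + 1)
        (-(1 / 2 : ℂ) • (M.transgression hn hr).cochain (semifunctor hM)) := by
  funext X c
  have h₁ : M.character (n + 2) X c = (M.closedGradedTrace (hn.add even_two)
      (hr.trans (Nat.le_add_right n 2))).toFun _ ((semifunctor hM).word c) :=
    (congrArg (M.superTrace (n + 2)) (coe_word hM c)).symm
  obtain _ | ⟨f, c⟩ := c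
  have h₂ := (M.transgression hn hr).two_mul_add_hochschild (semifunctor hM) hn f c
  rw [← h₁] at h₂
  rw [map_smul]
  change (M.closedGradedTrace hn hr).toFun _ ((M.dgSemicategory r).comp (zero_add n)
    ((semifunctor hM).map f) ((semifunctor hM).pairWord c)) =
    -((n : ℂ) / 2 + 1) * M.character (n + 2) X _ + -(1 / 2 : ℂ) * hochschild (n + 1) _ X _
  linear_combination (1 / 2 : ℂ) * h₂

end Cycle

end FredholmPair

end CatFredholm

end

open CatFredholm FredholmPair

/-- Let `(H, F)` be a `p`-summable even Fredholm module over a small `ℂ`-linear category `C`, and let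
`2m ≥ p - 1`. The operators entering the definitions of `φ²ᵐ` and `φ²ᵐ⁺²` are of trace class, `φ²ᵐ`
and `φ²ᵐ⁺²` are cyclic cocycles, `S(φ²ᵐ) = φ²ᵐ # ψ` exists as a cyclic cocycle, does not depend on
the cycles by which `φ²ᵐ` and `ψ` are represented, and `S(φ²ᵐ) = -(m + 1) φ²ᵐ⁺²` in
`H_λ^{2m+2}(C)`. -/
theorem theorem7p4 {C : Type u} [Category.{v} C] [Preadditive C] [Linear ℂ C]
    (M : CatFredholm.FredholmPair.{u, v, w} C) (p : ℝ) (hp : 1 ≤ p) (hM : M.IsSummable p)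
    (m : ℕ) (hm : p - 1 ≤ 2 * (m : ℝ)) :
    (∀ (X : C) (c : CatFredholm.Chain (2 * m) X X),
      CatFredholm.IsSchatten 1 (M.gradedComm (2 * m) (M.charOp c))) ∧
    (∀ (X : C) (c : CatFredholm.Chain (2 * m + 2) X X),
      CatFredholm.IsSchatten 1 (M.gradedComm (2 * m + 2) (M.charOp c))) ∧
    M.character (2 * m) ∈ CatFredholm.cyclicCocycles C (2 * m) ∧
    ∃ (h : M.character (2 * m + 2) ∈ CatFredholm.cyclicCocycles C (2 * m + 2))
      (Sφ : CatFredholm.NerveFun C (2 * m + 2))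
      (hS : Sφ ∈ CatFredholm.cyclicCocycles C (2 * m + 2)),
      CatFredholm.IsPeriodicity.{u, v, u, w, 0, 0} (M.character (2 * m)) Sφ ∧
      (∀ χ : CatFredholm.NerveFun C (2 * m + 2),
        CatFredholm.IsPeriodicity.{u, v, a, b, a', b'} (M.character (2 * m)) χ → χ = Sφ) ∧
      CatFredholm.cyclicClass Sφ hS =
        -((m : ℂ) + 1) • CatFredholm.cyclicClass (M.character (2 * m + 2)) h := by
  -- The integer exponent is `q = 2m + 1`, which is at least `p` by `2m ≥ p - 1`. With `r = 2m`, one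
  -- DG-semicategory carries both traces.
  have hI : ∀ {X Y : C} (f : X ⟶ Y), IsIdeal (2 * m + 1) 1 (M.gradedComm 0 (M.op f)) := fun f =>
    (hM f).isIdeal (by linarith) (by push_cast; linarith)
  have hn : Even (2 * m) := even_two_mul m
  have hn' : Even (2 * m + 2) := hn.add even_two
  have h₀ := character_cycle hI hn le_rfl
  have h₂ := character_cycle hI hn' (Nat.le_add_right _ 2)
  have hψ := character_unitCycle
  have hφ : M.character (2 * m + 2) ∈ cyclicCocycles C (2 * m + 2) :=
    h₂ ▸ (cycle hI hn' (Nat.le_add_right _ 2)).character_mem_cyclicCocycles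
  refine ⟨fun X c => ((isIdeal_gradedComm_charOp hI c).isTraceClass (Nat.succ_ne_zero _)
      le_rfl).isSchatten,
    fun X c => ((isIdeal_gradedComm_charOp hI c).isTraceClass (Nat.succ_ne_zero _)
      (by omega)).isSchatten,
    h₀ ▸ (cycle hI hn le_rfl).character_mem_cyclicCocycles, hφ, (cycle hI hn le_rfl).periodicity,
    (cycle hI hn le_rfl).periodicity_mem_cyclicCocycles unitCycle hψ,
    h₀ ▸ (cycle hI hn le_rfl).isPeriodicity unitCycle hψ,
    fun χ hχ => hχ.eq_periodicity (cycle hI hn le_rfl) h₀, ?_⟩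
  refine (Submodule.Quotient.eq _).2 ?_
  -- The primitive must itself be cyclic for the two classes to agree in `H_λ`; the coboundary
  -- identity alone would only compare Hochschild classes.
  refine ⟨-(1 / 2 : ℂ) • (M.transgression hn le_rfl).cochain (semifunctor hI),
    Submodule.smul_mem _ _ ((M.transgression hn le_rfl).cochain_mem_cyclicCochains _ hn), ?_⟩
  have h := periodicity_cycle hI hn le_rfl
  rw [Nat.cast_mul, Nat.cast_two, mul_div_cancel_left₀ _ (two_ne_zero' ℂ)] at h
  exact eq_sub_of_add_eq' h.symm
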